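/- **Definitions.** A *finite ringed poset* $X$ is a finite poset with a functor $x\mapsto\mathcal O_{X,x}$ from it to commutative rings (restriction maps $\mathcal O_{X,x}\to\mathcal O_{X,y}$ for $x\le y$). A morphism $f\colon X\to Y$ is a monotone map with ring homomorphisms $f^\sharp_x\colon\mathcal O_{Y,f(x)}\to\mathcal O_{X,x}$ compatible with restrictions. Put $\operatorname{Spec}(X)=\operatorname{colim}_{x\in X}\operatorname{Spec}(\mathcal O_{X,x})$, the colimit being taken in locally ringed spaces; this is functorial in $X$. The fibered product $X\times_YZ$ has as points the pairs $(x,z)$ with the same image $y$ in $Y$, ordered componentwise, and stalks $\mathcal O_{X,x}\otimes_{\mathcal O_{Y,y}}\mathcal O_{Z,z}$; similarly for finite families. * $X$ is *schematic* if its restriction maps are flat and, for all $t\le x,y$, the natural map $\mathcal O_{X,x}\otimes_{\mathcal O_{X,t}}\mathcal O_{X,y}\to\prod_{z\ge x,y}\mathcal O_{X,z}$ is faithfully flat. * A morphism $f\colon X\to Y$ is *schematic* if for all $x\in X$ and $y\ge f(x)$ the natural map $\mathcal O_{X,x}\otimes_{\mathcal O_{Y,f(x)}}\mathcal O_{Y,y}\to\prod_{z\ge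 x,\ f(z)\ge y}\mathcal O_{X,z}$ induces a surjection on prime spectra. It is *flat* if every $f^\sharp_x$ is flat. It is a *qc-isomorphism* if $\operatorname{Spec}(f)$ is an isomorphism. A *flat immersion* is a flat schematic morphism whose diagonal $X\to X\times_YX$ is a qc-isomorphism. * A finite family of flat immersions $\{f_i\colon U_i\to X\}_{i\in I}$ is a *covering* if the maps $\operatorname{Spec}(U_i)\to\operatorname{Spec}(X)$ are jointly surjective. * The *nerve datum* $\mathcal U$ of a finite family $\{f_i\colon U_i\to X\}_{i\in I}$ assigns to each non-empty subset $\Delta\subseteq I$ the fibered product $\mathcal U(\Delta)$ over $X$ of the $U_i$, $i\in\Delta$, and to each inclusion $\Delta\subseteq\Delta'$ the projection $\pi_{\Delta\Delta'}\colon\mathcal U(\Delta')\to\mathcal U(\Delta)$. Its *cylinder* $\operatorname{Cyl}(\mathcal U)$ is the finite ringed poset with underlying set $\coprod_\Delta|\mathcal U(\Delta)|$, where for $a\in\mathcal U(\Delta)$, $b\in\mathcal U(\Delta')$ one has $a\le b$ if and only if $\Delta\subseteq\Delta'$ and $a\le\pi_{\Delta\Delta'}(b)$ in $\mathcal U(\Delta)$;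 its stalk at $a$ is $\mathcal O_{\mathcal U(\Delta),a}$, and its restriction map along $a\le b$ is $\mathcal O_{\mathcal U(\Delta),a}\to\mathcal O_{\mathcal U(\Delta),\pi_{\Delta\Delta'}(b)}\to\mathcal O_{\mathcal U(\Delta'),b}$. The structure morphisms $\mathcal U(\Delta)\to X$ induce a morphism $\operatorname{Cyl}(\mathcal U)\to X$. **Statement.** Let $X$ and $U_i$ ($i\in I$, $I$ finite) be schematic finite ringed posets and let $\{f_i\colon U_i\to X\}_{i\in I}$ be a family of flat immersions with nerve datum $\mathcal U$. Then $\operatorname{Cyl}(\mathcal U)$ is schematic, and the morphism $\operatorname{Cyl}(\mathcal U)\to X$ is a flat immersion (in particular a schematic morphism). It is a qc-isomorphism if and only if the family $\{f_i\}_{i\in I}$ is a covering. -/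

import Mathlib

open CategoryTheory CategoryTheory.Limits AlgebraicGeometry Opposite

universe u v w

/-- A `C`-datum: a finite poset together with a functor from it to `C`. For `C = CommRingCat`
this is a finite ringed poset, the value of the functor at `x` being the stalk `𝒪_{X, x}`. -/
structure PosetDatum (C : Type v) [Category.{w} C] where
  carrier : Type u
  [partialOrder : PartialOrder carrier]
  [finite : Finite carrier]
  obj : carrier ⥤ C

namespace PosetDatum

attribute [instance] PosetDatum.partialOrder PosetDatum.finite

section General

variable {C : Type v} [Category.{w} C]

/-- The restriction morphism from the value at `x` to the value at `y`, for `x ≤ y`. -/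
abbrev res (X : PosetDatum.{u} C) {x y : X.carrier} (h : x ≤ y) : X.obj.obj x ⟶ X.obj.obj y :=
  X.obj.map (homOfLE h)

theorem res_self (X : PosetDatum.{u} C) {x : X.carrier} (h : x ≤ x) : X.res h = 𝟙 _ :=
  X.obj.map_id x

theorem res_comp (X : PosetDatum.{u} C) {x y z : X.carrier} (h : x ≤ y) (h' : y ≤ z) :
    X.res h ≫ X.res h' = X.res (h.trans h') :=
  (X.obj.map_comp (homOfLE h) (homOfLE h')).symm

/-- A morphism `(X, 𝓕) ⟶ (Y, 𝓖)` of `C`-data: a monotone map `f : X → Y` and a natural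
transformation `f⁻¹ 𝓖 ⟶ 𝓕`, given by its components. -/
structure Hom (X Y : PosetDatum.{u} C) where
  base : X.carrier → Y.carrier
  mono : Monotone base
  sharp : ∀ x : X.carrier, Y.obj.obj (base x) ⟶ X.obj.obj x
  naturality : ∀ {x x' : X.carrier} (h : x ≤ x'),
    Y.res (mono h) ≫ sharp x' = sharp x ≫ X.res h

theorem Hom.ext_of_base {X Y : PosetDatum.{u} C} {f g : Hom X Y} (h : ∀ x, f.base x = g.base x)
    (h' : ∀ x, f.sharp x = Y.res (h x).le ≫ g.sharp x) : f = g := by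
  obtain ⟨fb, fm, fs, fn⟩ := f
  obtain ⟨gb, gm, gs, gn⟩ := g
  obtain rfl : fb = gb := funext h
  obtain rfl : fs = gs := by
    funext x
    have := h' x
    simp only [res_self, Category.id_comp] at this
    exact this
  rfl

instance : Category (PosetDatum.{u} C) where
  Hom := Hom
  id X :=
    { base := id
      mono := monotone_id
      sharp := fun _ => 𝟙 _
      naturality := fun _ => by simp }
  comp {X Y Z} f g :=
    { base := g.base ∘ f.base
      mono := g.mono.comp f.mono
      sharp := fun x => g.sharp (f.base x) ≫ f.sharp x
      naturality := fun {x x'} h => by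
        have h1 := g.naturality (f.mono h)
        have h2 := f.naturality h
        simp only [Category.assoc, ← h2]
        rw [← Category.assoc, ← Category.assoc, ← h1] }
  id_comp f := by
    cases f
    congr 1
    funext x
    exact Category.comp_id _
  comp_id f := by
    cases f
    congr 1
    funext x
    exact Category.id_comp _
  assoc f g h := by
    congr 1
    funext x
    exact (Category.assoc _ _ _).symm

@[simp] theorem id_base (X : PosetDatum.{u} C) (x : X.carrier) : Hom.base (𝟙 X) x = x := rfl

@[simp] theorem id_sharp (X : PosetDatum.{u} C) (x : X.carrier) :
    Hom.sharp (𝟙 X) x = 𝟙 _ := rfl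

@[simp] theorem comp_base {X Y Z : PosetDatum.{u} C} (f : X ⟶ Y) (g : Y ⟶ Z) (x : X.carrier) :
    Hom.base (f ≫ g) x = g.base (f.base x) := rfl

@[simp] theorem comp_sharp {X Y Z : PosetDatum.{u} C} (f : X ⟶ Y) (g : Y ⟶ Z) (x : X.carrier) :
    Hom.sharp (f ≫ g) x = g.sharp (f.base x) ≫ f.sharp x := rfl

theorem hom_ext {X Y : PosetDatum.{u} C} {f g : X ⟶ Y} (h : ∀ x, f.base x = g.base x)
    (h' : ∀ x, f.sharp x = Y.res (h x).le ≫ g.sharp x) : f = g :=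
  Hom.ext_of_base h h'

theorem base_congr {X Y : PosetDatum.{u} C} {f g : X ⟶ Y} (h : f = g) (x : X.carrier) :
    f.base x = g.base x := by rw [h]

theorem res_sharp_congr {X Y : PosetDatum.{u} C} {f g : X ⟶ Y} (h : f = g) (x : X.carrier)
    {y : Y.carrier} (hf : y ≤ f.base x) (hg : y ≤ g.base x) :
    Y.res hf ≫ f.sharp x = Y.res hg ≫ g.sharp x := by
  subst h; rfl

end General

section Cylinder

variable {C : Type v} [Category.{w} C]

/-- The member of a diagram of `C`-data (a datum with values in `(C-data)ᵒᵖ`) at `p`. -/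
abbrev member (𝒳 : PosetDatum.{u} (PosetDatum.{u} C)ᵒᵖ) (p : 𝒳.carrier) : PosetDatum.{u} C :=
  (𝒳.obj.obj p).unop

/-- The transition morphism `𝒳(q) ⟶ 𝒳(p)` for `p ≤ q`. -/
abbrev trans (𝒳 : PosetDatum.{u} (PosetDatum.{u} C)ᵒᵖ) {p q : 𝒳.carrier} (h : p ≤ q) :
    𝒳.member q ⟶ 𝒳.member p :=
  (𝒳.res h).unop

theorem trans_self (𝒳 : PosetDatum.{u} (PosetDatum.{u} C)ᵒᵖ) {p : 𝒳.carrier} (h : p ≤ p) :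
    𝒳.trans h = 𝟙 _ := by
  simp only [trans, res_self]; rfl

theorem trans_comp (𝒳 : PosetDatum.{u} (PosetDatum.{u} C)ᵒᵖ) {p q r : 𝒳.carrier}
    (h : p ≤ q) (h' : q ≤ r) : 𝒳.trans h' ≫ 𝒳.trans h = 𝒳.trans (h.trans h') := by
  simp only [trans, ← res_comp 𝒳 h h']; rfl

/-- The points of the cylinder: the disjoint union of the posets `|𝒳(p)|`. -/
@[ext]
structure CylPoint (𝒳 : PosetDatum.{u} (PosetDatum.{u} C)ᵒᵖ) where
  idx : 𝒳.carrier
  pt : (𝒳.member idx).carrier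

variable {𝒳 : PosetDatum.{u} (PosetDatum.{u} C)ᵒᵖ}

instance : Finite (CylPoint 𝒳) :=
  Finite.of_injective
    (fun x => (⟨x.idx, x.pt⟩ : Σ p : 𝒳.carrier, (𝒳.member p).carrier))
    (by rintro ⟨p, x⟩ ⟨q, y⟩ h; cases h; rfl)

/-- `x_p ≤ y_q` if and only if `p ≤ q` and `x_p ≤ 𝒳_{pq}(y_q)` in `𝒳(p)`. -/
instance : PartialOrder (CylPoint 𝒳) where
  le x y := ∃ h : x.idx ≤ y.idx, x.pt ≤ (𝒳.trans h).base y.pt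
  le_refl x := ⟨le_rfl, by rw [trans_self]; exact le_rfl⟩
  le_trans x y z := by
    rintro ⟨h, hx⟩ ⟨h', hy⟩
    refine ⟨h.trans h', ?_⟩
    rw [← trans_comp 𝒳 h h']
    exact hx.trans ((𝒳.trans h).mono hy)
  le_antisymm := by
    rintro ⟨p, x⟩ ⟨q, y⟩ ⟨h, hx⟩ ⟨h', hy⟩
    obtain rfl : p = q := le_antisymm h h'
    rw [trans_self] at hx hy
    exact CylPoint.ext rfl (heq_of_eq (le_antisymm hx hy))

/-- The restriction of the cylinder along `x_p ≤ y_q`: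
the restriction of `𝒳(p)` from `x_p` to `𝒳_{pq}(y_q)` followed by `(𝒳_{pq})^♯` at `y_q`. -/
def cylRes {x y : CylPoint 𝒳} (h : x ≤ y) :
    (𝒳.member x.idx).obj.obj x.pt ⟶ (𝒳.member y.idx).obj.obj y.pt :=
  (𝒳.member x.idx).res h.2 ≫ (𝒳.trans h.1).sharp y.pt

variable (𝒳) in
/-- The cylinder of a diagram of `C`-data. -/
def cyl : PosetDatum.{u} C where
  carrier := CylPoint 𝒳
  obj :=
    { obj := fun x => (𝒳.member x.idx).obj.obj x.pt
      map := fun f => cylRes (leOfHom f)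
      map_id := fun x => by
        have h := res_sharp_congr (trans_self 𝒳 (le_refl x.idx)) x.pt (leOfHom (𝟙 x)).2
          (le_refl x.pt)
        exact h.trans (by rw [res_self]; exact Category.comp_id _)
      map_comp := fun {x y z} f g => by
        obtain ⟨h, hx⟩ := leOfHom f
        obtain ⟨h', hy⟩ := leOfHom g
        have hc : x.pt ≤ (𝒳.trans h' ≫ 𝒳.trans h).base z.pt := hx.trans ((𝒳.trans h).mono hy)
        have key := res_sharp_congr (trans_comp 𝒳 h h') z.pt hc (leOfHom (f ≫ g)).2
        have nat := (𝒳.trans h).naturality hy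
        refine key.symm.trans ?_
        simp only [comp_sharp, cylRes]
        rw [← res_comp _ hx ((𝒳.trans h).mono hy), Category.assoc, Category.assoc]
        congr 1
        rw [← Category.assoc, nat, Category.assoc] }

/-- The morphism `Cyl(𝒳) ⟶ Y` induced by compatible morphisms `φ_p : 𝒳(p) ⟶ Y`, that is, by a
morphism from `𝒳` to the constant diagram `Y`. It is `φ_p` on each `𝒳(p)`. -/
def cylDesc (Y : PosetDatum.{u} C) (φ : ∀ p, 𝒳.member p ⟶ Y)
    (hφ : ∀ {p q} (h : p ≤ q), 𝒳.trans h ≫ φ p = φ q) : cyl 𝒳 ⟶ Y where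
  base x := (φ x.idx).base x.pt
  mono x y h := ((φ x.idx).mono h.2).trans (base_congr (hφ h.1) y.pt).le
  sharp x := (φ x.idx).sharp x.pt
  naturality {x y} h := by
    have key := res_sharp_congr (hφ h.1) y.pt ((φ x.idx).mono h.2)
      (((φ x.idx).mono h.2).trans (base_congr (hφ h.1) y.pt).le)
    have nat := (φ x.idx).naturality h.2
    rw [comp_sharp, ← Category.assoc, nat, Category.assoc] at key
    exact key.symm

end Cylinder

section FiberProduct

variable {C : Type v} [Category.{w} C]

theorem fiberProduct_aux [HasPushouts C] {X Y Z : PosetDatum.{u} C} (f : X ⟶ Y)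
    (g : Z ⟶ Y) {x x' : X.carrier} {z z' : Z.carrier} (h : f.base x = g.base z)
    (h' : f.base x' = g.base z') (hx : x ≤ x') (hz : z ≤ z') :
    f.sharp x ≫ X.res hx ≫ pushout.inl (f.sharp x') (Y.res h'.le ≫ g.sharp z') =
      (Y.res h.le ≫ g.sharp z) ≫ Z.res hz ≫
        pushout.inr (f.sharp x') (Y.res h'.le ≫ g.sharp z') := by
  have h1 := f.naturality hx
  have h2 := g.naturality hz
  have h3 := pushout.condition (f := f.sharp x') (g := Y.res h'.le ≫ g.sharp z')
  rw [← Category.assoc, ← h1, Category.assoc, h3]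
  simp only [Category.assoc]
  rw [← Category.assoc (g.sharp z), ← h2]
  simp only [← Category.assoc, res_comp]

/-- The fibered product `X ×_Y Z` of `C`-data: its points are the pairs `(x, z)` with
`f x = g z`, with the componentwise order, and its value at `(x, z)` is the pushout
(for rings: the tensor product) of the values at `x` and at `z` over the value at `f x = g z`. -/
noncomputable def fiberProduct [HasPushouts C] {X Y Z : PosetDatum.{u} C} (f : X ⟶ Y)
    (g : Z ⟶ Y) : PosetDatum.{u} C where
  carrier := {p : X.carrier × Z.carrier // f.base p.1 = g.base p.2}
  obj :=
    { obj := fun p => pushout (f.sharp p.1.1) (Y.res p.2.le ≫ g.sharp p.1.2)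
      map := fun {p q} h => pushout.desc
        (X.res (leOfHom h).1 ≫ pushout.inl _ _)
        (Z.res (leOfHom h).2 ≫ pushout.inr _ _)
        (fiberProduct_aux f g p.2 q.2 (leOfHom h).1 (leOfHom h).2)
      map_id := fun p => by
        apply pushout.hom_ext
        · rw [pushout.inl_desc, Category.comp_id, res_self]
          exact Category.id_comp _
        · rw [pushout.inr_desc, Category.comp_id, res_self]
          exact Category.id_comp _
      map_comp := fun {p q r} h h' => by
        apply pushout.hom_ext
        · rw [pushout.inl_desc, ← Category.assoc, pushout.inl_desc, Category.assoc,
            pushout.inl_desc, ← Category.assoc, res_comp]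
        · rw [pushout.inr_desc, ← Category.assoc, pushout.inr_desc, Category.assoc,
            pushout.inr_desc, ← Category.assoc, res_comp] }

/-- The diagonal `X ⟶ X ×_Y X`: the map `x ↦ (x, x)` with the codiagonals of the values. -/
noncomputable def diag [HasPushouts C] {X Y : PosetDatum.{u} C} (f : X ⟶ Y) :
    X ⟶ fiberProduct f f where
  base x := ⟨(x, x), rfl⟩
  mono _ _ h := ⟨h, h⟩
  sharp x := pushout.desc (𝟙 _) (𝟙 _) (by rw [res_self]; simp)
  naturality {x x'} h := by
    apply pushout.hom_ext
    · dsimp only [fiberProduct]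
      rw [← Category.assoc, pushout.inl_desc, Category.assoc, pushout.inl_desc,
        ← Category.assoc, pushout.inl_desc, Category.id_comp, Category.comp_id]
    · dsimp only [fiberProduct]
      rw [← Category.assoc, pushout.inr_desc, Category.assoc, pushout.inr_desc,
        ← Category.assoc, pushout.inr_desc, Category.id_comp, Category.comp_id]

/-- A point of the fibered product over `X` of a family `f_j : U_j ⟶ X`: points of all the `U_j`
with the same image in `X`, together with that image. -/
@[ext]
structure WidePoint {J : Type u} {X : PosetDatum.{u} C} {U : J → PosetDatum.{u} C}
    (f : ∀ j, U j ⟶ X) where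
  pt : ∀ j, (U j).carrier
  img : X.carrier
  base_pt : ∀ j, (f j).base (pt j) = img

variable {J K : Type u} {X : PosetDatum.{u} C} {U : J → PosetDatum.{u} C} {f : ∀ j, U j ⟶ X}

instance : PartialOrder (WidePoint f) where
  le x y := (∀ j, x.pt j ≤ y.pt j) ∧ x.img ≤ y.img
  le_refl _ := ⟨fun _ => le_rfl, le_rfl⟩
  le_trans _ _ _ h h' := ⟨fun j => (h.1 j).trans (h'.1 j), h.2.trans h'.2⟩
  le_antisymm _ _ h h' :=
    WidePoint.ext (funext fun j => le_antisymm (h.1 j) (h'.1 j)) (le_antisymm h.2 h'.2)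

instance [Finite J] : Finite (WidePoint f) :=
  Finite.of_injective (fun x => (x.pt, x.img)) fun x y h => by
    simp only [Prod.mk.injEq] at h
    exact WidePoint.ext h.1 h.2

/-- For a point of the fibered product with image `x` in `X`, the structure morphism from the
value of `X` at `x` to the value of `U_j` at the `j`-th coordinate. -/
abbrev WidePoint.arrow (x : WidePoint f) (j : J) :
    X.obj.obj x.img ⟶ (U j).obj.obj (x.pt j) :=
  X.res (x.base_pt j).ge ≫ (f j).sharp (x.pt j)

/-- The value of the fibered product at a point: the pushout (for rings: the tensor product)
of the values of the `U_j` over the value of `X`. -/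
noncomputable abbrev WidePoint.val [HasWidePushouts.{u} C] (x : WidePoint f) : C :=
  widePushout (X.obj.obj x.img) (fun j => (U j).obj.obj (x.pt j)) x.arrow

/-- The point of the fibered product over `X` of a subfamily obtained by
forgetting coordinates. -/
def WidePoint.sub (σ : K → J) (x : WidePoint f) : WidePoint (fun k => f (σ k)) where
  pt k := x.pt (σ k)
  img := x.img
  base_pt k := x.base_pt (σ k)

theorem WidePoint.arrow_res (σ : K → J) {y : WidePoint (fun k => f (σ k))} {x : WidePoint f}
    (h : ∀ k, y.pt k ≤ x.pt (σ k)) (h' : y.img ≤ x.img) (k : K) :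
    y.arrow k ≫ (U (σ k)).res (h k) = X.res h' ≫ x.arrow (σ k) := by
  have h1 := (f (σ k)).naturality (h k)
  simp only [WidePoint.arrow, Category.assoc]
  rw [← h1]
  simp only [← Category.assoc, res_comp]

/-- The comparison of values for a reindexing `σ : K → J` and a point `y` of the fibered product
over `K` below the restriction of a point `x` of the fibered product over `J`. -/
noncomputable def WidePoint.valMap [HasWidePushouts.{u} C] (σ : K → J)
    {y : WidePoint (fun k => f (σ k))} {x : WidePoint f}
    (h : ∀ k, y.pt k ≤ x.pt (σ k)) (h' : y.img ≤ x.img) : y.val ⟶ x.val :=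
  WidePushout.desc (X.res h' ≫ WidePushout.head x.arrow)
    (fun k => (U (σ k)).res (h k) ≫ WidePushout.ι x.arrow (σ k))
    (fun k => by
      rw [← Category.assoc, WidePoint.arrow_res σ h h' k, Category.assoc,
        WidePushout.arrow_ι])

theorem WidePoint.head_valMap [HasWidePushouts.{u} C] (σ : K → J)
    {y : WidePoint (fun k => f (σ k))} {x : WidePoint f}
    (h : ∀ k, y.pt k ≤ x.pt (σ k)) (h' : y.img ≤ x.img) :
    WidePushout.head y.arrow ≫ WidePoint.valMap σ h h' = X.res h' ≫ WidePushout.head x.arrow :=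
  WidePushout.head_desc y.arrow _ _ _

theorem WidePoint.ι_valMap [HasWidePushouts.{u} C] (σ : K → J)
    {y : WidePoint (fun k => f (σ k))} {x : WidePoint f}
    (h : ∀ k, y.pt k ≤ x.pt (σ k)) (h' : y.img ≤ x.img) (k : K) :
    WidePushout.ι y.arrow k ≫ WidePoint.valMap σ h h' =
      (U (σ k)).res (h k) ≫ WidePushout.ι x.arrow (σ k) :=
  WidePushout.ι_desc y.arrow _ _ _ _

theorem WidePoint.valMap_self [HasWidePushouts.{u} C] (x : WidePoint f)
    (h : ∀ j, x.pt j ≤ x.pt j) (h' : x.img ≤ x.img) :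
    WidePoint.valMap (y := x) (fun j => j) h h' = 𝟙 _ := by
  refine WidePushout.hom_ext x.arrow _ _ (fun j => ?_) ?_
  · rw [WidePoint.ι_valMap, res_self, Category.comp_id]
    exact Category.id_comp _
  · rw [WidePoint.head_valMap, res_self, Category.comp_id]
    exact Category.id_comp _

theorem WidePoint.valMap_comp [HasWidePushouts.{u} C] {L : Type u} (σ : K → J) (τ : L → K)
    {z : WidePoint (fun l => f (σ (τ l)))} {y : WidePoint (fun k => f (σ k))} {x : WidePoint f}
    (h : ∀ k, y.pt k ≤ x.pt (σ k)) (h' : y.img ≤ x.img)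
    (g : ∀ l, z.pt l ≤ y.pt (τ l)) (g' : z.img ≤ y.img) :
    WidePoint.valMap (f := fun k => f (σ k)) τ g g' ≫ WidePoint.valMap σ h h' =
      WidePoint.valMap (fun l => σ (τ l)) (fun l => (g l).trans (h (τ l))) (g'.trans h') := by
  refine WidePushout.hom_ext z.arrow _ _ (fun l => ?_) ?_
  · rw [← Category.assoc]
    refine (congrArg (· ≫ _) (WidePoint.ι_valMap (f := fun k => f (σ k)) τ g g' l)).trans ?_
    refine Eq.trans ?_ (WidePoint.ι_valMap (fun l => σ (τ l)) _ _ l).symm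
    rw [Category.assoc, WidePoint.ι_valMap, ← Category.assoc, res_comp]
  · rw [← Category.assoc]
    refine (congrArg (· ≫ _) (WidePoint.head_valMap (f := fun k => f (σ k)) τ g g')).trans ?_
    refine Eq.trans ?_ (WidePoint.head_valMap (fun l => σ (τ l)) _ _).symm
    rw [Category.assoc, WidePoint.head_valMap, ← Category.assoc, res_comp]

variable (f) in
/-- The fibered product over `X` of a finite family `f_j : U_j ⟶ X`. -/
noncomputable def wideFiberProduct [HasWidePushouts.{u} C] [Finite J] : PosetDatum.{u} C where
  carrier := WidePoint f
  obj :=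
    { obj := fun x => x.val
      map := fun h => WidePoint.valMap (fun j => j) (leOfHom h).1 (leOfHom h).2
      map_id := fun x => WidePoint.valMap_self x _ _
      map_comp := fun h h' => (WidePoint.valMap_comp (fun j => j) (fun j => j)
        (leOfHom h').1 (leOfHom h').2 (leOfHom h).1 (leOfHom h).2).symm }

variable (f) in
/-- The projection of the fibered product of a family onto that of a subfamily. -/
noncomputable def wideProj [HasWidePushouts.{u} C] [Finite J] [Finite K] (σ : K → J) :
    wideFiberProduct f ⟶ wideFiberProduct (fun k => f (σ k)) where
  base x := x.sub σ
  mono _ _ h := ⟨fun k => h.1 (σ k), h.2⟩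
  sharp _ := WidePoint.valMap σ (fun _ => le_rfl) le_rfl
  naturality {x x'} h :=
    (WidePoint.valMap_comp (f := f) σ (fun k => k) (y := x'.sub σ) (z := x.sub σ)
      (fun _ => le_rfl) le_rfl (fun k => h.1 (σ k)) h.2).trans
    (WidePoint.valMap_comp (f := f) (fun j => j) σ (x := x') (y := x) (z := x.sub σ)
      h.1 h.2 (fun _ => le_rfl) le_rfl).symm

variable (f) in
/-- The structure morphism of the fibered product to `X`. -/
noncomputable def wideToBase [HasWidePushouts.{u} C] [Finite J] : wideFiberProduct f ⟶ X where
  base x := x.img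
  mono _ _ h := h.2
  sharp x := WidePushout.head x.arrow
  naturality h := (WidePoint.head_valMap (fun j => j) h.1 h.2).symm

theorem wideProj_toBase [HasWidePushouts.{u} C] [Finite J] [Finite K] (σ : K → J) :
    wideProj f σ ≫ wideToBase (fun k => f (σ k)) = wideToBase f :=
  hom_ext (fun _ => rfl) fun _ => WidePoint.head_valMap σ (fun _ => le_rfl) le_rfl

theorem wideProj_self [HasWidePushouts.{u} C] [Finite J] :
    wideProj f (fun j => j) = 𝟙 (wideFiberProduct f) :=
  hom_ext (fun _ => rfl) fun x => (WidePoint.valMap_self x _ _).trans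
    ((congrArg (· ≫ 𝟙 _) (res_self (wideFiberProduct f) (x := x) le_rfl)).trans
      (Category.comp_id _)).symm

theorem wideProj_comp [HasWidePushouts.{u} C] {L : Type u} [Finite J] [Finite K] [Finite L]
    (σ : K → J) (τ : L → K) :
    wideProj f σ ≫ wideProj (fun k => f (σ k)) τ = wideProj f (fun l => σ (τ l)) :=
  hom_ext (fun _ => rfl) fun x =>
    (WidePoint.valMap_comp (f := f) σ τ (x := x) (y := x.sub σ) (z := (x.sub σ).sub τ)
      (fun _ => le_rfl) le_rfl (fun _ => le_rfl) le_rfl).trans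
    ((congrArg (· ≫ Hom.sharp (wideProj f (fun l => σ (τ l))) x)
      (res_self (wideFiberProduct (fun l => f (σ (τ l)))) (x := (x.sub σ).sub τ) le_rfl)).trans
      (Category.id_comp _)).symm

end FiberProduct

section Nerve

variable {C : Type v} [Category.{w} C] [HasWidePushouts.{u} C]
variable {I : Type u} [Finite I] {X : PosetDatum.{u} C} {U : I → PosetDatum.{u} C}

/-- The nerve datum of a finite family `f_i : U_i ⟶ X`: its underlying poset is the set of
non-empty subsets `Δ` of `I`, ordered by inclusion; its value at `Δ` is the fibered product of the
`U_i`, `i ∈ Δ`, over `X`; its transition morphisms are the projections. -/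
noncomputable def nerve (f : ∀ i, U i ⟶ X) : PosetDatum.{u} (PosetDatum.{u} C)ᵒᵖ where
  carrier := {Δ : Set I // Δ.Nonempty}
  obj :=
    { obj := fun Δ => op (wideFiberProduct (fun i : Δ.1 => f i.1))
      map := fun {_ Δ'} h => (wideProj (fun i : Δ'.1 => f i.1) (Set.inclusion (leOfHom h))).op
      map_id := fun Δ => congrArg Quiver.Hom.op
        (wideProj_self (f := fun i : Δ.1 => f i.1))
      map_comp := fun {_ _ Δ₃} h h' => congrArg Quiver.Hom.op
        (wideProj_comp (f := fun i : Δ₃.1 => f i.1) (Set.inclusion (leOfHom h'))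
          (Set.inclusion (leOfHom h))).symm }

/-- The natural morphism from the cylinder of the nerve datum to `X`. -/
noncomputable def cylNerveToBase (f : ∀ i, U i ⟶ X) : cyl (nerve f) ⟶ X :=
  cylDesc X (fun Δ => wideToBase (fun i : Δ.1 => f i.1))
    (fun {_ Δ'} h => wideProj_toBase (f := fun i : Δ'.1 => f i.1) (Set.inclusion h))

end Nerve

end PosetDatum

/-- Finite ringed posets: finite posets with a functor to commutative rings. -/
abbrev RingedPoset : Type (u + 1) := PosetDatum.{u} CommRingCat.{u}

namespace RingedPoset

open PosetDatum

/-- The diagram of affine schemes `x ↦ Spec 𝒪_{X, x}`. -/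
noncomputable abbrev specDiagram (X : RingedPoset.{u}) : X.carrierᵒᵖ ⥤ LocallyRingedSpace.{u} :=
  X.obj.op ⋙ Spec.toLocallyRingedSpace

/-- The locally ringed space `Spec X = colim_{x ∈ X} Spec 𝒪_{X, x}`. -/
noncomputable def spec (X : RingedPoset.{u}) : LocallyRingedSpace.{u} := colimit X.specDiagram

/-- The morphism `Spec f : Spec X ⟶ Spec Y`, given on `Spec 𝒪_{X, x}` by
`Spec (f^♯_x)` followed by `Spec 𝒪_{Y, f x} ⟶ Spec Y`. -/
noncomputable def specMap {X Y : RingedPoset.{u}} (f : X ⟶ Y) : X.spec ⟶ Y.spec :=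
  colimit.desc X.specDiagram
    { pt := colimit Y.specDiagram
      ι :=
        { app := fun x => Spec.toLocallyRingedSpace.map (f.sharp x.unop).op ≫
            colimit.ι Y.specDiagram (op (f.base x.unop))
          naturality := fun x x' h => by
            have h1 := f.naturality (leOfHom h.unop)
            have h2 := colimit.w Y.specDiagram (homOfLE (f.mono (leOfHom h.unop))).op
            refine Eq.trans ?_ (Category.comp_id _).symm
            rw [← h2]
            simp only [specDiagram, Functor.comp_map, Functor.op_map]
            rw [← Category.assoc, ← Category.assoc, ← Functor.map_comp, ← Functor.map_comp,
              ← op_comp]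
            exact congrArg (fun a => Spec.toLocallyRingedSpace.map (Quiver.Hom.op a) ≫
              colimit.ι Y.specDiagram (op (f.base x'.unop))) h1.symm } }

/-- For `t ≤ x, y`, the natural ring homomorphism
`𝒪_x ⊗_{𝒪_t} 𝒪_y ⟶ ∏_{z ≥ x, y} 𝒪_z`. -/
noncomputable def overlapMap (X : RingedPoset.{u}) {t x y : X.carrier} (hx : t ≤ x) (hy : t ≤ y) :
    pushout (X.res hx) (X.res hy) ⟶
      CommRingCat.of (∀ z : {z : X.carrier // x ≤ z ∧ y ≤ z}, X.obj.obj z.1) :=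
  pushout.desc
    (CommRingCat.ofHom (RingHom.pi fun z => (X.res z.2.1).hom))
    (CommRingCat.ofHom (RingHom.pi fun z => (X.res z.2.2).hom)) (by
      ext a z
      have h := (X.res_comp hx z.2.1).trans (X.res_comp hy z.2.2).symm
      exact congrArg (fun b => b.hom a) h)

/-- A finite ringed poset is schematic if its restriction morphisms are flat and the
homomorphisms `𝒪_x ⊗_{𝒪_t} 𝒪_y ⟶ ∏_{z ≥ x, y} 𝒪_z`, for `t ≤ x, y`, are faithfully flat. -/
structure IsSchematic (X : RingedPoset.{u}) : Prop where
  flat : ∀ {x y : X.carrier} (h : x ≤ y), (X.res h).hom.Flat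
  faithfullyFlat : ∀ {t x y : X.carrier} (hx : t ≤ x) (hy : t ≤ y),
    (X.overlapMap hx hy).hom.FaithfullyFlat

/-- For a morphism `f : X ⟶ Y`, `x ∈ X` and `y ≥ f x`, the natural ring homomorphism
`𝒪_{X, x} ⊗_{𝒪_{Y, f x}} 𝒪_{Y, y} ⟶ ∏_{z ∈ U_x ∩ f⁻¹(U_y)} 𝒪_{X, z}`. -/
noncomputable def overlapMapHom {X Y : RingedPoset.{u}} (f : X ⟶ Y) (x : X.carrier)
    {y : Y.carrier} (hy : f.base x ≤ y) :
    pushout (f.sharp x) (Y.res hy) ⟶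
      CommRingCat.of (∀ z : {z : X.carrier // x ≤ z ∧ y ≤ f.base z}, X.obj.obj z.1) :=
  pushout.desc
    (CommRingCat.ofHom (RingHom.pi fun z => (X.res z.2.1).hom))
    (CommRingCat.ofHom (RingHom.pi fun z => (Y.res z.2.2 ≫ f.sharp z.1).hom)) (by
      ext a z
      have h : f.sharp x ≫ X.res z.2.1 = Y.res hy ≫ Y.res z.2.2 ≫ f.sharp z.1 := by
        rw [← Category.assoc, Y.res_comp hy z.2.2]
        exact (f.naturality z.2.1).symm
      exact congrArg (fun b => b.hom a) h)

/-- A morphism of ringed posets is schematic if the homomorphisms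
`𝒪_{X, x} ⊗_{𝒪_{Y, f x}} 𝒪_{Y, y} ⟶ ∏_{z ∈ U_x ∩ f⁻¹(U_y)} 𝒪_{X, z}`, for `x ∈ X` and
`y ≥ f x`, induce surjections between the prime spectra. -/
def IsSchematicHom {X Y : RingedPoset.{u}} (f : X ⟶ Y) : Prop :=
  ∀ (x : X.carrier) {y : Y.carrier} (hy : f.base x ≤ y),
    Function.Surjective (PrimeSpectrum.comap (overlapMapHom f x hy).hom)

/-- A morphism is flat if all the homomorphisms `𝒪_{Y, f x} ⟶ 𝒪_{X, x}` are flat. -/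
def IsFlat {X Y : RingedPoset.{u}} (f : X ⟶ Y) : Prop :=
  ∀ x : X.carrier, (f.sharp x).hom.Flat

/-- A morphism `f` is a qc-isomorphism if `Spec f` is an isomorphism of locally ringed spaces. -/
def IsQcIso {X Y : RingedPoset.{u}} (f : X ⟶ Y) : Prop := IsIso (specMap f)

/-- A flat immersion is a flat schematic morphism whose diagonal is a qc-isomorphism. -/
structure IsFlatImmersion {X Y : RingedPoset.{u}} (f : X ⟶ Y) : Prop where
  schematic : IsSchematicHom f
  flat : IsFlat f
  diag : IsQcIso (diag f)

/-- A family of morphisms to `X` is a covering if it consists of flat immersions and the maps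
`Spec U_i ⟶ Spec X` are jointly surjective. -/
structure IsCovering {I : Type u} {X : RingedPoset.{u}} {U : I → RingedPoset.{u}}
    (f : ∀ i, U i ⟶ X) : Prop where
  flatImmersion : ∀ i, IsFlatImmersion (f i)
  surjective : ∀ p : X.spec, ∃ (i : I) (q : (U i).spec), (specMap (f i)).base q = p

end RingedPoset

/-! Everything is tested on points with values in fields. In a schematic poset the restriction maps
are flat epimorphisms, and a point with values in a field `K` lifts along an epimorphism of rings as
soon as its kernel does, without enlarging `K`. Hence a poset is schematic exactly when its
restrictions are flat epimorphisms and `K`-points that agree below merge above (`isSchematic_iff`).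
When the source has epimorphic restrictions, schematic morphisms are those that lift `K`-points
(`isSchematicHom_iff`). Flat immersions of schematic posets are the flat morphisms that lift
`K`-points, have epimorphic components, and merge `K`-points with the same image
(`IsPointwiseFlatImmersion`).

The values of the cylinder are finite tensor products of flat epimorphic algebras over values of
`X`. So they are flat and epimorphic over `X`, and their `K`-points are `K`-points of `X` with a
factorization property. The difficulty is that a point of a fibered product needs coordinates with
equal images, while lifting only gives images above a given `x`. The remedy is to pass to a
`K`-point of `X` that extends to no larger element: whatever lies above it lies exactly over it.
Points of the cylinder at `Δ` and `Δ'` over the same `K`-point of `X` then extend to a point at `Δ ∪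
Δ'` (`exists_cyl_over_maximal`). This gives the merging and lifting conditions for the cylinder.

Two results link this to `Spec`. `isQcIso_of_flat` builds the inverse of `Spec g` by descent along
finite jointly surjective flat families. Since `Spec Y` is merely a locally ringed space, descent of
morphisms to such targets is proved (`exists_hom_of_flat`). Conversely,
`IsQcIso.eq_zero_of_vanishesOver` extracts from a qc-isomorphism that a section vanishing at all
points above is zero; applied to the diagonal, it shows that the components of a flat immersion are
epimorphisms.

For the cylinder, the only hypothesis of `isQcIso_of_flat` not automatic is surjectivity, which
follows from the covering condition. Conversely, a point of `Spec` of the cylinder maps to some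
`Spec U_i` because `Δ` is non-empty. -/

/-! ### Pullback of sections on presheafed spaces -/

open TopologicalSpace in
/-- The pullback of sections over `V` along `f`, restricted to a smaller open set `V'`. -/
noncomputable def AlgebraicGeometry.PresheafedSpace.appLE
    {X Y : PresheafedSpace.{_, _, u} CommRingCat.{u}} (f : X ⟶ Y) (V : Opens Y) (V' : Opens X)
    (h : V' ≤ (Opens.map f.base).obj V) :
    Y.presheaf.obj (op V) ⟶ X.presheaf.obj (op V') :=
  f.c.app (op V) ≫ X.presheaf.map (homOfLE h).op

namespace AlgebraicGeometry.PresheafedSpace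

open TopologicalSpace

variable {X Y Z : PresheafedSpace.{_, _, u} CommRingCat.{u}}

theorem appLE_comp (f : X ⟶ Y) (g : Y ⟶ Z) (V : Opens Z) (V' : Opens Y) (V'' : Opens X)
    (h : V' ≤ (Opens.map g.base).obj V) (h' : V'' ≤ (Opens.map f.base).obj V')
    (h'' : V'' ≤ (Opens.map (f ≫ g).base).obj V) :
    appLE g V V' h ≫ appLE f V' V'' h' = appLE (f ≫ g) V V'' h'' := by
  have n := f.c.naturality (homOfLE h).op
  have m := X.presheaf.map_comp ((Opens.map f.base).map (homOfLE h)).op (homOfLE h').op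
  calc appLE g V V' h ≫ appLE f V' V'' h'
      = g.c.app (op V) ≫ (Y.presheaf.map (homOfLE h).op ≫ f.c.app (op V')) ≫
          X.presheaf.map (homOfLE h').op := by
        simp only [appLE, Category.assoc]
    _ = g.c.app (op V) ≫ f.c.app (op ((Opens.map g.base).obj V)) ≫
          X.presheaf.map ((Opens.map f.base).map (homOfLE h)).op ≫
          X.presheaf.map (homOfLE h').op := by
        rw [n, Category.assoc]; rfl
    _ = g.c.app (op V) ≫ f.c.app (op ((Opens.map g.base).obj V)) ≫
          X.presheaf.map (((Opens.map f.base).map (homOfLE h)).op ≫ (homOfLE h').op) := by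
        rw [m]
    _ = _ := (Category.assoc _ _ _).symm

theorem appLE_congr {f g : X ⟶ Y} (e : f = g) (V : Opens Y) (V' : Opens X)
    (h : V' ≤ (Opens.map f.base).obj V) (h' : V' ≤ (Opens.map g.base).obj V) :
    appLE f V V' h = appLE g V V' h' := by
  subst e; rfl

theorem appLE_comp_apply (f : X ⟶ Y) (g : Y ⟶ Z) {k : X ⟶ Z} (e : f ≫ g = k) {V : Opens Z}
    {V' : Opens Y} {V'' : Opens X}
    (h : V' ≤ (Opens.map g.base).obj V) (h' : V'' ≤ (Opens.map f.base).obj V')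
    (h'' : V'' ≤ (Opens.map k.base).obj V) (s : Z.presheaf.obj (op V)) :
    appLE f V' V'' h' (appLE g V V' h s) = appLE k V V'' h'' s := by
  subst e
  rw [← appLE_comp f g V V' V'' h h' h'', ConcreteCategory.comp_apply]

theorem map_appLE (f : X ⟶ Y) {V W : Opens Y} (V' : Opens X) (i : W ⟶ V)
    (h : V' ≤ (Opens.map f.base).obj W) :
    Y.presheaf.map i.op ≫ appLE f W V' h =
      appLE f V V' (h.trans ((Opens.map f.base).map i).le) := by
  have n := f.c.naturality i.op
  have m := X.presheaf.map_comp ((Opens.map f.base).map i).op (homOfLE h).op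
  calc Y.presheaf.map i.op ≫ appLE f W V' h
      = (Y.presheaf.map i.op ≫ f.c.app (op W)) ≫ X.presheaf.map (homOfLE h).op := by
        simp only [appLE, Category.assoc]
    _ = f.c.app (op V) ≫ X.presheaf.map ((Opens.map f.base).map i).op ≫
          X.presheaf.map (homOfLE h).op := by
        rw [n, Category.assoc]; rfl
    _ = f.c.app (op V) ≫ X.presheaf.map (((Opens.map f.base).map i).op ≫ (homOfLE h).op) := by
        rw [m]
    _ = _ := rfl

theorem appLE_map (f : X ⟶ Y) {V : Opens Y} {V' W' : Opens X} (i : W' ⟶ V')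
    (h : V' ≤ (Opens.map f.base).obj V) :
    appLE f V V' h ≫ X.presheaf.map i.op = appLE f V W' (i.le.trans h) := by
  unfold appLE
  rw [Category.assoc, ← Functor.map_comp]
  rfl

theorem appLE_id (V V' : Opens X) (h : V' ≤ V) :
    appLE (𝟙 X) V V' h = X.presheaf.map (homOfLE h).op := by
  unfold appLE
  rw [id_c_app, X.presheaf.map_id]
  exact Category.id_comp (X.presheaf.map (homOfLE h).op)

theorem appLE_self (f : X ⟶ Y) (V : Opens Y) : appLE f V _ le_rfl = f.c.app (op V) := by
  unfold appLE
  exact (congrArg (f.c.app (op V) ≫ ·) (X.presheaf.map_id _)).trans (Category.comp_id _)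

theorem hom_ext_appLE {f g : X ⟶ Y} (e : f.base = g.base)
    (H : ∀ (V : Opens Y) (V' : Opens X) (h : V' ≤ (Opens.map f.base).obj V)
      (h' : V' ≤ (Opens.map g.base).obj V), appLE f V V' h = appLE g V V' h') : f = g := by
  obtain ⟨fb, fc⟩ := f
  obtain ⟨gb, gc⟩ := g
  obtain rfl : fb = gb := e
  congr 1
  refine NatTrans.ext (funext fun V => ?_)
  have := H V.unop _ le_rfl le_rfl
  unfold appLE at this
  rw [show (homOfLE (le_refl ((Opens.map fb).obj V.unop))).op = 𝟙 _ from rfl,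
    show X.presheaf.map (𝟙 (op ((Opens.map fb).obj V.unop))) = 𝟙 _ from X.presheaf.map_id _] at this
  exact (Category.comp_id _).symm.trans (this.trans (Category.comp_id _))

/-! ### Sections over open subsets of a colimit of presheafed spaces -/

section Colimit

variable {J : Type u} [SmallCategory J] (F : J ⥤ PresheafedSpace.{_, _, u} CommRingCat.{u})

theorem colimit_sections_ext (V : Opens (Limits.colimit F).carrier)
    (s t : (Limits.colimit F).presheaf.obj (op V))
    (h : ∀ j, (Limits.colimit.ι F j).c.app (op V) s = (Limits.colimit.ι F j).c.app (op V) t) :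
    s = t := by
  have e := (colimitPresheafObjIsoComponentwiseLimit F V)
  have hi : Function.Injective (colimitPresheafObjIsoComponentwiseLimit F V).hom :=
    (ConcreteCategory.bijective_of_isIso (colimitPresheafObjIsoComponentwiseLimit F V).hom).1
  apply hi
  refine Concrete.limit_ext _ _ _ fun j => ?_
  rw [← ConcreteCategory.comp_apply, ← ConcreteCategory.comp_apply]
  erw [colimitPresheafObjIsoComponentwiseLimit_hom_π F V j.unop]
  exact h j.unop

theorem colimit_sections_exists (V : Opens (Limits.colimit F).carrier)
    (s : ∀ j, (F.obj j).presheaf.obj (op ((Opens.map (Limits.colimit.ι F j).base).obj V)))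
    (hs : ∀ {j k : J} (f : j ⟶ k) (h), appLE (F.map f) _ _ h (s k) = s j) :
    ∃ t : (Limits.colimit F).presheaf.obj (op V),
      ∀ j, (Limits.colimit.ι F j).c.app (op V) t = s j := by
  have hl := isLimitOfPreserves (CategoryTheory.forget CommRingCat.{u})
    (limit.isLimit (PresheafedSpace.componentwiseDiagram F V))
  obtain ⟨y, hy⟩ : ∃ y : (limit (componentwiseDiagram F V) : CommRingCat.{u}), ∀ j : J,
      limit.π (componentwiseDiagram F V) (op j) y = s j := by
    refine ⟨(Types.isLimitEquivSections hl).symm ⟨fun j => s j.unop, ?_⟩, fun j => ?_⟩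
    · intro j k f
      exact hs f.unop (eqToHom (by
        rw [← Limits.colimit.w F f.unop, comp_base]; rfl)).le
    · exact Types.isLimitEquivSections_symm_apply hl _ (op j)
  refine ⟨(colimitPresheafObjIsoComponentwiseLimit F V).inv y, fun j => ?_⟩
  rw [← ConcreteCategory.comp_apply, colimitPresheafObjIsoComponentwiseLimit_inv_ι_app]
  exact hy j

variable {F} {c : Cocone F}

/-- The forgetful functors send colimits of locally ringed spaces to colimit cocones, not to the
chosen colimit. The statement is therefore needed for every colimit cocone, and is transported along
the comparison isomorphism. -/
theorem isColimit_sections_ext (hc : IsColimit c) (V : Opens c.pt.carrier) (s t : c.pt.presheaf.obj (op V))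
    (h : ∀ j, appLE (c.ι.app j) V _ le_rfl s = appLE (c.ι.app j) V _ le_rfl t) : s = t := by
  obtain ⟨e, he⟩ : ∃ e : Limits.colimit F ≅ c.pt, ∀ j, colimit.ι F j ≫ e.hom = c.ι.app j :=
    ⟨IsColimit.coconePointUniqueUpToIso (colimit.isColimit F) hc,
      IsColimit.comp_coconePointUniqueUpToIso_hom _ hc⟩
  let V' := (Opens.map e.hom.base).obj V
  have hV : V = (Opens.map e.inv.base).obj V' := by
    have : (Opens.map (e.inv ≫ e.hom).base).obj V = V := by rw [e.inv_hom_id]; rfl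
    exact this.symm
  have hV' : V' ≤ (Opens.map e.hom.base).obj V := le_rfl
  have key : ∀ s, appLE e.inv V' V hV.le (appLE e.hom V V' hV' s) = s := by
    intro s
    rw [appLE_comp_apply e.inv e.hom e.inv_hom_id hV' hV.le (V'' := V) (le_refl V), appLE_id,
      show (homOfLE (le_refl V)).op = 𝟙 (op V) from rfl, c.pt.presheaf.map_id]
    rfl
  rw [← key s, ← key t]
  congr 1
  refine colimit_sections_ext _ _ _ _ fun j => ?_
  have h1 : ∀ s, (colimit.ι F j).c.app (op V') (appLE e.hom V V' hV' s) =
      appLE (c.ι.app j) V _ (by rw [← he]; exact le_rfl) s := by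
    intro s
    rw [← appLE_self]
    exact appLE_comp_apply _ _ (he j) _ _ _ _
  rw [h1, h1]
  have h2 : ∀ V'' h', appLE (c.ι.app j) V V'' h' s = appLE (c.ι.app j) V V'' h' t := by
    intro V'' h'
    have := appLE_map (c.ι.app j) (homOfLE h') (V := V) le_rfl
    rw [← this, ConcreteCategory.comp_apply, ConcreteCategory.comp_apply, h j]
  exact h2 _ _

theorem isColimit_sections_exists (hc : IsColimit c) (V : Opens c.pt.carrier)
    (s : ∀ j, (F.obj j).presheaf.obj (op ((Opens.map (c.ι.app j).base).obj V)))
    (hs : ∀ {j k : J} (f : j ⟶ k) (h), appLE (F.map f) _ _ h (s k) = s j) :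
    ∃ t : c.pt.presheaf.obj (op V), ∀ j, appLE (c.ι.app j) V _ le_rfl t = s j := by
  obtain ⟨e, he⟩ : ∃ e : Limits.colimit F ≅ c.pt, ∀ j, colimit.ι F j ≫ e.hom = c.ι.app j :=
    ⟨IsColimit.coconePointUniqueUpToIso (colimit.isColimit F) hc,
      IsColimit.comp_coconePointUniqueUpToIso_hom _ hc⟩
  have he' : ∀ j, c.ι.app j ≫ e.inv = colimit.ι F j := fun j => by rw [Iso.comp_inv_eq, he]
  let V' := (Opens.map e.hom.base).obj V
  have hV : V = (Opens.map e.inv.base).obj V' := by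
    have : (Opens.map (e.inv ≫ e.hom).base).obj V = V := by rw [e.inv_hom_id]; rfl
    exact this.symm
  have hι : ∀ j, (Opens.map (colimit.ι F j).base).obj V' = (Opens.map (c.ι.app j).base).obj V := by
    intro j
    rw [← he]; rfl
  obtain ⟨t, ht⟩ := colimit_sections_exists F V'
    (fun j => (F.obj j).presheaf.map (homOfLE (hι j).le).op (s j)) (fun {j k} f h => by
      have h0 : (Opens.map (c.ι.app j).base).obj V ≤
          (Opens.map (F.map f).base).obj ((Opens.map (c.ι.app k).base).obj V) := by
        rw [← c.w f]; exact le_rfl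
      have h1 := map_appLE (F.map f) _ (homOfLE (hι k).le) h
      have h2 := appLE_map (F.map f) (homOfLE (hι j).le) h0
      rw [← hs f h0, ← ConcreteCategory.comp_apply, ← ConcreteCategory.comp_apply, h2, h1])
  refine ⟨appLE e.inv V' V hV.le t, fun j => ?_⟩
  rw [appLE_comp_apply _ _ (he' j) hV.le le_rfl (hι j).ge]
  have h3 := appLE_map (colimit.ι F j) (homOfLE (hι j).ge) (V := V') le_rfl
  rw [← h3, ConcreteCategory.comp_apply, appLE_self, ht j, ← ConcreteCategory.comp_apply,
    ← Functor.map_comp, show (homOfLE (hι j).le).op ≫ (homOfLE (hι j).ge).op = 𝟙 _ from rfl,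
    CategoryTheory.Functor.map_id]
  rfl

end Colimit

end AlgebraicGeometry.PresheafedSpace

/-! ### Points, open sets and sections of colimits of locally ringed spaces -/

namespace AlgebraicGeometry.LocallyRingedSpace

open TopologicalSpace

section Colimit

variable {J : Type u} [SmallCategory J] (F : J ⥤ LocallyRingedSpace.{u})

theorem colimit_sections_ext (V : Opens (Limits.colimit F).carrier)
    (s t : (Limits.colimit F).presheaf.obj (op V))
    (h : ∀ j, PresheafedSpace.appLE (colimit.ι F j).toHom V _ le_rfl s =
      PresheafedSpace.appLE (colimit.ι F j).toHom V _ le_rfl t) : s = t :=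
  PresheafedSpace.isColimit_sections_ext
    (isColimitOfPreserves SheafedSpace.forgetToPresheafedSpace
      (isColimitOfPreserves forgetToSheafedSpace (colimit.isColimit F))) V s t h

theorem colimit_sections_exists (V : Opens (Limits.colimit F).carrier)
    (s : ∀ j, (F.obj j).presheaf.obj (op ((Opens.map (colimit.ι F j).base).obj V)))
    (hs : ∀ {j k : J} (f : j ⟶ k) (h), PresheafedSpace.appLE (F.map f).toHom _ _ h (s k) = s j) :
    ∃ t : (Limits.colimit F).presheaf.obj (op V),
      ∀ j, PresheafedSpace.appLE (colimit.ι F j).toHom V _ le_rfl t = s j :=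
  PresheafedSpace.isColimit_sections_exists
    (isColimitOfPreserves SheafedSpace.forgetToPresheafedSpace
      (isColimitOfPreserves forgetToSheafedSpace (colimit.isColimit F))) V s hs

noncomputable instance : PreservesColimitsOfSize.{u, u} forgetToTop.{u} :=
  inferInstanceAs (PreservesColimitsOfSize.{u, u} (forgetToSheafedSpace ⋙ SheafedSpace.forget _))

/-- A subset of the colimit is open as soon as its preimages in the members of the diagram are. -/
theorem isOpen_colimit (S : Set (Limits.colimit F).carrier)
    (h : ∀ j, IsOpen ((colimit.ι F j).base ⁻¹' S)) : IsOpen S := by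
  have hc := isColimitOfPreserves forgetToTop (colimit.isColimit F)
  exact (TopCat.isOpen_iff_of_isColimit _ hc S).2 h

theorem colimit_exists_rep (x : (Limits.colimit F).carrier) :
    ∃ (j : J) (y : (F.obj j).carrier), (colimit.ι F j).base y = x :=
  Concrete.isColimit_exists_rep (F ⋙ forgetToTop)
    (isColimitOfPreserves forgetToTop (colimit.isColimit F)) x

/-- Functions on the colimit can be defined on the members of the diagram. -/
theorem colimit_exists_lift {T : Type u} (φ : ∀ j, (F.obj j).carrier → T)
    (hφ : ∀ {j k : J} (f : j ⟶ k) (y : (F.obj j).carrier), φ k ((F.map f).base y) = φ j y) :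
    ∃ ψ : (Limits.colimit F).carrier → T, ∀ j y, ψ ((colimit.ι F j).base y) = φ j y := by
  have hc := isColimitOfPreserves (forget TopCat)
    (isColimitOfPreserves forgetToTop (colimit.isColimit F))
  let d : Cocone ((F ⋙ forgetToTop) ⋙ forget TopCat) :=
    { pt := T
      ι :=
        { app := fun j => TypeCat.ofHom (φ j)
          naturality := fun j k f => by
            ext y
            exact hφ f y } }
  exact ⟨fun x => hc.desc d x, fun j y => congrArg (fun g => g y) (hc.fac d j)⟩

end Colimit

end AlgebraicGeometry.LocallyRingedSpace

/-! ### Descent of sections along finite flat jointly surjective families of affine schemes -/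

namespace AlgebraicGeometry.Scheme

/-- The homomorphism to the sections over `V` corresponding to a morphism from `V` to an affine
scheme. -/
noncomputable def Opens.sectionsOfHom {X : Scheme.{u}} (V : X.Opens) {R : CommRingCat.{u}}
    (g : V.toScheme ⟶ Spec R) : R ⟶ Γ(X, V) :=
  (ΓSpecIso R).inv ≫ g.appTop ≫ V.topIso.hom

theorem Opens.sectionsOfHom_toSpecΓ {X : Scheme.{u}} (V : X.Opens) {R : CommRingCat.{u}}
    (ρ : R ⟶ Γ(X, V)) : V.sectionsOfHom (V.toSpecΓ ≫ Spec.map ρ) = ρ := by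
  simp [sectionsOfHom, Opens.toSpecΓ_appTop, -topIso_hom, -topIso_inv]

theorem Opens.toSpecΓ_sectionsOfHom {X : Scheme.{u}} (V : X.Opens) {R : CommRingCat.{u}}
    (g : V.toScheme ⟶ Spec R) : V.toSpecΓ ≫ Spec.map (V.sectionsOfHom g) = g := by
  apply ext_of_isAffine
  rw [Scheme.Hom.comp_appTop, Opens.toSpecΓ_appTop, ← Category.assoc,
    ΓSpecIso_naturality]
  simp [sectionsOfHom, -topIso_hom, -topIso_inv]

theorem comp_toSpecΓ_SpecMap {X Z : Scheme.{u}} (V : X.Opens) {R : CommRingCat.{u}}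
    (g : Z ⟶ V.toScheme) (ρ : R ⟶ Γ(X, V)) (h : ⊤ ≤ (g ≫ V.ι) ⁻¹ᵁ V) :
    g ≫ V.toSpecΓ ≫ Spec.map ρ = Z.toSpecΓ ≫ Spec.map (ρ ≫ (g ≫ V.ι).appLE V ⊤ h) := by
  have h1 : V.topIso.inv ≫ g.appTop = (g ≫ V.ι).appLE V ⊤ h := by
    have h2 : V.topIso.inv = V.ι.appLE V ⊤ (by simp) := by
      rw [Opens.ι_appLE, Opens.topIso_inv]
      rfl
    have h3 : g.appTop = g.appLE ⊤ ⊤ le_top := g.appLE_eq_app.symm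
    rw [h2, h3]
    exact Scheme.Hom.appLE_comp_appLE g V.ι V ⊤ ⊤ _ _
  rw [Opens.toSpecΓ, Category.assoc, Scheme.toSpecΓ_naturality_assoc, ← Spec.map_comp,
    ← Spec.map_comp, ← h1, Category.assoc]

section Descent

variable {ι : Type u} [Finite ι] {A : CommRingCat.{u}} {B : ι → CommRingCat.{u}}
  (φ : ∀ i, A ⟶ B i) (hφ : ∀ i, (φ i).hom.Flat)
  (hs : ∀ p : PrimeSpectrum A, ∃ i, ∃ q : PrimeSpectrum (B i), PrimeSpectrum.comap (φ i).hom q = p)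

include hφ hs in
-- The restricted morphisms are flat, quasi-compact and jointly surjective, so they form an fpqc
-- covering of `D`, and the fpqc topology is subcanonical.
theorem isSheafFor_restrict_flat (D : (Spec A).Opens) (T : Scheme.{u}) :
    Presieve.IsSheafFor (yoneda.obj T) (Presieve.ofArrows
      (fun i => (Spec.map (φ i) ⁻¹ᵁ D).toScheme) (fun i => Spec.map (φ i) ∣_ D)) := by
  have hfl : ∀ i, Flat (Spec.map (φ i)) := fun i => Flat.SpecMap_iff.2 (hφ i)
  let 𝒰 : Scheme.Cover.{u} (precoverage @Flat) D.toScheme :=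
    { I₀ := ι
      X := fun i => (Spec.map (φ i) ⁻¹ᵁ D).toScheme
      f := fun i => Spec.map (φ i) ∣_ D
      mem₀ := by
        refine (presieve₀_mem_precoverage_iff (P := @Flat) _).2 ?_
        refine ⟨fun x => ?_, fun i => inferInstanceAs (Flat (Spec.map (φ i) ∣_ D))⟩
        obtain ⟨i, q, hq⟩ := hs x.1
        refine ⟨i, ⟨q, ?_⟩, ?_⟩
        · change (Spec.map (φ i)) q ∈ D
          have : (Spec.map (φ i)) q = x.1 := hq
          rw [this]; exact x.2
        · apply Subtype.ext
          exact (morphismRestrict_base_coe (Spec.map (φ i)) D _).trans hq }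
  have : Finite 𝒰.I₀ := ‹Finite ι›
  have : ∀ i, AlgebraicGeometry.QuasiCompact (𝒰.f i) := fun i =>
    inferInstanceAs (QuasiCompact (Spec.map (φ i) ∣_ D))
  have hj : ∀ P : MorphismProperty Scheme.{u}, JointlySurjective (precoverage P) := inferInstance
  have := hj @Flat
  have : QuasiCompactCover 𝒰.toPreZeroHypercover := QuasiCompactCover.of_finite
  have h1 : Presieve.IsSheaf fpqcTopology (yoneda.obj T) :=
    GrothendieckTopology.Subcanonical.isSheaf_of_isRepresentable _
  have h2 := h1.isSheafFor _ 𝒰.mem_propQCTopology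
  exact h2

include hφ hs in
-- Homomorphisms from `R` to the sections over `D` are morphisms from `D` to `Spec R`, so this is
-- the sheaf property of `Spec R`.
theorem exists_sections_of_flat (D : (Spec A).Opens) {R : CommRingCat.{u}}
    (ρ : ∀ i, R ⟶ Γ(Spec (B i), Spec.map (φ i) ⁻¹ᵁ D))
    (hρ : ∀ (i j) (Z : Scheme.{u}) (a : Z ⟶ Spec (B i)) (b : Z ⟶ Spec (B j)) (ha hb),
      a ≫ Spec.map (φ i) = b ≫ Spec.map (φ j) →
      ρ i ≫ a.appLE (Spec.map (φ i) ⁻¹ᵁ D) ⊤ ha = ρ j ≫ b.appLE (Spec.map (φ j) ⁻¹ᵁ D) ⊤ hb) :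
    ∃! σ : R ⟶ Γ(Spec A, D), ∀ i, σ ≫ (Spec.map (φ i)).app D = ρ i := by
  obtain ⟨g, hg, hg'⟩ := (Presieve.isSheafFor_arrows_iff _ _).1
    (isSheafFor_restrict_flat φ hφ hs D (Spec R))
    (fun i => (Spec.map (φ i) ⁻¹ᵁ D).toSpecΓ ≫ Spec.map (ρ i)) (by
      intro i j Z a b hab
      have h : ∀ (k) (c : Z ⟶ (Spec.map (φ k) ⁻¹ᵁ D).toScheme),
          ⊤ ≤ (c ≫ (Spec.map (φ k) ⁻¹ᵁ D).ι) ⁻¹ᵁ (Spec.map (φ k) ⁻¹ᵁ D) := by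
        intro k c
        simp
      have h1 := comp_toSpecΓ_SpecMap _ a (ρ i) (h i a)
      have h2 := comp_toSpecΓ_SpecMap _ b (ρ j) (h j b)
      refine h1.trans (Eq.trans ?_ h2.symm)
      rw [hρ i j Z (a ≫ (Spec.map (φ i) ⁻¹ᵁ D).ι) (b ≫ (Spec.map (φ j) ⁻¹ᵁ D).ι) (h i a) (h j b)]
      have := congrArg (· ≫ D.ι) hab
      simpa using this)
  refine ⟨D.sectionsOfHom g, fun i => ?_, fun σ hσ => ?_⟩
  · rw [← Opens.sectionsOfHom_toSpecΓ _ (ρ i)]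
    have := hg i
    dsimp at this
    rw [← this, ← Opens.sectionsOfHom_toSpecΓ _ (D.sectionsOfHom g ≫ (Spec.map (φ i)).app D),
      Spec.map_comp, Opens.toSpecΓ_naturality_assoc, Opens.toSpecΓ_sectionsOfHom]
  · rw [← hg' (D.toSpecΓ ≫ Spec.map σ), Opens.sectionsOfHom_toSpecΓ]
    intro i
    dsimp
    rw [← Opens.toSpecΓ_naturality_assoc, ← Spec.map_comp, hσ]

include hφ hs in
-- A section is a homomorphism from the polynomial ring `ℤ[X]`, so the uniqueness in
-- `exists_sections_of_flat` applies.
theorem sections_ext_of_flat (D : (Spec A).Opens) (s t : Γ(Spec A, D))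
    (h : ∀ i, (Spec.map (φ i)).app D s = (Spec.map (φ i)).app D t) : s = t := by
  let R : CommRingCat.{u} := CommRingCat.of (Polynomial (ULift.{u} ℤ))
  let ev : ∀ {S : CommRingCat.{u}}, S → (R ⟶ S) := fun {S} x => CommRingCat.ofHom
    (Polynomial.eval₂RingHom ((Int.castRingHom S).comp ULift.ringEquiv.toRingHom) x)
  have hev : ∀ {S : CommRingCat.{u}} (x : S), ev x (Polynomial.X : Polynomial (ULift.{u} ℤ)) = x :=
    fun x => Polynomial.eval₂_X _ _
  have hcomp : ∀ {S S' : CommRingCat.{u}} (x : S) (f : S ⟶ S'), ev x ≫ f = ev (f x) := by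
    intro S S' x f
    ext : 1
    refine Polynomial.ringHom_ext (fun n => ?_) ?_
    · have hC : ∀ {S : CommRingCat.{u}} (x : S), ev x (Polynomial.C n : Polynomial (ULift.{u} ℤ)) =
          ((n.down : ℤ) : S) := fun x => Polynomial.eval₂_C _ _
      exact (congrArg f (hC x)).trans ((map_intCast f.hom n.down).trans (hC (f x)).symm)
    · exact (congrArg f (hev x)).trans (hev (f x)).symm
  obtain ⟨σ, hσ, huniq⟩ := exists_sections_of_flat φ hφ hs D
    (fun i => ev s ≫ (Spec.map (φ i)).app D) (by
      intro i j Z a b ha hb hab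
      have : ∀ k (c : Z ⟶ Spec (B k)) (hc), (Spec.map (φ k)).app D ≫
          c.appLE (Spec.map (φ k) ⁻¹ᵁ D) ⊤ hc = (c ≫ Spec.map (φ k)).appLE D ⊤ hc :=
        fun k c hc => (Scheme.Hom.comp_appLE _ _ _ _ _).symm
      simp only [Category.assoc]
      rw [this i a ha, this j b hb]
      simp only [hab])
  have h1 := huniq (ev s) (fun i => rfl)
  have h2 := huniq (ev t) (fun i => by rw [hcomp, hcomp, h i])
  rw [← hev s, ← hev t, h1, h2]

end Descent

end AlgebraicGeometry.Scheme

/-! ### Flat descent of morphisms from an affine scheme to a locally ringed space -/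

namespace AlgebraicGeometry.LocallyRingedSpace

open TopologicalSpace

section Descent

/-- The spectrum of a ring as a locally ringed space. -/
noncomputable abbrev specObj (A : CommRingCat.{u}) : LocallyRingedSpace.{u} :=
  Spec.toLocallyRingedSpace.obj (op A)

/-- The morphism of spectra induced by a homomorphism of rings. -/
noncomputable abbrev specMap {A B : CommRingCat.{u}} (φ : A ⟶ B) : specObj B ⟶ specObj A :=
  Spec.toLocallyRingedSpace.map φ.op

theorem specMap_comp {A B C : CommRingCat.{u}} (φ : A ⟶ B) (ψ : B ⟶ C) :
    specMap (φ ≫ ψ) = specMap ψ ≫ specMap φ := by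
  rw [specMap, op_comp, Functor.map_comp]

variable {ι : Type u} [Finite ι] {A : CommRingCat.{u}} {B : ι → CommRingCat.{u}}
  (φ : ∀ i, A ⟶ B i) (hφ : ∀ i, (φ i).hom.Flat)
  (hs : ∀ p : PrimeSpectrum A, ∃ i, ∃ q : PrimeSpectrum (B i), PrimeSpectrum.comap (φ i).hom q = p)

include hφ hs in
theorem sections_ext_of_flat (D : Opens (specObj A)) (s t : (specObj A).presheaf.obj (op D))
    (h : ∀ i, PresheafedSpace.appLE (specMap (φ i)).toHom D _ le_rfl s =
      PresheafedSpace.appLE (specMap (φ i)).toHom D _ le_rfl t) : s = t := by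
  have key : ∀ i, (Spec.map (φ i)).app D =
      PresheafedSpace.appLE (specMap (φ i)).toHom D _ le_rfl := fun i =>
    (PresheafedSpace.appLE_self (specMap (φ i)).toHom D).symm
  refine Scheme.sections_ext_of_flat φ hφ hs D s t fun i => ?_
  exact (congrArg (fun g => g s) (key i)).trans ((h i).trans (congrArg (fun g => g t) (key i)).symm)

include hφ hs in
-- As `T` need not be a scheme, subcanonicity cannot be quoted: joint surjectivity settles the
-- points, and `sections_ext_of_flat` settles the sections.
theorem hom_ext_of_flat {T : LocallyRingedSpace.{u}} {k k' : specObj A ⟶ T}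
    (h : ∀ i, specMap (φ i) ≫ k = specMap (φ i) ≫ k') : k = k' := by
  have hb : k.base = k'.base := by
    ext p
    obtain ⟨i, q, rfl⟩ := hs p
    exact congrArg (fun g : specObj (B i) ⟶ T => g.base q) (h i)
  refine Hom.ext' (PresheafedSpace.hom_ext_appLE hb fun V V' h1 h2 => ?_)
  ext s
  refine sections_ext_of_flat φ hφ hs V' _ _ fun i => ?_
  have h3 : ∀ (k : specObj A ⟶ T) (hk : V' ≤ (Opens.map k.base).obj V),
      PresheafedSpace.appLE (specMap (φ i)).toHom V' _ le_rfl
        (PresheafedSpace.appLE k.toHom V V' hk s) =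
      PresheafedSpace.appLE (specMap (φ i) ≫ k).toHom V ((Opens.map (specMap (φ i)).base).obj V')
        ((Opens.map (specMap (φ i)).base).monotone hk) s := fun k hk =>
    PresheafedSpace.appLE_comp_apply (specMap (φ i)).toHom k.toHom rfl hk le_rfl _ s
  rw [h3 k h1, h3 k' h2]
  exact congrArg (fun g => g s) (PresheafedSpace.appLE_congr (congrArg Hom.toHom (h i)) _ _ _ _)

include hφ hs in
-- The family is assembled into one morphism from a finite coproduct of affine schemes; a flat
-- quasi-compact surjection is a topological quotient map.
theorem isOpen_of_isOpen_preimage_comap (S : Set (PrimeSpectrum A))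
    (hS : ∀ i, IsOpen (PrimeSpectrum.comap (φ i).hom ⁻¹' S)) : IsOpen S := by
  have hfl : ∀ i, Flat (Spec.map (φ i)) := fun i => Flat.SpecMap_iff.2 (hφ i)
  let g : (∐ fun i => Spec (B i)) ⟶ Spec A := Sigma.desc fun i => Spec.map (φ i)
  have hg : ∀ i, Sigma.ι (fun i => Spec (B i)) i ≫ g = Spec.map (φ i) := fun i =>
    Sigma.ι_desc _ _
  have : Surjective g := by
    refine Surjective.sigmaDesc_of_union_range_eq_univ (Set.eq_univ_of_forall fun p => ?_)
    obtain ⟨i, q, hq⟩ := hs p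
    exact Set.mem_iUnion.2 ⟨i, q, hq⟩
  have : Flat g := inferInstanceAs (Flat (Sigma.desc fun i => Spec.map (φ i)))
  refine (Flat.isQuotientMap_of_surjective g).isOpen_preimage.1 ?_
  refine (sigmaMk fun i => Spec (B i)).isOpen_preimage.1 (isOpen_sigma_iff.2 fun i => ?_)
  have h1 : Sigma.mk i ⁻¹' (sigmaMk (fun i => Spec (B i)) ⁻¹' (g ⁻¹' S)) =
      PrimeSpectrum.comap (φ i).hom ⁻¹' S := by
    ext q
    have h2 := congrArg (fun f : Spec (B i) ⟶ Spec A => f q) (hg i)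
    have h3 := congrArg g (sigmaMk_mk (f := fun i => Spec (B i)) i q)
    exact (congrArg (· ∈ S) (h3.trans h2)).to_iff
  exact h1 ▸ hS i

/-- Two primes over the same prime are the kernels of homomorphisms to a common field. -/
theorem _root_.CommRingCat.exists_field_of_comap_eq {A B C : CommRingCat.{u}} (φ : A ⟶ B)
    (ψ : A ⟶ C) (q : PrimeSpectrum B) (r : PrimeSpectrum C)
    (h : PrimeSpectrum.comap φ.hom q = PrimeSpectrum.comap ψ.hom r) :
    ∃ (L : Type u) (_ : Field L) (b : B ⟶ CommRingCat.of L) (c : C ⟶ CommRingCat.of L),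
      φ ≫ b = ψ ≫ c ∧ PrimeSpectrum.comap b.hom ⊥ = q ∧ PrimeSpectrum.comap c.hom ⊥ = r := by
  -- The common field is the residue field of a point of the fibered product of spectra lying over
  -- both primes.
  obtain ⟨z, hz1, hz2⟩ := Scheme.Pullback.exists_preimage_pullback (f := Spec.map φ)
    (g := Spec.map ψ) q r h
  let Z := pullback (Spec.map φ) (Spec.map ψ)
  let e : Spec (Z.residueField z) ⟶ Z := Z.fromSpecResidueField z
  refine ⟨Z.residueField z, inferInstance, Spec.preimage (e ≫ pullback.fst _ _),
    Spec.preimage (e ≫ pullback.snd _ _), ?_, ?_, ?_⟩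
  · apply Spec.map_injective
    rw [Spec.map_comp, Spec.map_comp]
    simp only [Spec.map_preimage, Category.assoc]
    rw [pullback.condition]
  · have h1 : ∀ (B : CommRingCat.{u}) (a : Spec (Z.residueField z) ⟶ Spec B),
        PrimeSpectrum.comap (Spec.preimage a).hom ⊥ =
          a (⊥ : PrimeSpectrum (Z.residueField z)) := fun B a =>
      congrArg (fun f : Spec (Z.residueField z) ⟶ Spec B =>
        f (⊥ : PrimeSpectrum (Z.residueField z))) (Spec.map_preimage a)
    refine (h1 _ _).trans ?_
    refine (Scheme.Hom.comp_apply _ _ _).trans ?_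
    rw [← hz1]
    exact congrArg _ (Scheme.fromSpecResidueField_apply z _)
  · have h1 : ∀ (B : CommRingCat.{u}) (a : Spec (Z.residueField z) ⟶ Spec B),
        PrimeSpectrum.comap (Spec.preimage a).hom ⊥ =
          a (⊥ : PrimeSpectrum (Z.residueField z)) := fun B a =>
      congrArg (fun f : Spec (Z.residueField z) ⟶ Spec B =>
        f (⊥ : PrimeSpectrum (Z.residueField z))) (Spec.map_preimage a)
    refine (h1 _ _).trans ?_
    refine (Scheme.Hom.comp_apply _ _ _).trans ?_
    rw [← hz2]
    exact congrArg _ (Scheme.fromSpecResidueField_apply z _)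

include hφ hs in
-- Compatibility is required on affine test objects only. Those given by fields determine the map on
-- points, the quotient topology makes it continuous, and sections descend over each open set.
theorem exists_hom_of_flat {T : LocallyRingedSpace.{u}} (h : ∀ i, specObj (B i) ⟶ T)
    (hc : ∀ (i j) (R : CommRingCat.{u}) (β : B i ⟶ R) (β' : B j ⟶ R),
      φ i ≫ β = φ j ≫ β' → specMap β ≫ h i = specMap β' ≫ h j) :
    ∃ k : specObj A ⟶ T, ∀ i, specMap (φ i) ≫ k = h i := by
  have hpt : ∀ i j (q : PrimeSpectrum (B i)) (q' : PrimeSpectrum (B j)),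
      PrimeSpectrum.comap (φ i).hom q = PrimeSpectrum.comap (φ j).hom q' →
      (h i).base q = (h j).base q' := by
    intro i j q q' e
    obtain ⟨L, _, b, c, hbc, hb, hc'⟩ := CommRingCat.exists_field_of_comap_eq (φ i) (φ j) q q' e
    have := congrArg (fun f : specObj (CommRingCat.of L) ⟶ T => f.base (⊥ : PrimeSpectrum L))
      (hc i j _ b c hbc)
    rw [← hb, ← hc']
    exact this
  choose i₀ q₀ hq₀ using hs
  let kb : specObj A → T := fun p => (h (i₀ p)).base (q₀ p)
  have hkb : ∀ i (q : PrimeSpectrum (B i)), kb (PrimeSpectrum.comap (φ i).hom q) = (h i).base q :=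
    fun i q => hpt _ _ _ _ (hq₀ _)
  have hs : ∀ p : PrimeSpectrum A, ∃ i, ∃ q : PrimeSpectrum (B i),
    PrimeSpectrum.comap (φ i).hom q = p := fun p => ⟨_, _, hq₀ p⟩
  have hcont : Continuous kb := by
    refine continuous_def.2 fun V hV => isOpen_of_isOpen_preimage_comap φ hφ hs _ fun i => ?_
    have : PrimeSpectrum.comap (φ i).hom ⁻¹' (kb ⁻¹' V) = (h i).base ⁻¹' V := by
      ext q
      exact (congrArg (· ∈ V) (hkb i q)).to_iff
    exact this ▸ hV.preimage (h i).base.hom.continuous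
  let base : (specObj A).carrier ⟶ T.carrier := TopCat.ofHom ⟨kb, hcont⟩
  have hbase : ∀ i, (specMap (φ i)).base ≫ base = (h i).base := by
    intro i
    ext q
    exact hkb i q
  have hle : ∀ i (V : Opens T), (Opens.map (specMap (φ i)).base).obj ((Opens.map base).obj V) ≤
      (Opens.map (h i).base).obj V := by
    intro i V
    rw [← hbase i]
    exact le_rfl
  have hex : ∀ V : Opens T, ∃ σ : T.presheaf.obj (op V) ⟶
      (specObj A).presheaf.obj (op ((Opens.map base).obj V)), ∀ i,
      σ ≫ PresheafedSpace.appLE (specMap (φ i)).toHom _ _ le_rfl =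
        PresheafedSpace.appLE (h i).toHom V _ (hle i V) := by
    intro V
    have key : ∀ i, (Spec.map (φ i)).app ((Opens.map base).obj V) =
        PresheafedSpace.appLE (specMap (φ i)).toHom ((Opens.map base).obj V) _ le_rfl := fun i =>
      (PresheafedSpace.appLE_self (specMap (φ i)).toHom _).symm
    obtain ⟨σ, hσ, -⟩ := Scheme.exists_sections_of_flat φ hφ hs ((Opens.map base).obj V)
      (fun i => PresheafedSpace.appLE (h i).toHom V _ (hle i V)) (by
        intro i j Z a b ha hb hab
        -- A morphism to an affine scheme factors through `Spec Γ(Z, ⊤)`, which reduces arbitrary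
        -- test schemes to affine ones.
        have hfac : ∀ k (c : Z ⟶ Spec (B k)), c = Z.toSpecΓ ≫
            Spec.map ((Scheme.ΓSpecIso _).inv ≫ c.appTop) := by
          intro k c
          rw [Spec.map_comp, ← Scheme.toSpecΓ_naturality_assoc]
          simp
        have hcomp : a.toLRSHom ≫ h i = b.toLRSHom ≫ h j := by
          have h1 : φ i ≫ (Scheme.ΓSpecIso _).inv ≫ a.appTop =
              φ j ≫ (Scheme.ΓSpecIso _).inv ≫ b.appTop := by
            have := congrArg (fun f => (Scheme.ΓSpecIso _).inv ≫ Scheme.Hom.appTop f) hab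
            simpa using this
          have h2 := hc i j _ _ _ h1
          have h3 : ∀ k (c : Z ⟶ Spec (B k)), c.toLRSHom ≫ h k = Z.toSpecΓ.toLRSHom ≫
              specMap ((Scheme.ΓSpecIso _).inv ≫ c.appTop) ≫ h k := by
            intro k c
            refine Eq.trans ?_ (Category.assoc _ _ _)
            exact congrArg (· ≫ h k) (congrArg Scheme.Hom.toLRSHom (hfac k c))
          exact (h3 _ _).trans ((congrArg (Z.toSpecΓ.toLRSHom ≫ ·) h2).trans (h3 _ _).symm)
        have hle' : ⊤ ≤ (Opens.map (a.toLRSHom ≫ h i).base).obj V :=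
          ha.trans ((Opens.map a.toLRSHom.base).monotone (hle i V))
        have hle'' : ⊤ ≤ (Opens.map (b.toLRSHom ≫ h j).base).obj V :=
          hb.trans ((Opens.map b.toLRSHom.base).monotone (hle j V))
        refine (PresheafedSpace.appLE_comp a.toLRSHom.toHom (h i).toHom V _ ⊤ _ ha hle').trans ?_
        refine Eq.trans ?_
          (PresheafedSpace.appLE_comp b.toLRSHom.toHom (h j).toHom V _ ⊤ _ hb hle'').symm
        exact PresheafedSpace.appLE_congr (congrArg Hom.toHom hcomp) _ _ _ _)
    exact ⟨σ, fun i => (congrArg (σ ≫ ·) (key i)).symm.trans (hσ i)⟩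
  choose σ hσ using hex
  let k : (specObj A).toPresheafedSpace ⟶ T.toPresheafedSpace :=
    { base := base
      c :=
        { app := fun V => σ V.unop
          naturality := by
            intro V W f
            ext s
            refine sections_ext_of_flat φ hφ hs _ _ _ fun i => ?_
            have h1 := congrArg (fun g => g (T.presheaf.map f s)) (hσ W.unop i)
            have h2 := congrArg (fun g => g s) (hσ V.unop i)
            have h3 := congrArg (fun g => g s)
              (PresheafedSpace.map_appLE (h i).toHom _ f.unop (hle i W.unop))
            have h4 := congrArg (fun g => g (σ V.unop s))
              (PresheafedSpace.map_appLE (specMap (φ i)).toHom _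
                ((Opens.map base).map f.unop) le_rfl)
            have h5 := congrArg (fun g => g (σ V.unop s)) (PresheafedSpace.appLE_map
              (specMap (φ i)).toHom ((Opens.map (specMap (φ i)).base).map
                ((Opens.map base).map f.unop)) le_rfl)
            have h6 := congrArg (fun g => g s) (PresheafedSpace.appLE_map
              (h i).toHom ((Opens.map (specMap (φ i)).base).map
                ((Opens.map base).map f.unop)) (hle i V.unop))
            refine h1.trans (h3.trans ?_)
            refine Eq.trans ?_ (h5.trans h4.symm)
            refine h6.symm.trans ?_
            exact congrArg (fun x => (specObj (B i)).presheaf.map _ x) h2.symm } }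
  have hk : ∀ i, (specMap (φ i)).toHom ≫ k = (h i).toHom := by
    intro i
    refine PresheafedSpace.hom_ext_appLE (hbase i) fun V V' h1 h2 => ?_
    refine (PresheafedSpace.appLE_comp _ k V _ V' le_rfl h1 h1).symm.trans ?_
    have e1 : PresheafedSpace.appLE k V _ le_rfl = σ V := PresheafedSpace.appLE_self k V
    have e2 := PresheafedSpace.appLE_map (specMap (φ i)).toHom (homOfLE h1)
      (V := (Opens.map base).obj V) le_rfl
    have e3 := PresheafedSpace.appLE_map (h i).toHom (homOfLE h1) (hle i V)
    refine (congrArg (· ≫ _) e1).trans (Eq.trans ?_ e3)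
    refine Eq.trans ?_ (congrArg (· ≫ _) (hσ V i))
    exact (congrArg (σ V ≫ ·) e2.symm).trans (Category.assoc _ _ _).symm
  -- The stalk map of `k` is local because it becomes local after composition with the stalk map of
  -- some `specMap (φ i)`.
  refine ⟨⟨k, fun p => ?_⟩, fun i => Hom.ext' (hk i)⟩
  obtain ⟨i, q, rfl⟩ := hs p
  have h1 : IsLocalHom (((specMap (φ i)).toHom ≫ k).stalkMap q).hom := by
    rw [hk i]
    exact (h i).prop q
  have h2 := PresheafedSpace.stalkMap.comp (specMap (φ i)).toHom k q
  have h3 : IsLocalHom (k.stalkMap ((specMap (φ i)).toHom.base q) ≫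
      (specMap (φ i)).toHom.stalkMap q).hom := h2 ▸ h1
  exact isLocalHom_of_comp (k.stalkMap ((specMap (φ i)).toHom.base q)).hom
    ((specMap (φ i)).toHom.stalkMap q).hom

end Descent

end AlgebraicGeometry.LocallyRingedSpace

/-! ### Flat homomorphisms and flat epimorphisms of rings -/

open scoped TensorProduct in
/-- If `B` is flat over `A` and `1 ⊗ m = 0` in `B ⊗ M`, then the annihilator of `m` generates the
unit ideal of `B`. -/
theorem Module.Flat.exists_smul_eq_zero {A B M : Type u} [CommRing A] [CommRing B] [Algebra A B]
    [Module.Flat A B] [AddCommGroup M] [Module A M] (m : M) (h : (1 : B) ⊗ₜ[A] m = 0)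
    (q : PrimeSpectrum B) : ∃ s : A, algebraMap A B s ∉ q.asIdeal ∧ s • m = 0 := by
  by_contra! H
  -- The annihilator `I` of `m` gives an embedding of `A ⧸ I` in `M`. By flatness `B ⧸ IB` embeds in
  -- `B ⊗ M` with `1` going to `1 ⊗ m = 0`. So `IB = B`, whereas `H` puts `I` inside `q`.
  let I : Ideal A := LinearMap.ker (LinearMap.toSpanSingleton A M m)
  let g : (A ⧸ I) →ₗ[A] M := I.liftQ (LinearMap.toSpanSingleton A M m) le_rfl
  have hg : Function.Injective g := LinearMap.ker_eq_bot.1 (Submodule.ker_liftQ_eq_bot' _ _ rfl)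
  have h1 := Module.Flat.lTensor_preserves_injective_linearMap (M := B) g hg
  have h2 : (1 : B) ⊗ₜ[A] (Ideal.Quotient.mk I 1) = 0 := by
    apply h1
    rw [map_zero, LinearMap.lTensor_tmul]
    have : g (Ideal.Quotient.mk I 1) = m := by
      change LinearMap.toSpanSingleton A M m 1 = m
      simp
    rw [this, h]
  have h3 := congrArg (TensorProduct.tensorQuotEquivQuotSMul B I) h2
  rw [TensorProduct.tensorQuotEquivQuotSMul_tmul_mk, map_zero, one_smul,
    Submodule.Quotient.mk_eq_zero, Ideal.smul_top_eq_map] at h3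
  have h4 : Ideal.map (algebraMap A B) I ≤ q.asIdeal := Ideal.map_le_iff_le_comap.2 fun s hs => by
    by_contra hsq
    exact H s hsq hs
  exact q.2.ne_top ((Ideal.eq_top_iff_one _).2 (h4 h3))

theorem RingHom.Flat.pi {A : Type u} {ι : Type v} [_root_.Finite ι] {B : ι → Type w} [CommRing A]
    [∀ i, CommRing (B i)] (φ : ∀ i, A →+* B i) (h : ∀ i, (φ i).Flat) : (RingHom.pi φ).Flat := by
  classical
  have := Fintype.ofFinite ι
  let := fun i => (φ i).toAlgebra
  have : ∀ i, Module.Flat A (B i) := h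
  exact Module.Flat.of_linearEquiv (DirectSum.linearEquivFunOnFintype A ι B).symm

namespace CommRingCat

variable {A B C : CommRingCat.{u}}

theorem flat_pushout_inl (φ : A ⟶ B) (ψ : A ⟶ C) (h : ψ.hom.Flat) :
    (pushout.inl φ ψ).hom.Flat :=
  RingHom.Flat.isStableUnderBaseChange.pushout_inl RingHom.Flat.respectsIso φ ψ h

theorem flat_comp {φ : A ⟶ B} {ψ : B ⟶ C} (h : φ.hom.Flat) (h' : ψ.hom.Flat) :
    (φ ≫ ψ).hom.Flat := h.comp h'

theorem flat_of_isIso (φ : A ⟶ B) [IsIso φ] : φ.hom.Flat :=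
  .of_bijective (ConcreteCategory.bijective_of_isIso φ)

/-- As `φ` is an epimorphism, `ψ` is, up to isomorphism, the base change of `φ ≫ ψ` along `φ`. -/
theorem flat_of_epi_of_flat_comp (φ : A ⟶ B) (ψ : B ⟶ C) [Epi φ] (h : (φ ≫ ψ).hom.Flat) :
    ψ.hom.Flat := by
  have h1 := flat_pushout_inl φ (φ ≫ ψ) h
  have h2 : ψ = pushout.inl φ (φ ≫ ψ) ≫ inv (pushout.inr φ (φ ≫ ψ)) := by
    rw [IsIso.eq_comp_inv, ← cancel_epi φ, pushout.condition, Category.assoc]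
  rw [h2]
  exact flat_comp h1 (flat_of_isIso _)

theorem epi_of_inl_eq_inr (φ : A ⟶ B) (h : pushout.inl φ φ = pushout.inr φ φ) : Epi φ := by
  refine ⟨fun {Z} f g e => ?_⟩
  rw [← pushout.inl_desc f g e, h, pushout.inr_desc]

open scoped TensorProduct in
theorem exists_mul_eq_zero_of_pushout (φ : A ⟶ B) (hφ : φ.hom.Flat) (ψ : A ⟶ C) (c : C)
    (hc : pushout.inl ψ φ c = 0) (q : PrimeSpectrum B) :
    ∃ s : A, φ s ∉ q.asIdeal ∧ ψ s * c = 0 := by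
  let := φ.hom.toAlgebra
  let := ψ.hom.toAlgebra
  have : Module.Flat A B := hφ
  have hp := CommRingCat.isPushout_tensorProduct A B C
  obtain ⟨s, hs, hs'⟩ := Module.Flat.exists_smul_eq_zero (A := A) (B := B) (M := C) c (by
    have h1 : (ofHom (S := B ⊗[A] C) Algebra.TensorProduct.includeRight.toRingHom : C ⟶ _) =
        pushout.inl ψ φ ≫ pushout.desc _ _ hp.w.symm := (pushout.inl_desc _ _ _).symm
    have h2 := congrArg (fun f => f c) h1
    refine Eq.trans h2 ?_
    rw [CommRingCat.comp_apply, hc, map_zero]) q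
  exact ⟨s, hs, by rw [← hs']; rfl⟩

theorem exists_mul_eq_zero (φ : A ⟶ B) (hφ : φ.hom.Flat) (a : A) (ha : φ a = 0)
    (q : PrimeSpectrum B) : ∃ s : A, φ s ∉ q.asIdeal ∧ s * a = 0 := by
  refine exists_mul_eq_zero_of_pushout φ hφ (𝟙 A) a ?_ q
  have h : pushout.inl (𝟙 A) φ = φ ≫ pushout.inr (𝟙 A) φ := by
    rw [← pushout.condition, Category.id_comp]
  rw [h, CommRingCat.comp_apply, ha, map_zero]

/-- For an epimorphism `1 ⊗ b = b ⊗ 1` in `B ⊗ B`, so the class of `b` in the cokernel of `A → B`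
dies after tensoring with `B`. By flatness some `s` outside `q` kills it: locally, elements of `B`
are fractions from `A`. -/
theorem exists_eq_mul (φ : A ⟶ B) (hφ : φ.hom.Flat) [Epi φ] (b : B) (q : PrimeSpectrum B) :
    ∃ s a : A, φ s ∉ q.asIdeal ∧ φ a = φ s * b := by
  let := φ.hom.toAlgebra
  have : Module.Flat A B := hφ
  have he : Algebra.IsEpi A B := CommRingCat.epi_iff_epi.1 ‹Epi φ›
  let N := B ⧸ LinearMap.range (Algebra.linearMap A B)
  have hb := (Algebra.isEpi_iff_forall_one_tmul_eq A B).1 he b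
  have h1 := congrArg (LinearMap.lTensor B (LinearMap.range (Algebra.linearMap A B)).mkQ) hb
  rw [LinearMap.lTensor_tmul, LinearMap.lTensor_tmul] at h1
  have h2 : (LinearMap.range (Algebra.linearMap A B)).mkQ 1 = 0 := by
    rw [Submodule.mkQ_apply, Submodule.Quotient.mk_eq_zero]
    exact ⟨1, map_one (algebraMap A B)⟩
  rw [h2, TensorProduct.tmul_zero] at h1
  obtain ⟨s, hs, hs'⟩ := Module.Flat.exists_smul_eq_zero (A := A) (B := B) _ h1 q
  rw [← map_smul, Submodule.mkQ_apply, Submodule.Quotient.mk_eq_zero] at hs'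
  obtain ⟨a, ha⟩ := hs'
  exact ⟨s, a, hs, ha.trans (Algebra.smul_def s b)⟩

/-- If `a ≠ 0`, its annihilator lies in a maximal ideal. A prime of some `B i` over that ideal
contradicts `exists_mul_eq_zero`. -/
theorem eq_zero_of_flat {ι : Type v} {B : ι → CommRingCat.{u}} (φ : ∀ i, A ⟶ B i)
    (hφ : ∀ i, (φ i).hom.Flat)
    (hs : ∀ p : PrimeSpectrum A, ∃ i, ∃ q, PrimeSpectrum.comap (φ i).hom q = p) (a : A)
    (ha : ∀ i, φ i a = 0) : a = 0 := by
  by_contra hne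
  let I : Ideal A := LinearMap.ker (LinearMap.toSpanSingleton A A a)
  have hI : I ≠ ⊤ := fun h => hne (by
    have : (1 : A) ∈ I := h ▸ Submodule.mem_top
    simpa [I] using this)
  obtain ⟨M, hM, hIM⟩ := Ideal.exists_le_maximal I hI
  obtain ⟨i, q, hq⟩ := hs ⟨M, hM.isPrime⟩
  obtain ⟨s, hs1, hs2⟩ := exists_mul_eq_zero (φ i) (hφ i) a (ha i) q
  refine hs1 ?_
  have h2 : s ∈ M := hIM hs2
  have h3 : s ∈ (PrimeSpectrum.comap (φ i).hom q).asIdeal := by rw [hq]; exact h2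
  exact h3

/-! ### Points with values in fields -/

variable {K : Type u} [Field K]

/-- A point with values in a field lifts along an epimorphism as soon as its kernel does. -/
theorem exists_lift_of_epi (φ : A ⟶ B) [Epi φ] (a : A ⟶ of K) (q : PrimeSpectrum B)
    (h : PrimeSpectrum.comap φ.hom q = PrimeSpectrum.comap a.hom ⊥) :
    ∃ b : B ⟶ of K, φ ≫ b = a ∧ PrimeSpectrum.comap b.hom ⊥ = q := by
  obtain ⟨L, _, b, c, hbc, hb, hc⟩ := exists_field_of_comap_eq φ a q ⊥ h
  have hff : c.hom.FaithfullyFlat := by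
    let := c.hom.toAlgebra
    change Module.FaithfullyFlat K L
    infer_instance
  -- Inside `L`, the field `K` is the equalizer of the two maps to `L ⊗_K L`. These agree after `b`
  -- because they do after `φ ≫ b`, which factors through `K`, and `φ` is an epimorphism; so `b`
  -- lands in `K`.
  obtain ⟨b', hb'⟩ := Fork.IsLimit.lift' (isLimitForkPushoutSelfOfFaithfullyFlat c hff) b (by
    rw [← cancel_epi φ, ← Category.assoc, ← Category.assoc, hbc, Category.assoc, Category.assoc,
      pushout.condition])
  have hc : Mono c := ConcreteCategory.mono_of_injective c c.hom.injective
  replace hb' : b' ≫ c = b := hb'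
  refine ⟨b', ?_, ?_⟩
  · rw [← cancel_mono c, Category.assoc, ← hbc, hb']
  · rw [← hb, ← hb', CommRingCat.hom_comp, PrimeSpectrum.comap_comp_apply]
    exact congrArg (PrimeSpectrum.comap b'.hom) (Subsingleton.elim (α := PrimeSpectrum K) _ _)

/-- Surjectivity on spectra of a homomorphism to a finite product, in terms of points with values
in fields. -/
theorem comap_pi_surjective_iff {ι : Type u} [Finite ι] {B : ι → CommRingCat.{u}}
    (φ : A ⟶ of (∀ i, B i)) {R : CommRingCat.{u}} (α : R ⟶ A)
    (hα : ∀ i, Epi (α ≫ φ ≫ ofHom (Pi.evalRingHom (fun i => (B i : Type u)) i))) :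
    Function.Surjective (PrimeSpectrum.comap φ.hom) ↔
      ∀ (K : Type u) [Field K] (a : A ⟶ of K), ∃ i, ∃ b : B i ⟶ of K,
        φ ≫ ofHom (Pi.evalRingHom (fun i => (B i : Type u)) i) ≫ b = a := by
  constructor
  · intro h K _ a
    obtain ⟨q, hq⟩ := h (PrimeSpectrum.comap a.hom ⊥)
    obtain ⟨i, r, rfl⟩ := PrimeSpectrum.exists_comap_evalRingHom_eq q
    have h2 := hα i
    have h3 : Epi (φ ≫ ofHom (Pi.evalRingHom (fun i => (B i : Type u)) i)) := epi_of_epi α _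
    obtain ⟨b, hb, -⟩ := exists_lift_of_epi (φ ≫ ofHom (Pi.evalRingHom _ i)) a r hq
    exact ⟨i, b, by rw [← hb, Category.assoc]⟩
  · intro h p
    let e : A ⟶ of p.asIdeal.ResidueField := ofHom (algebraMap A p.asIdeal.ResidueField)
    obtain ⟨i, b, hb⟩ := h _ e
    refine ⟨PrimeSpectrum.comap (ofHom (Pi.evalRingHom (fun i => (B i : Type u)) i) ≫ b).hom ⊥, ?_⟩
    rw [← PrimeSpectrum.comap_comp_apply]
    refine (congrArg (fun f : A ⟶ of p.asIdeal.ResidueField =>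
      PrimeSpectrum.comap f.hom ⊥) hb).trans ?_
    apply PrimeSpectrum.ext
    exact (RingHom.ker_eq_comap_bot _).symm.trans (Ideal.ker_algebraMap_residueField _)

end CommRingCat

/-! ### Schematic posets and schematic morphisms in terms of field-valued points -/

namespace RingedPoset

open PosetDatum

variable {X Y : RingedPoset.{u}}

/-- Points with values in a field `K` at `x` and `y` that agree at some `t ≤ x, y` extend to a
point at some `z ≥ x, y`. -/
def MergesPoints (X : RingedPoset.{u}) : Prop :=
  ∀ {t x y : X.carrier} (hx : t ≤ x) (hy : t ≤ y) (K : Type u) [Field K]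
    (a : X.obj.obj x ⟶ CommRingCat.of K) (b : X.obj.obj y ⟶ CommRingCat.of K),
    X.res hx ≫ a = X.res hy ≫ b → ∃ (z : X.carrier) (hz : x ≤ z) (hz' : y ≤ z)
      (c : X.obj.obj z ⟶ CommRingCat.of K), X.res hz ≫ c = a ∧ X.res hz' ≫ c = b

/-- The description of schematic ringed posets in terms of points with values in fields. -/
structure IsPointwiseSchematic (X : RingedPoset.{u}) : Prop where
  flat : ∀ {x y : X.carrier} (h : x ≤ y), (X.res h).hom.Flat
  epi : ∀ {x y : X.carrier} (h : x ≤ y), Epi (X.res h)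
  merges : X.MergesPoints

/-- Points with values in a field `K` at `x ∈ X` and at `y ≥ f x` that agree at `f x` come from a
point at some `z ≥ x` with `f z ≥ y`. -/
def LiftsPoints (f : X ⟶ Y) : Prop :=
  ∀ (x : X.carrier) {y : Y.carrier} (hy : f.base x ≤ y) (K : Type u) [Field K]
    (a : X.obj.obj x ⟶ CommRingCat.of K) (b : Y.obj.obj y ⟶ CommRingCat.of K),
    f.sharp x ≫ a = Y.res hy ≫ b → ∃ (z : X.carrier) (hz : x ≤ z) (hz' : y ≤ f.base z)
      (c : X.obj.obj z ⟶ CommRingCat.of K), X.res hz ≫ c = a ∧ Y.res hz' ≫ f.sharp z ≫ c = b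

theorem inl_overlapMap {t x y : X.carrier} (hx : t ≤ x) (hy : t ≤ y)
    (z : {z : X.carrier // x ≤ z ∧ y ≤ z}) :
    pushout.inl _ _ ≫ X.overlapMap hx hy ≫ CommRingCat.ofHom (Pi.evalRingHom
      (fun z : {z : X.carrier // x ≤ z ∧ y ≤ z} => (X.obj.obj z.1 : Type u)) z) =
      X.res z.2.1 := by
  rw [overlapMap, pushout.inl_desc_assoc]
  rfl

theorem inr_overlapMap {t x y : X.carrier} (hx : t ≤ x) (hy : t ≤ y)
    (z : {z : X.carrier // x ≤ z ∧ y ≤ z}) :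
    pushout.inr _ _ ≫ X.overlapMap hx hy ≫ CommRingCat.ofHom (Pi.evalRingHom
      (fun z : {z : X.carrier // x ≤ z ∧ y ≤ z} => (X.obj.obj z.1 : Type u)) z) =
      X.res z.2.2 := by
  rw [overlapMap, pushout.inr_desc_assoc]
  rfl

/-- The two coprojections of `𝒪_y ⊗_{𝒪_x} 𝒪_y` agree after the overlap map for the pair `y, y`,
which is injective by faithful flatness. -/
theorem IsSchematic.epi (h : X.IsSchematic) {x y : X.carrier} (hxy : x ≤ y) : Epi (X.res hxy) := by
  refine CommRingCat.epi_of_inl_eq_inr _ ?_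
  have : HasPushout (X.res hxy) (X.res hxy) := HasColimitsOfShape.has_colimit _
  have h1 : pushout.inl _ _ ≫ X.overlapMap hxy hxy = pushout.inr _ _ ≫ X.overlapMap hxy hxy := by
    rw [overlapMap, pushout.inl_desc, pushout.inr_desc]
  exact (ConcreteCategory.mono_of_injective (X.overlapMap hxy hxy)
    (h.faithfullyFlat hxy hxy).injective).right_cancellation _ _ h1

theorem comap_overlapMap_surjective_iff (h : ∀ {x y : X.carrier} (h : x ≤ y), Epi (X.res h))
    {t x y : X.carrier} (hx : t ≤ x) (hy : t ≤ y) :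
    Function.Surjective (PrimeSpectrum.comap (X.overlapMap hx hy).hom) ↔
      ∀ (K : Type u) [Field K] (a : X.obj.obj x ⟶ CommRingCat.of K)
        (b : X.obj.obj y ⟶ CommRingCat.of K), X.res hx ≫ a = X.res hy ≫ b →
        ∃ (z : X.carrier) (hz : x ≤ z) (hz' : y ≤ z) (c : X.obj.obj z ⟶ CommRingCat.of K),
          X.res hz ≫ c = a ∧ X.res hz' ≫ c = b := by
  refine (CommRingCat.comap_pi_surjective_iff
    (B := fun z : {z : X.carrier // x ≤ z ∧ y ≤ z} => X.obj.obj z.1) (X.overlapMap hx hy)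
    (pushout.inl _ _) (fun z => ?_)).trans ⟨fun H K _ a b hab => ?_, fun H K _ p => ?_⟩
  · rw [inl_overlapMap]
    exact h _
  · obtain ⟨z, c, hc⟩ := H K (pushout.desc a b hab)
    refine ⟨z.1, z.2.1, z.2.2, c, ?_, ?_⟩
    · rw [← inl_overlapMap hx hy z, Category.assoc, Category.assoc, hc, pushout.inl_desc]
    · rw [← inr_overlapMap hx hy z, Category.assoc, Category.assoc, hc, pushout.inr_desc]
  · obtain ⟨z, hz, hz', c, hc, hc'⟩ := H K (pushout.inl _ _ ≫ p) (pushout.inr _ _ ≫ p) (by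
      rw [← Category.assoc, pushout.condition, Category.assoc])
    refine ⟨⟨z, hz, hz'⟩, c, ?_⟩
    apply pushout.hom_ext
    · rw [← hc, ← inl_overlapMap hx hy ⟨z, hz, hz'⟩, Category.assoc, Category.assoc]
    · rw [← hc', ← inr_overlapMap hx hy ⟨z, hz, hz'⟩, Category.assoc, Category.assoc]

/-- Once restrictions are flat epimorphisms, the overlap map is automatically flat: it is so after
the epimorphism `pushout.inl`. Only surjectivity on spectra remains. -/
theorem isSchematic_iff : X.IsSchematic ↔ X.IsPointwiseSchematic := by
  refine ⟨fun h => ⟨h.flat, h.epi, fun hx hy => ?_⟩, fun h => ⟨h.flat, fun {t x y} hx hy => ?_⟩⟩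
  · exact (comap_overlapMap_surjective_iff h.epi hx hy).1
      (RingHom.FaithfullyFlat.iff_flat_and_comap_surjective.1 (h.faithfullyFlat hx hy)).2
  · refine RingHom.FaithfullyFlat.iff_flat_and_comap_surjective.2
      ⟨?_, (comap_overlapMap_surjective_iff h.epi hx hy).2 (h.merges hx hy)⟩
    have := h.epi hy
    refine CommRingCat.flat_of_epi_of_flat_comp (pushout.inl _ _) _ ?_
    rw [overlapMap, pushout.inl_desc]
    exact RingHom.Flat.pi _ fun z => h.flat z.2.1

theorem inl_overlapMapHom (f : X ⟶ Y) (x : X.carrier) {y : Y.carrier} (hy : f.base x ≤ y)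
    (z : {z : X.carrier // x ≤ z ∧ y ≤ f.base z}) :
    pushout.inl _ _ ≫ overlapMapHom f x hy ≫ CommRingCat.ofHom (Pi.evalRingHom
      (fun z : {z : X.carrier // x ≤ z ∧ y ≤ f.base z} => (X.obj.obj z.1 : Type u)) z) =
      X.res z.2.1 := by
  rw [overlapMapHom, pushout.inl_desc_assoc]
  rfl

theorem inr_overlapMapHom (f : X ⟶ Y) (x : X.carrier) {y : Y.carrier} (hy : f.base x ≤ y)
    (z : {z : X.carrier // x ≤ z ∧ y ≤ f.base z}) :
    pushout.inr _ _ ≫ overlapMapHom f x hy ≫ CommRingCat.ofHom (Pi.evalRingHom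
      (fun z : {z : X.carrier // x ≤ z ∧ y ≤ f.base z} => (X.obj.obj z.1 : Type u)) z) =
      Y.res z.2.2 ≫ f.sharp z.1 := by
  rw [overlapMapHom, pushout.inr_desc_assoc]
  rfl

theorem isSchematicHom_iff (h : ∀ {x y : X.carrier} (h : x ≤ y), Epi (X.res h)) (f : X ⟶ Y) :
    IsSchematicHom f ↔ LiftsPoints f := by
  refine forall_congr' fun x => forall_congr' fun y => forall_congr' fun hy => ?_
  refine (CommRingCat.comap_pi_surjective_iff
    (B := fun z : {z : X.carrier // x ≤ z ∧ y ≤ f.base z} => X.obj.obj z.1) (overlapMapHom f x hy)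
    (pushout.inl _ _) (fun z => ?_)).trans ⟨fun H K _ a b hab => ?_, fun H K _ p => ?_⟩
  · rw [inl_overlapMapHom]
    exact h _
  · obtain ⟨z, c, hc⟩ := H K (pushout.desc a b hab)
    refine ⟨z.1, z.2.1, z.2.2, c, ?_, ?_⟩
    · rw [← inl_overlapMapHom f x hy z, Category.assoc, Category.assoc, hc, pushout.inl_desc]
    · rw [← Category.assoc, ← inr_overlapMapHom f x hy z, Category.assoc, Category.assoc, hc,
        pushout.inr_desc]
  · obtain ⟨z, hz, hz', c, hc, hc'⟩ := H K (pushout.inl _ _ ≫ p) (pushout.inr _ _ ≫ p) (by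
      rw [← Category.assoc, pushout.condition, Category.assoc])
    refine ⟨⟨z, hz, hz'⟩, c, ?_⟩
    apply pushout.hom_ext
    · rw [← hc, ← inl_overlapMapHom f x hy ⟨z, hz, hz'⟩, Category.assoc, Category.assoc]
    · have h1 := congrArg (· ≫ c) (inr_overlapMapHom f x hy ⟨z, hz, hz'⟩)
      simp only [Category.assoc] at h1
      exact h1.trans hc'

/-! ### Points of `Spec X` -/

section Points

/-- The canonical morphism `Spec 𝒪_{X, x} ⟶ Spec X`. -/
noncomputable abbrev ι (X : RingedPoset.{u}) (x : X.carrier) :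
    LocallyRingedSpace.specObj (X.obj.obj x) ⟶ X.spec :=
  colimit.ι X.specDiagram (op x)

theorem specMap_res_ι {x y : X.carrier} (h : x ≤ y) :
    LocallyRingedSpace.specMap (X.res h) ≫ X.ι x = X.ι y :=
  colimit.w X.specDiagram (homOfLE h).op

theorem ι_specMap (f : X ⟶ Y) (x : X.carrier) :
    X.ι x ≫ specMap f = LocallyRingedSpace.specMap (f.sharp x) ≫ Y.ι (f.base x) :=
  colimit.ι_desc _ _

theorem ι_base_comap {x y : X.carrier} (h : x ≤ y) (q : PrimeSpectrum (X.obj.obj y)) :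
    (X.ι x).base (PrimeSpectrum.comap (X.res h).hom q) = (X.ι y).base q :=
  congrArg (fun f : LocallyRingedSpace.specObj (X.obj.obj y) ⟶ X.spec => f.base q)
    (specMap_res_ι h)

theorem specMap_base_ι (f : X ⟶ Y) (x : X.carrier) (q : PrimeSpectrum (X.obj.obj x)) :
    (specMap f).base ((X.ι x).base q) =
      (Y.ι (f.base x)).base (PrimeSpectrum.comap (f.sharp x).hom q) :=
  congrArg (fun f : LocallyRingedSpace.specObj (X.obj.obj x) ⟶ Y.spec => f.base q)
    (ι_specMap f x)

theorem exists_ι_base_eq (p : X.spec) :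
    ∃ (x : X.carrier) (q : PrimeSpectrum (X.obj.obj x)), (X.ι x).base q = p := by
  obtain ⟨x, q, hq⟩ := LocallyRingedSpace.colimit_exists_rep X.specDiagram p
  exact ⟨x.unop, q, hq⟩

theorem comap_res_comap_res {x y z : X.carrier} (h : x ≤ y) (h' : y ≤ z)
    (q : PrimeSpectrum (X.obj.obj z)) :
    PrimeSpectrum.comap (X.res h).hom (PrimeSpectrum.comap (X.res h').hom q) =
      PrimeSpectrum.comap (X.res (h.trans h')).hom q := by
  rw [← X.res_comp h h', CommRingCat.hom_comp, PrimeSpectrum.comap_comp_apply]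

theorem comap_res_self {x : X.carrier} (h : x ≤ x) (q : PrimeSpectrum (X.obj.obj x)) :
    PrimeSpectrum.comap (X.res h).hom q = q := by
  rw [X.res_self]; rfl

/-- Primes at `x` and `y` that agree at some `t ≤ x, y` come from a prime at some `z ≥ x, y`. -/
theorem MergesPoints.exists_prime (hX : X.MergesPoints) {t x y : X.carrier} (hx : t ≤ x)
    (hy : t ≤ y) (p : PrimeSpectrum (X.obj.obj x)) (q : PrimeSpectrum (X.obj.obj y))
    (h : PrimeSpectrum.comap (X.res hx).hom p = PrimeSpectrum.comap (X.res hy).hom q) :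
    ∃ (z : X.carrier) (hz : x ≤ z) (hz' : y ≤ z) (r : PrimeSpectrum (X.obj.obj z)),
      PrimeSpectrum.comap (X.res hz).hom r = p ∧ PrimeSpectrum.comap (X.res hz').hom r = q := by
  obtain ⟨L, _, a, b, hab, rfl, rfl⟩ := CommRingCat.exists_field_of_comap_eq _ _ p q h
  obtain ⟨z, hz, hz', c, rfl, rfl⟩ := hX hx hy L a b hab
  exact ⟨z, hz, hz', PrimeSpectrum.comap c.hom ⊥, rfl, rfl⟩

/-- Merging makes the relation of coming from a common prime above transitive. It is thus an
equivalence relation, and its quotient detects equality in the colimit. -/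
theorem MergesPoints.ι_base_eq_iff (hX : X.MergesPoints) {x y : X.carrier}
    (p : PrimeSpectrum (X.obj.obj x)) (q : PrimeSpectrum (X.obj.obj y)) :
    (X.ι x).base p = (X.ι y).base q ↔
      ∃ (z : X.carrier) (hz : x ≤ z) (hz' : y ≤ z) (r : PrimeSpectrum (X.obj.obj z)),
        PrimeSpectrum.comap (X.res hz).hom r = p ∧ PrimeSpectrum.comap (X.res hz').hom r = q := by
  refine ⟨fun h => ?_, ?_⟩
  · let s : Setoid (Σ x : X.carrier, PrimeSpectrum (X.obj.obj x)) :=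
      { r := fun p q => ∃ (z : X.carrier) (hz : p.1 ≤ z) (hz' : q.1 ≤ z)
          (r : PrimeSpectrum (X.obj.obj z)), PrimeSpectrum.comap (X.res hz).hom r = p.2 ∧
          PrimeSpectrum.comap (X.res hz').hom r = q.2
        iseqv :=
          { refl := fun p => ⟨p.1, le_rfl, le_rfl, p.2, comap_res_self _ _, comap_res_self _ _⟩
            symm := fun ⟨z, h, h', r, hr, hr'⟩ => ⟨z, h', h, r, hr', hr⟩
            trans := by
              rintro p q s ⟨z, h, h', r, hr, hr'⟩ ⟨w, g, g', r', hg, hg'⟩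
              obtain ⟨v, hv, hv', r'', e, e'⟩ := hX.exists_prime h' g r r' (hr'.trans hg.symm)
              refine ⟨v, h.trans hv, g'.trans hv', r'', ?_, ?_⟩
              · rw [← comap_res_comap_res h hv, e, hr]
              · rw [← comap_res_comap_res g' hv', e', hg'] } }
    obtain ⟨ψ, hψ⟩ := LocallyRingedSpace.colimit_exists_lift X.specDiagram (T := Quotient s)
      (fun x p => Quotient.mk s ⟨x.unop, p⟩) (by
        intro j k f p
        refine Quotient.sound ⟨j.unop, leOfHom f.unop, le_rfl, p, rfl, comap_res_self _ _⟩)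
    have h1 := (hψ (op x) p).symm.trans ((congrArg ψ h).trans (hψ (op y) q))
    exact Quotient.exact h1
  · rintro ⟨z, hz, hz', r, rfl, rfl⟩
    rw [ι_base_comap, ι_base_comap]

end Points

end RingedPoset

namespace CommRingCat

theorem exists_residueField {A : CommRingCat.{u}} (p : PrimeSpectrum A) :
    ∃ (K : Type u) (_ : Field K) (a : A ⟶ of K), PrimeSpectrum.comap a.hom ⊥ = p :=
  ⟨p.asIdeal.ResidueField, inferInstance, ofHom (algebraMap A p.asIdeal.ResidueField),
    PrimeSpectrum.ext
      ((RingHom.ker_eq_comap_bot _).symm.trans (Ideal.ker_algebraMap_residueField _))⟩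

end CommRingCat

/-! ### A criterion for qc-isomorphisms by flat descent -/

namespace RingedPoset

open PosetDatum LocallyRingedSpace

variable {X Y Z : RingedPoset.{u}}

theorem res_sharp_res (g : Y ⟶ Z) {z : Z.carrier} {y w : Y.carrier} (h : z ≤ g.base y)
    (hw : y ≤ w) (h' : z ≤ g.base w) :
    Z.res h ≫ g.sharp y ≫ Y.res hw = Z.res h' ≫ g.sharp w := by
  rw [← g.naturality hw, ← Category.assoc, Z.res_comp]

/-- This is the gluing condition for building the inverse in `isQcIso_of_flat`: `R`-points of `Y`
over the same `R`-point of `Z` coincide in `Spec Y`. By `hm`, the rings `R ⊗_{𝒪_y} 𝒪_w` with `w ≥ y,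
y'` cover `Spec R`, and over each of them both points factor through `𝒪_w`. -/
theorem specMap_comp_ι_eq {g : Y ⟶ Z}
    (hY : ∀ {y y' : Y.carrier} (h : y ≤ y'), (Y.res h).hom.Flat)
    (hZ : ∀ {z z' : Z.carrier} (h : z ≤ z'), Epi (Z.res h)) (hg : ∀ y, Epi (g.sharp y))
    (hm : ∀ {z : Z.carrier} {y y' : Y.carrier} (h : z ≤ g.base y) (h' : z ≤ g.base y')
      (K : Type u) [Field K] (a : Y.obj.obj y ⟶ CommRingCat.of K)
      (b : Y.obj.obj y' ⟶ CommRingCat.of K),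
      Z.res h ≫ g.sharp y ≫ a = Z.res h' ≫ g.sharp y' ≫ b →
      ∃ (w : Y.carrier) (hw : y ≤ w) (hw' : y' ≤ w) (c : Y.obj.obj w ⟶ CommRingCat.of K),
        Y.res hw ≫ c = a ∧ Y.res hw' ≫ c = b)
    {z : Z.carrier} {y y' : Y.carrier} (h : z ≤ g.base y) (h' : z ≤ g.base y')
    {R : CommRingCat.{u}} (β : Y.obj.obj y ⟶ R) (β' : Y.obj.obj y' ⟶ R)
    (e : Z.res h ≫ g.sharp y ≫ β = Z.res h' ≫ g.sharp y' ≫ β') :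
    LocallyRingedSpace.specMap β ≫ Y.ι y = LocallyRingedSpace.specMap β' ≫ Y.ι y' := by
  refine hom_ext_of_flat (ι := {w : Y.carrier // y ≤ w ∧ y' ≤ w})
    (fun w => pushout.inl β (Y.res w.2.1))
    (fun w => CommRingCat.flat_pushout_inl _ _ (hY w.2.1)) (fun r => ?_) fun w => ?_
  · obtain ⟨K, _, k, rfl⟩ := CommRingCat.exists_residueField r
    obtain ⟨w, hw, hw', c, hc, hc'⟩ := hm h h' K (β ≫ k) (β' ≫ k) (by
      have := congrArg (· ≫ k) e
      simpa only [Category.assoc] using this)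
    refine ⟨⟨w, hw, hw'⟩, PrimeSpectrum.comap (pushout.desc k c hc.symm).hom ⊥, ?_⟩
    rw [← PrimeSpectrum.comap_comp_apply, ← CommRingCat.hom_comp, pushout.inl_desc]
  · have := hZ h'
    have := hg y'
    have e1 : β ≫ pushout.inl β (Y.res w.2.1) = Y.res w.2.1 ≫ pushout.inr _ _ := pushout.condition
    have e2 : β' ≫ pushout.inl β (Y.res w.2.1) = Y.res w.2.2 ≫ pushout.inr _ _ := by
      have h1 := res_sharp_res g h w.2.1 (h.trans (g.mono w.2.1))
      have h2 := res_sharp_res g h' w.2.2 (h.trans (g.mono w.2.1))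
      have h3 := congrArg (· ≫ pushout.inl β (Y.res w.2.1)) e
      simp only [Category.assoc] at h3
      -- Homomorphisms out of `𝒪_{y'}` are determined on `𝒪_z`, where `e` applies.
      refine (cancel_epi (Z.res h' ≫ g.sharp y')).1 ?_
      rw [Category.assoc, ← h3, e1]
      have h4 := congrArg (· ≫ pushout.inr β (Y.res w.2.1)) (h1.trans h2.symm)
      simpa only [Category.assoc] using h4
    rw [← Category.assoc, ← Category.assoc, ← LocallyRingedSpace.specMap_comp,
      ← LocallyRingedSpace.specMap_comp, e1, e2, LocallyRingedSpace.specMap_comp,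
      LocallyRingedSpace.specMap_comp, Category.assoc, Category.assoc, specMap_res_ι,
      specMap_res_ι]

/-- A criterion for a flat morphism with epimorphic components to be a qc-isomorphism. -/
theorem isQcIso_of_flat {g : Y ⟶ Z}
    (hY : ∀ {y y' : Y.carrier} (h : y ≤ y'), (Y.res h).hom.Flat)
    (hZ' : ∀ {z z' : Z.carrier} (h : z ≤ z'), (Z.res h).hom.Flat)
    (hZ : ∀ {z z' : Z.carrier} (h : z ≤ z'), Epi (Z.res h)) (hg : ∀ y, Epi (g.sharp y))
    (hg' : IsFlat g)
    (hs : ∀ (z : Z.carrier) (p : PrimeSpectrum (Z.obj.obj z)), ∃ (y : Y.carrier)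
      (h : z ≤ g.base y) (q : PrimeSpectrum (Y.obj.obj y)),
      PrimeSpectrum.comap (Z.res h ≫ g.sharp y).hom q = p)
    (hm : ∀ {z : Z.carrier} {y y' : Y.carrier} (h : z ≤ g.base y) (h' : z ≤ g.base y')
      (K : Type u) [Field K] (a : Y.obj.obj y ⟶ CommRingCat.of K)
      (b : Y.obj.obj y' ⟶ CommRingCat.of K),
      Z.res h ≫ g.sharp y ≫ a = Z.res h' ≫ g.sharp y' ≫ b →
      ∃ (w : Y.carrier) (hw : y ≤ w) (hw' : y' ≤ w) (c : Y.obj.obj w ⟶ CommRingCat.of K),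
        Y.res hw ≫ c = a ∧ Y.res hw' ≫ c = b) : IsQcIso g := by
  let φ : ∀ (z : Z.carrier) (y : {y : Y.carrier // z ≤ g.base y}),
    Z.obj.obj z ⟶ Y.obj.obj y.1 := fun z y => Z.res y.2 ≫ g.sharp y.1
  have hφ : ∀ z y, (φ z y).hom.Flat := fun z y => CommRingCat.flat_comp (hZ' y.2) (hg' y.1)
  have hs' : ∀ z (p : PrimeSpectrum (Z.obj.obj z)), ∃ y, ∃ q,
      PrimeSpectrum.comap (φ z y).hom q = p := fun z p => by
    obtain ⟨y, h, q, hq⟩ := hs z p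
    exact ⟨⟨y, h⟩, q, hq⟩
  -- The inverse on `Spec 𝒪_z` is descended from the canonical morphisms at all `y` lying above `z`.
  have hex : ∀ z, ∃ k : specObj (Z.obj.obj z) ⟶ Y.spec, ∀ y,
      LocallyRingedSpace.specMap (φ z y) ≫ k = Y.ι y.1 := fun z =>
    exists_hom_of_flat (φ z) (hφ z) (hs' z) (fun y => Y.ι y.1) fun y y' R β β' e =>
      specMap_comp_ι_eq hY hZ hg hm y.2 y'.2 β β' (by
        simpa only [φ, Category.assoc] using e)
  choose k hk using hex
  have hres : ∀ {z z' : Z.carrier} (h : z ≤ z'),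
      LocallyRingedSpace.specMap (Z.res h) ≫ k z = k z' := by
    intro z z' h
    refine hom_ext_of_flat (φ z') (hφ z') (hs' z') fun y => ?_
    rw [hk, ← Category.assoc, ← LocallyRingedSpace.specMap_comp]
    have : Z.res h ≫ φ z' y = φ z ⟨y.1, h.trans y.2⟩ := by
      rw [← Category.assoc, Z.res_comp]
    rw [this, hk]
  let K : Z.spec ⟶ Y.spec := colimit.desc Z.specDiagram
    { pt := Y.spec
      ι :=
        { app := fun z => k z.unop
          naturality := fun z z' h =>
            (hres (leOfHom h.unop)).trans (Category.comp_id _).symm } }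
  have hK : ∀ z, Z.ι z ≫ K = k z := fun z => colimit.ι_desc _ _
  refine ⟨K, ?_, ?_⟩
  · refine colimit.hom_ext fun y => ?_
    have h1 : Y.ι y.unop ≫ specMap g ≫ K = Y.ι y.unop := by
      rw [← Category.assoc, ι_specMap, Category.assoc, hK]
      have := hk (g.base y.unop) ⟨y.unop, le_rfl⟩
      simp only [φ, Z.res_self, Category.id_comp] at this
      exact this
    exact h1.trans (Category.comp_id _).symm
  · refine colimit.hom_ext fun z => ?_
    have h1 : Z.ι z.unop ≫ K ≫ specMap g = Z.ι z.unop := by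
      rw [← Category.assoc, hK]
      refine hom_ext_of_flat (φ z.unop) (hφ z.unop) (hs' z.unop) fun y => ?_
      rw [← Category.assoc, hk, ι_specMap, LocallyRingedSpace.specMap_comp, Category.assoc,
        specMap_res_ι]
    exact h1.trans (Category.comp_id _).symm

end RingedPoset

/-! ### Open subsets of `Spec W` and local vanishing of sections -/

/-- The set is the zero locus of the contracted ideal: a prime containing it contains a minimal one,
and minimal primes over a contraction are contractions of primes containing the ideal. -/
theorem PrimeSpectrum.isClosed_setOf_exists_comap_le {A B : Type u} [CommRing A] [CommRing B]
    (φ : A →+* B) {C : Set (PrimeSpectrum B)} (hC : IsClosed C) :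
    IsClosed {q | ∃ r ∈ C, PrimeSpectrum.comap φ r ≤ q} := by
  obtain ⟨I, rfl⟩ := (PrimeSpectrum.isClosed_iff_zeroLocus_ideal C).1 hC
  refine (PrimeSpectrum.isClosed_iff_zeroLocus_ideal _).2 ⟨I.comap φ, ?_⟩
  ext q
  constructor
  · rintro ⟨r, hr, hq⟩
    exact (Ideal.comap_mono hr).trans hq
  · intro hq
    obtain ⟨P, hP, hPq⟩ := Ideal.exists_minimalPrimes_le (I := I.comap φ) (J := q.asIdeal) hq
    obtain ⟨r, hr, hIr, rfl⟩ := Ideal.exists_comap_eq_of_mem_minimalPrimes φ P hP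
    exact ⟨⟨r, hr⟩, hIr, hPq⟩

namespace AlgebraicGeometry.LocallyRingedSpace

open TopologicalSpace

/-- The section of the structure sheaf of `Spec A` defined by an element of `A`. -/
noncomputable def toSections (A : CommRingCat.{u}) (V : Opens (specObj A)) :
    A ⟶ (specObj A).presheaf.obj (op V) :=
  (Scheme.ΓSpecIso A).inv ≫ (Spec A).presheaf.map (homOfLE le_top : V ⟶ ⊤).op

theorem toSections_appLE {A B : CommRingCat.{u}} (φ : A ⟶ B) (V : Opens (specObj A))
    (V' : Opens (specObj B)) (h : V' ≤ (Opens.map (specMap φ).base).obj V) :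
    toSections A V ≫ PresheafedSpace.appLE (specMap φ).toHom V V' h = φ ≫ toSections B V' := by
  have h1 := Scheme.ΓSpecIso_inv_naturality φ
  have h2 := PresheafedSpace.map_appLE (specMap φ).toHom V' (homOfLE le_top : V ⟶ ⊤) h
  have h3 := PresheafedSpace.appLE_map (specMap φ).toHom (V := ⊤) (homOfLE le_top : V' ⟶ ⊤) le_rfl
  have h4 : (Spec.map φ).appTop = PresheafedSpace.appLE (specMap φ).toHom ⊤ ⊤ le_rfl :=
    (PresheafedSpace.appLE_self (specMap φ).toHom _).symm
  refine (Category.assoc _ _ _).trans ((congrArg ((Scheme.ΓSpecIso A).inv ≫ ·) (h2.trans h3.symm)).trans ?_)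
  refine (Category.assoc _ _ _).symm.trans (Eq.trans ?_ (Category.assoc _ _ _))
  refine congrArg (· ≫ _) ?_
  exact (congrArg ((Scheme.ΓSpecIso A).inv ≫ ·) h4).symm.trans h1.symm

theorem isUnit_toSections {A : CommRingCat.{u}} {V : Opens (specObj A)} {s : A}
    (h : ∀ q : PrimeSpectrum A, q ∈ V → s ∉ q.asIdeal) : IsUnit (toSections A V s) := by
  let f : Γ(Spec A, ⊤) := (Scheme.ΓSpecIso A).inv s
  have h1 : V ≤ (Spec A).basicOpen f := by
    rw [basicOpen_eq_of_affine]
    exact fun q hq => h q hq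
  have h2 := (Spec A).toRingedSpace.isUnit_res_basicOpen f
  have h3 := h2.map ((Spec A).presheaf.map (homOfLE h1).op).hom
  have h4 : (Spec A).presheaf.map (homOfLE ((Spec A).basicOpen_le f)).op ≫
      (Spec A).presheaf.map (homOfLE h1).op = (Spec A).presheaf.map (homOfLE le_top : V ⟶ ⊤).op :=
    ((Spec A).presheaf.map_comp _ _).symm
  have h5 := congrArg (fun g => g f) h4
  exact h5 ▸ h3

theorem toSections_eq_zero {A : CommRingCat.{u}} {V : Opens (specObj A)} {a : A}
    (h : ∀ q : PrimeSpectrum A, q ∈ V → ∃ s : A, s ∉ q.asIdeal ∧ s * a = 0) :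
    toSections A V a = 0 := by
  refine (Spec A).IsSheaf.section_ext (U := op V) fun q hq => ?_
  obtain ⟨s, hs, hsa⟩ := h q hq
  let V' : Opens (specObj A) := V ⊓ PrimeSpectrum.basicOpen s
  refine ⟨V', inf_le_left, ⟨hq, hs⟩, ?_⟩
  have h1 : ∀ b : A, (Spec A).presheaf.map (homOfLE (inf_le_left : V' ≤ V)).op (toSections A V b) =
      toSections A V' b := by
    intro b
    have : (Spec A).presheaf.map (homOfLE (le_top : V ≤ ⊤)).op ≫
      (Spec A).presheaf.map (homOfLE (inf_le_left : V' ≤ V)).op =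
        (Spec A).presheaf.map (homOfLE le_top : V' ⟶ ⊤).op :=
      ((Spec A).presheaf.map_comp _ _).symm
    exact congrArg (fun g => g ((Scheme.ΓSpecIso A).inv b)) this
  have h2 : IsUnit (toSections A V' s) := isUnit_toSections fun q hq => hq.2
  have h3 : toSections A V' a = 0 := by
    refine (h2.mul_right_eq_zero).1 ?_
    rw [← map_mul, hsa, map_zero]
  exact (h1 a).trans (h3.trans (map_zero ((Spec A).presheaf.map _).hom).symm)

theorem exists_mul_eq_zero_of_toSections {A : CommRingCat.{u}} {V : Opens (specObj A)} {a : A}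
    (h : toSections A V a = 0) {q : PrimeSpectrum A} (hq : q ∈ V) :
    ∃ s : A, s ∉ q.asIdeal ∧ s * a = 0 := by
  obtain ⟨_, ⟨s, rfl⟩, hqs, hsV⟩ :=
    PrimeSpectrum.isTopologicalBasis_basic_opens.exists_subset_of_mem_open hq V.2
  let f : Γ(Spec A, ⊤) := (Scheme.ΓSpecIso A).inv s
  have h1 : (Spec A).basicOpen f ≤ V := by
    rw [basicOpen_eq_of_affine]
    exact hsV
  have h4 : (Spec A).presheaf.map (homOfLE (le_top : V ≤ ⊤)).op ≫
      (Spec A).presheaf.map (homOfLE h1).op =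
        (Spec A).presheaf.map (homOfLE ((Spec A).basicOpen_le f)).op :=
    ((Spec A).presheaf.map_comp _ _).symm
  have h5 := congrArg (fun g => g ((Scheme.ΓSpecIso A).inv a)) h4
  have h6 : ((Scheme.ΓSpecIso A).inv a : Γ(Spec A, ⊤)) |_ (Spec A).basicOpen f = 0 := by
    refine h5.symm.trans ?_
    exact (congrArg ((Spec A).presheaf.map (homOfLE h1).op) h).trans
      (map_zero ((Spec A).presheaf.map _).hom)
  obtain ⟨n, hn⟩ := exists_pow_mul_eq_zero_of_res_basicOpen_eq_zero_of_isAffineOpen (Spec A)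
    (isAffineOpen_top _) _ f h6
  refine ⟨s ^ n, fun hs => hqs (q.2.mem_of_pow_mem n hs), ?_⟩
  have h7 : (Scheme.ΓSpecIso A).inv (s ^ n * a) = 0 := by
    rw [map_mul, map_pow]; exact hn
  have h8 := congrArg (Scheme.ΓSpecIso A).hom h7
  rwa [map_zero, CategoryTheory.Iso.inv_hom_id_apply] at h8

end AlgebraicGeometry.LocallyRingedSpace

namespace RingedPoset

open PosetDatum LocallyRingedSpace TopologicalSpace

variable {W : RingedPoset.{u}}

/-- An open neighbourhood of the image of a prime `p` at `m` that avoids given closed subsets. -/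
theorem IsPointwiseSchematic.exists_open_avoiding (hW : W.IsPointwiseSchematic) {m : W.carrier}
    (p : PrimeSpectrum (W.obj.obj m)) (K : ∀ y, Set (PrimeSpectrum (W.obj.obj y)))
    (hK : ∀ y, IsClosed (K y))
    (h : ∀ (y z : W.carrier) (hy : y ≤ z) (hm : m ≤ z) (r : PrimeSpectrum (W.obj.obj z)),
      PrimeSpectrum.comap (W.res hm).hom r ≤ p → PrimeSpectrum.comap (W.res hy).hom r ∉ K y) :
    ∃ V : Opens W.spec, (W.ι m).base p ∈ V ∧
      ∀ y (q : PrimeSpectrum (W.obj.obj y)), (W.ι y).base q ∈ V → q ∉ K y := by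
  -- All specializations at `x` of points lying over some `K y`. These closed sets match under
  -- restriction, so their complements glue to an open subset of the colimit.
  let Z : ∀ x : W.carrier, Set (PrimeSpectrum (W.obj.obj x)) := fun x =>
    {q | ∃ (y z : W.carrier) (hx : x ≤ z) (hy : y ≤ z) (r : PrimeSpectrum (W.obj.obj z)),
      PrimeSpectrum.comap (W.res hy).hom r ∈ K y ∧ PrimeSpectrum.comap (W.res hx).hom r ≤ q}
  have hZ : ∀ x, IsClosed (Z x) := by
    intro x
    have : Z x = ⋃ yz : {yz : W.carrier × W.carrier // x ≤ yz.2 ∧ yz.1 ≤ yz.2},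
        {q | ∃ r ∈ PrimeSpectrum.comap (W.res yz.2.2).hom ⁻¹' K yz.1.1,
          PrimeSpectrum.comap (W.res yz.2.1).hom r ≤ q} := by
      ext q
      simp only [Set.mem_iUnion]
      constructor
      · rintro ⟨y, z, hx, hy, r, hr, hq⟩
        exact ⟨⟨(y, z), hx, hy⟩, r, hr, hq⟩
      · rintro ⟨⟨⟨y, z⟩, hx, hy⟩, r, hr, hq⟩
        exact ⟨y, z, hx, hy, r, hr, hq⟩
    rw [this]
    exact isClosed_iUnion_of_finite fun yz => PrimeSpectrum.isClosed_setOf_exists_comap_le _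
      ((hK _).preimage (PrimeSpectrum.continuous_comap _))
  have hcompat : ∀ {x x' : W.carrier} (hx : x ≤ x') (q : PrimeSpectrum (W.obj.obj x')),
      PrimeSpectrum.comap (W.res hx).hom q ∈ Z x ↔ q ∈ Z x' := by
    intro x x' hx q
    constructor
    · rintro ⟨y, z, hxz, hy, r, hr, hq⟩
      -- Going down along the flat restriction replaces `q` by a generalization with the same image
      -- as `r`; merging then gives a prime above both.
      obtain ⟨q', hq', e⟩ := (hW.flat hx).generalizingMap_comap
        ((PrimeSpectrum.le_iff_specializes _ _).1 hq)
      obtain ⟨z', hz, hx', r', rfl, rfl⟩ := MergesPoints.exists_prime hW.merges hxz hx r q' e.symm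
      refine ⟨y, z', hx', hy.trans hz, r', ?_, (PrimeSpectrum.le_iff_specializes _ _).2 hq'⟩
      rwa [← comap_res_comap_res hy hz]
    · rintro ⟨y, z, hxz, hy, r, hr, hq⟩
      refine ⟨y, z, hx.trans hxz, hy, r, hr, ?_⟩
      rw [← comap_res_comap_res hx hxz]
      exact Ideal.comap_mono hq
  obtain ⟨ψ, hψ⟩ := colimit_exists_lift W.specDiagram (T := ULift.{u} Prop)
    (fun x q => ULift.up (q ∈ Z x.unop)) (fun {j k} f q => congrArg ULift.up
      (propext (hcompat (leOfHom f.unop) q)))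
  have hψ' : ∀ x (q : PrimeSpectrum (W.obj.obj x)), (ψ ((W.ι x).base q)).down = (q ∈ Z x) :=
    fun x q => congrArg ULift.down (hψ (op x) q)
  refine ⟨⟨{ξ | ¬ (ψ ξ).down}, isOpen_colimit W.specDiagram _ fun x => ?_⟩, ?_, fun y q hq hK => ?_⟩
  · have : (colimit.ι W.specDiagram x).base ⁻¹' {ξ | ¬ (ψ ξ).down} = (Z x.unop)ᶜ := by
      ext q
      exact not_congr (hψ' x.unop q).to_iff
    exact this ▸ (hZ x.unop).isOpen_compl
  · change ¬ (ψ ((W.ι m).base p)).down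
    rw [hψ' m p]
    rintro ⟨y, z, hm, hy, r, hr, hp⟩
    exact h y z hy hm r hp hr
  · refine hq ((hψ' y q).to_iff.2 ⟨y, y, le_rfl, le_rfl, q, ?_, ?_⟩)
    · rwa [comap_res_self]
    · rw [comap_res_self]

end RingedPoset

/-! ### Consequences of being a qc-isomorphism -/

namespace RingedPoset

open PosetDatum LocallyRingedSpace TopologicalSpace

variable {U W : RingedPoset.{u}}

theorem res_res_apply (W : RingedPoset.{u}) {x y z : W.carrier} (h : x ≤ y) (h' : y ≤ z)
    (a : W.obj.obj x) : W.res h' (W.res h a) = W.res (h.trans h') a :=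
  congrArg (fun f => f a) (W.res_comp h h')

theorem res_self_apply (W : RingedPoset.{u}) {x : W.carrier} (h : x ≤ x) (a : W.obj.obj x) :
    W.res h a = a :=
  congrArg (fun f => f a) (W.res_self h)

theorem res_sharp_res_apply (δ : U ⟶ W) {x : W.carrier} {v v' : U.carrier} (h : x ≤ δ.base v)
    (hv : v ≤ v') (h' : x ≤ δ.base v') (a : W.obj.obj x) :
    U.res hv (δ.sharp v (W.res h a)) = δ.sharp v' (W.res h' a) :=
  congrArg (fun f => f a) (res_sharp_res δ h hv h')

/-- Surjectivity of `Spec δ` gives a prime of `U` with the same image in `Spec W`. The description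
of equality there provides a common prime, and epimorphisms allow the `K`-point to follow without
enlarging `K`. -/
theorem IsQcIso.exists_point {δ : U ⟶ W} (h : IsQcIso δ) (hW : W.IsPointwiseSchematic)
    (hδ : LiftsPoints δ) (he : ∀ u, Epi (δ.sharp u)) {w : W.carrier} {K : Type u} [Field K]
    (a : W.obj.obj w ⟶ CommRingCat.of K) :
    ∃ (v : U.carrier) (hv : w ≤ δ.base v) (c : U.obj.obj v ⟶ CommRingCat.of K),
      W.res hv ≫ δ.sharp v ≫ c = a := by
  have : IsIso (specMap δ) := h
  let p := PrimeSpectrum.comap a.hom ⊥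
  obtain ⟨u, q, hq⟩ := exists_ι_base_eq ((inv (specMap δ)).base ((W.ι w).base p))
  have h1 : (W.ι w).base p = (W.ι (δ.base u)).base (PrimeSpectrum.comap (δ.sharp u).hom q) := by
    rw [← specMap_base_ι, hq]
    exact congrArg (fun f : W.spec ⟶ W.spec => f.base ((W.ι w).base p))
      (IsIso.inv_hom_id (specMap δ)).symm
  obtain ⟨z, hz, hz', r, hr, hr'⟩ := (MergesPoints.ι_base_eq_iff hW.merges _ _).1 h1
  have := hW.epi hz
  obtain ⟨a', ha', har⟩ := CommRingCat.exists_lift_of_epi (W.res hz) a r hr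
  have := he u
  obtain ⟨b, hb, -⟩ := CommRingCat.exists_lift_of_epi (δ.sharp u) (W.res hz' ≫ a') q (by
    rw [← hr', ← har, CommRingCat.hom_comp, PrimeSpectrum.comap_comp_apply])
  obtain ⟨v, hv, hv', c, -, hc⟩ := hδ u hz' K b a' hb
  refine ⟨v, hz.trans hv', c, ?_⟩
  rw [← W.res_comp hz hv', Category.assoc, hc, ha']

/-- The sections at `w` that vanish at all points of `U` above `w`. -/
def VanishesOver (δ : U ⟶ W) (w : W.carrier) (a : W.obj.obj w) : Prop :=
  ∀ (v : U.carrier) (h : w ≤ δ.base v), δ.sharp v (W.res h a) = 0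

/-- Near `p` the section `j` is a fraction `c / s` from `x`. The numerator need not vanish over `x`,
but its image in `𝒪_v ⊗_{𝒪_x} 𝒪_m` is zero, so for each of the finitely many `v` some `t v` outside
`p` kills it. -/
theorem exists_vanishesOver (hW : W.IsPointwiseSchematic) (hU : U.IsPointwiseSchematic) {δ : U ⟶ W}
    (hδ : LiftsPoints δ) {x m : W.carrier} (hx : x ≤ m) {j : W.obj.obj m} (hj : VanishesOver δ m j)
    (p : PrimeSpectrum (W.obj.obj m)) : ∃ s a : W.obj.obj x, VanishesOver δ x a ∧
      W.res hx s ∉ p.asIdeal ∧ W.res hx a = W.res hx s * j := by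
  have hepi := hW.epi hx
  obtain ⟨s, c, hs, hc⟩ := CommRingCat.exists_eq_mul (W.res hx) (hW.flat hx) j p
  have key : ∀ v : {v : U.carrier // x ≤ δ.base v}, ∃ t : W.obj.obj x, W.res hx t ∉ p.asIdeal ∧
      (W.res v.2 ≫ δ.sharp v.1) t * (W.res v.2 ≫ δ.sharp v.1) c = 0 := by
    rintro ⟨v, hv⟩
    refine CommRingCat.exists_mul_eq_zero_of_pushout (W.res hx) (hW.flat hx)
      (W.res hv ≫ δ.sharp v) _ ?_ p
    have hcond : ∀ v' : {v' : U.carrier // v ≤ v' ∧ m ≤ δ.base v'},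
        (W.res hv ≫ δ.sharp v) ≫ U.res v'.2.1 = W.res hx ≫ W.res v'.2.2 ≫ δ.sharp v'.1 := by
      intro v'
      rw [Category.assoc, res_sharp_res δ hv v'.2.1 (hx.trans v'.2.2), ← Category.assoc,
        W.res_comp]
    -- Vanishing in the tensor product is tested at all `v'` above both `v` and `m`. They cover its
    -- spectrum by merging in `W` and lifting along `δ`.
    refine CommRingCat.eq_zero_of_flat (ι := {v' : U.carrier // v ≤ v' ∧ m ≤ δ.base v'})
      (fun v' => pushout.desc (U.res v'.2.1) (W.res v'.2.2 ≫ δ.sharp v'.1) (hcond v'))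
      (fun v' => ?_) (fun r => ?_) _ fun v' => ?_
    · refine CommRingCat.flat_of_epi_of_flat_comp (pushout.inl _ _) _ ?_
      rw [pushout.inl_desc]
      exact hU.flat _
    · obtain ⟨K, _, k, rfl⟩ := CommRingCat.exists_residueField r
      obtain ⟨w, hw, hw', c', hc1, hc2⟩ := hW.merges hv hx K
        (δ.sharp v ≫ pushout.inl (W.res hv ≫ δ.sharp v) (W.res hx) ≫ k)
        (pushout.inr (W.res hv ≫ δ.sharp v) (W.res hx) ≫ k) (by
          have := congrArg (· ≫ k) (pushout.condition (f := W.res hv ≫ δ.sharp v) (g := W.res hx))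
          simpa only [Category.assoc] using this)
      obtain ⟨v', hv', hvw, c'', hc3, hc4⟩ := hδ v hw K
        (pushout.inl (W.res hv ≫ δ.sharp v) (W.res hx) ≫ k) c' hc1.symm
      refine ⟨⟨v', hv', hw'.trans hvw⟩, PrimeSpectrum.comap c''.hom ⊥, ?_⟩
      rw [← PrimeSpectrum.comap_comp_apply, ← CommRingCat.hom_comp]
      congr 2
      apply pushout.hom_ext
      · rw [pushout.inl_desc_assoc, hc3]
      · rw [pushout.inr_desc_assoc, ← hc2, ← hc4, ← Category.assoc (W.res hw'), W.res_comp,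
          Category.assoc]
    · have h1 := congrArg (fun f => f ((W.res hv ≫ δ.sharp v) c))
        (pushout.inl_desc (U.res v'.2.1) (W.res v'.2.2 ≫ δ.sharp v'.1) (hcond v'))
      refine h1.trans ((res_sharp_res_apply δ hv v'.2.1 (hx.trans v'.2.2) c).trans ?_)
      rw [← res_res_apply W hx v'.2.2, hc, map_mul, map_mul, hj v'.1 v'.2.2, mul_zero]
  choose t ht ht' using key
  classical
  have := Fintype.ofFinite {v : U.carrier // x ≤ δ.base v}
  refine ⟨(∏ v, t v) * s, (∏ v, t v) * c, fun v hv => ?_, ?_, ?_⟩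
  · rw [Fintype.prod_eq_mul_prod_compl (⟨v, hv⟩ : {v : U.carrier // x ≤ δ.base v}) t,
      mul_right_comm, map_mul, map_mul]
    have h1 : δ.sharp v (W.res hv (t ⟨v, hv⟩ * c)) = 0 := by
      rw [map_mul, map_mul]; exact ht' ⟨v, hv⟩
    rw [h1, zero_mul]
  · rw [map_mul, map_prod]
    refine fun h => (p.2.mem_or_mem h).elim (fun h => ?_) hs
    obtain ⟨v, -, hv⟩ := (Ideal.IsPrime.prod_mem_iff (hp := p.2)).1 h
    exact ht v hv
  · rw [map_mul, map_mul, hc, mul_assoc]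

/-- An element of a stalk need not extend over `Spec W`. A bad element `j` is taken at a maximal
index `m` and extended to a section over an open neighbourhood of a prime `p` containing its
annihilator. That section pulls back to zero along the isomorphism `Spec δ`, so it is zero,
contradicting the choice of `p`. -/
theorem IsQcIso.eq_zero_of_vanishesOver {δ : U ⟶ W} (h : IsQcIso δ) (hW : W.IsPointwiseSchematic)
    (hU : U.IsPointwiseSchematic) (hδ : LiftsPoints δ) {w : W.carrier} {b : W.obj.obj w}
    (hb : VanishesOver δ w b) : b = 0 := by
  by_contra hne
  obtain ⟨m, ⟨j, hj, hj0⟩, hmax⟩ := (Set.toFinite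
    {m : W.carrier | ∃ j, VanishesOver δ m j ∧ j ≠ 0}).exists_maximal ⟨w, b, hb, hne⟩
  obtain ⟨p, hp⟩ : ∃ p : PrimeSpectrum (W.obj.obj m), ∀ s, s * j = 0 → s ∈ p.asIdeal := by
    let I : Ideal (W.obj.obj m) := LinearMap.ker (LinearMap.toSpanSingleton _ (W.obj.obj m) j)
    have hI : I ≠ ⊤ := fun h => hj0 (by
      have : (1 : W.obj.obj m) ∈ I := h ▸ Submodule.mem_top
      simpa [I] using this)
    obtain ⟨M, hM, hIM⟩ := Ideal.exists_le_maximal I hI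
    exact ⟨⟨M, hM.isPrime⟩, fun s hs => hIM (by simpa [I] using hs)⟩
  -- The local candidates `a x / s x` represent `j` when `x ≤ m` and are `0 / 1` otherwise.
  have hex : ∀ x, ∃ s a : W.obj.obj x, VanishesOver δ x a ∧
      (∀ hx : x ≤ m, W.res hx s ∉ p.asIdeal ∧ W.res hx a = W.res hx s * j) ∧
      (¬ x ≤ m → s = 1 ∧ a = 0) := by
    intro x
    by_cases hx : x ≤ m
    · obtain ⟨s, a, h1, h2, h3⟩ := exists_vanishesOver hW hU hδ hx hj p
      exact ⟨s, a, h1, fun _ => ⟨h2, h3⟩, fun h => (h hx).elim⟩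
    · exact ⟨1, 0, fun v hv => by rw [map_zero, map_zero], fun h => (hx h).elim,
        fun _ => ⟨rfl, rfl⟩⟩
  choose s a ha hs hs' using hex
  let e : ∀ {x y : W.carrier}, x ≤ y → W.obj.obj y := fun {x y} h =>
    W.res h (a x) * s y - a y * W.res h (s x)
  -- The closed locus to avoid at `y`: either the denominator vanishes, or the cross difference `e`
  -- from some `x ≤ y` is non-zero in the local ring.
  let K : ∀ y, Set (PrimeSpectrum (W.obj.obj y)) := fun y => PrimeSpectrum.zeroLocus {s y} ∪
    ⋃ x : {x : W.carrier // x ≤ y}, PrimeSpectrum.zeroLocus {t | t * e x.2 = 0}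
  obtain ⟨V, hpV, hV⟩ := hW.exists_open_avoiding p K (fun y => by
      exact (PrimeSpectrum.isClosed_zeroLocus _).union
        (isClosed_iUnion_of_finite fun x => PrimeSpectrum.isClosed_zeroLocus _)) (by
      intro y z hy hm r hr hK
      have hrp : ∀ {x : W.carrier} (hx : x ≤ m) (t : W.obj.obj x),
          W.res (hx.trans hm) t ∈ r.asIdeal → W.res hx t ∈ p.asIdeal := by
        intro x hx t ht
        refine hr ?_
        change W.res hm (W.res hx t) ∈ r.asIdeal
        rwa [res_res_apply]
      rcases hK with hK | hK
      · have h1 : W.res hy (s y) ∈ r.asIdeal := hK rfl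
        by_cases hym : y ≤ m
        · exact (hs y hym).1 (hrp hym _ h1)
        · rw [(hs' y hym).1, map_one] at h1
          exact r.2.ne_top ((Ideal.eq_top_iff_one _).2 h1)
      · obtain ⟨⟨x, hxy⟩, hK⟩ := Set.mem_iUnion.1 hK
        by_cases hym : y ≤ m
        · obtain ⟨t, ht, ht'⟩ := CommRingCat.exists_mul_eq_zero (W.res hym) (hW.flat hym) (e hxy) (by
            simp only [e]
            rw [map_sub, map_mul, map_mul, res_res_apply, res_res_apply, (hs y hym).2,
              (hs x (hxy.trans hym)).2]
            ring) p
          exact ht (hrp hym t (hK ht'))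
        · by_cases hxm : x ≤ m
          · have hz0 : W.res (hxy.trans hy) (a x) = 0 := by
              by_contra hne
              have hzS : z ∈ {m : W.carrier | ∃ j, VanishesOver δ m j ∧ j ≠ 0} := by
                refine ⟨_, fun v hv => ?_, hne⟩
                rw [res_res_apply]
                exact ha x v _
              exact hym (hy.trans (hmax hzS hm))
            obtain ⟨t, ht, ht'⟩ := CommRingCat.exists_mul_eq_zero (W.res hy) (hW.flat hy) (e hxy) (by
              simp only [e]
              rw [(hs' y hym).1, (hs' y hym).2, zero_mul, sub_zero, mul_one, res_res_apply, hz0]) r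
            exact ht (hK ht')
          · have h1 : (1 : W.obj.obj y) ∈ (PrimeSpectrum.comap (W.res hy).hom r).asIdeal := by
              refine hK ?_
              change 1 * e hxy = 0
              simp only [e]
              rw [(hs' y hym).2, (hs' x hxm).2, map_zero, zero_mul, zero_mul, sub_zero, mul_zero]
            exact (PrimeSpectrum.comap (W.res hy).hom r).2.ne_top ((Ideal.eq_top_iff_one _).2 h1))
  let Vx : ∀ x, Opens (specObj (W.obj.obj x)) := fun x => (Opens.map (W.ι x).base).obj V
  have hunit : ∀ x, IsUnit (toSections (W.obj.obj x) (Vx x) (s x)) := fun x =>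
    isUnit_toSections fun q hq hsq => hV x q hq (Or.inl (by
      rintro _ rfl
      exact hsq))
  have hzero : ∀ {x y : W.carrier} (hxy : x ≤ y), toSections _ (Vx y) (e hxy) = 0 := by
    intro x y hxy
    refine toSections_eq_zero fun q hq => ?_
    by_contra! H
    refine hV y q hq (Or.inr (Set.mem_iUnion.2 ⟨⟨x, hxy⟩, fun t ht => ?_⟩))
    by_contra hne
    exact H t hne ht
  choose σ hσ using fun x => (hunit x).dvd (a := toSections (W.obj.obj x) (Vx x) (a x))
  obtain ⟨t, ht⟩ := colimit_sections_exists W.specDiagram V (fun x => σ x.unop) (by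
    intro y x f hf
    have hxy : x.unop ≤ y.unop := leOfHom f.unop
    let τ : (specObj (W.obj.obj y.unop)).presheaf.obj (op (Vx y.unop)) :=
      PresheafedSpace.appLE (LocallyRingedSpace.specMap (W.res hxy)).toHom _ _ hf (σ x.unop)
    have h0 := toSections_appLE (W.res hxy) (Vx x.unop) (Vx y.unop) hf
    have h1 : toSections _ (Vx y.unop) (W.res hxy (a x.unop)) =
        toSections _ (Vx y.unop) (W.res hxy (s x.unop)) * τ := by
      have h2 := congrArg (fun f => f (a x.unop)) h0
      have h3 := congrArg (fun f => f (s x.unop)) h0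
      refine h2.symm.trans ?_
      refine (congrArg (PresheafedSpace.appLE (LocallyRingedSpace.specMap (W.res hxy)).toHom _ _ hf)
        (hσ x.unop)).trans ?_
      refine (map_mul (PresheafedSpace.appLE _ _ _ hf).hom _ _).trans ?_
      exact congrArg (· * τ) h3
    have h4 : IsUnit (toSections _ (Vx y.unop) (W.res hxy (s x.unop))) := by
      have h3 := congrArg (fun f => f (s x.unop)) h0
      exact h3 ▸ (hunit x.unop).map (PresheafedSpace.appLE _ _ _ hf).hom
    have h5 := hzero hxy
    simp only [e] at h5
    rw [map_sub, map_mul, map_mul, h1, hσ y.unop] at h5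
    have h6 : toSections _ (Vx y.unop) (W.res hxy (s x.unop)) *
        toSections _ (Vx y.unop) (s y.unop) * (τ - σ y.unop) = 0 := by
      rw [← h5]; ring
    exact sub_eq_zero.1 (((h4.mul (hunit y.unop)).mul_right_eq_zero).1 h6))
  have hpull : PresheafedSpace.appLE (specMap δ).toHom V _ le_rfl t = 0 := by
    refine colimit_sections_ext U.specDiagram _ _ _ fun u => ?_
    refine Eq.trans ?_ (map_zero (PresheafedSpace.appLE _ _ _ _).hom).symm
    let v := u.unop
    have hle : (Opens.map (U.ι v).base).obj ((Opens.map (specMap δ).base).obj V) ≤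
        (Opens.map (LocallyRingedSpace.specMap (δ.sharp v)).base).obj (Vx (δ.base v)) := by
      intro q hq
      change (W.ι (δ.base v)).base (PrimeSpectrum.comap (δ.sharp v).hom q) ∈ V
      exact (congrArg (· ∈ V) (specMap_base_ι δ v q)).mp hq
    have h1 := PresheafedSpace.appLE_comp_apply (U.ι v).toHom (specMap δ).toHom
      (k := (U.ι v ≫ specMap δ).toHom) rfl (V := V) le_rfl le_rfl le_rfl t
    have h2 := PresheafedSpace.appLE_comp_apply (LocallyRingedSpace.specMap (δ.sharp v)).toHom
      (W.ι (δ.base v)).toHom (k := (U.ι v ≫ specMap δ).toHom)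
      (congrArg Hom.toHom (ι_specMap δ v)).symm (V := V) le_rfl hle le_rfl t
    refine (h1.trans h2.symm).trans ?_
    rw [show PresheafedSpace.appLE (W.ι (δ.base v)).toHom V _ le_rfl t = σ (δ.base v) from
      ht (op (δ.base v))]
    have h0 := toSections_appLE (δ.sharp v) (Vx (δ.base v)) _ hle
    have h3 := congrArg (fun f => f (s (δ.base v))) h0
    have h4 := congrArg (fun f => f (a (δ.base v))) h0
    have h5 := (hunit (δ.base v)).map (PresheafedSpace.appLE
      (LocallyRingedSpace.specMap (δ.sharp v)).toHom _ _ hle).hom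
    refine (h5.mul_right_eq_zero).1 ?_
    refine (map_mul (PresheafedSpace.appLE
      (LocallyRingedSpace.specMap (δ.sharp v)).toHom _ _ hle).hom _ _).symm.trans ?_
    refine (congrArg _ (hσ (δ.base v)).symm).trans (h4.trans ?_)
    have h6 := ha (δ.base v) v le_rfl
    rw [res_self_apply] at h6
    exact (congrArg _ h6).trans (map_zero (toSections _ _).hom)
  -- Pulling back along the inverse of `Spec δ` recovers `t` from zero.
  have ht0 : t = 0 := by
    have : IsIso (specMap δ) := h
    have e1 : (inv (specMap δ)).toHom ≫ (specMap δ).toHom = 𝟙 W.spec.toPresheafedSpace :=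
      congrArg LocallyRingedSpace.Hom.toHom (IsIso.inv_hom_id (specMap δ))
    have hle : V ≤ (Opens.map (inv (specMap δ)).base).obj
        ((Opens.map (specMap δ).base).obj V) := by
      intro ξ hξ
      have := congrArg (fun f : W.spec ⟶ W.spec => f.base ξ) (IsIso.inv_hom_id (specMap δ))
      exact (congrArg (· ∈ V) this).mpr hξ
    have h1 := PresheafedSpace.appLE_comp_apply _ _ e1 (V := V) le_rfl hle le_rfl t
    rw [hpull, map_zero] at h1
    refine Eq.trans ?_ h1.symm
    exact (congrArg (fun f => f t) (PresheafedSpace.appLE_self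
      (𝟙 W.spec.toPresheafedSpace) V)).symm
  have hm0 : toSections _ (Vx m) (a m) = 0 := by
    have h1 : σ m = 0 := by
      rw [← ht (op m), ht0]
      exact map_zero (PresheafedSpace.appLE _ _ _ _).hom
    rw [hσ m, h1, mul_zero]
  obtain ⟨c, hc, hc'⟩ := exists_mul_eq_zero_of_toSections hm0 (q := p) hpV
  have h1 := (hs m le_rfl).1
  have h2 := (hs m le_rfl).2
  rw [res_self_apply] at h1
  rw [res_self_apply, res_self_apply] at h2
  rw [h2, ← mul_assoc] at hc'
  exact (p.2.mem_or_mem (hp _ hc')).elim hc h1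

end RingedPoset

/-! ### Maximal points, and fibered products of schematic posets -/

namespace RingedPoset

open PosetDatum

variable {U X Z : RingedPoset.{u}}

section MaximalPoints

variable {K : Type u} [Field K]

/-- A point at `x` with values in a field is maximal if it does not extend to any `y > x`. -/
def IsMaximalPoint {x : X.carrier} (e : X.obj.obj x ⟶ CommRingCat.of K) : Prop :=
  ∀ (y : X.carrier) (h : x ≤ y) (e' : X.obj.obj y ⟶ CommRingCat.of K), X.res h ≫ e' = e → x = y

theorem exists_isMaximalPoint {x : X.carrier} (a : X.obj.obj x ⟶ CommRingCat.of K) :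
    ∃ (y : X.carrier) (h : x ≤ y) (e : X.obj.obj y ⟶ CommRingCat.of K),
      X.res h ≫ e = a ∧ IsMaximalPoint e := by
  obtain ⟨y, ⟨h, e, he⟩, hy⟩ := (Set.toFinite {y : X.carrier | ∃ (h : x ≤ y)
    (e : X.obj.obj y ⟶ CommRingCat.of K), X.res h ≫ e = a}).exists_maximal
    ⟨x, le_rfl, a, by rw [X.res_self, Category.id_comp]⟩
  refine ⟨y, h, e, he, fun z hz e' he' => le_antisymm hz (hy ⟨h.trans hz, e', ?_⟩ hz)⟩
  rw [← X.res_comp h hz, Category.assoc, he', he]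

theorem MergesPoints.exists_isMaximalPoint (hX : X.MergesPoints) {t x y : X.carrier} (hx : t ≤ x)
    (hy : t ≤ y) (a : X.obj.obj x ⟶ CommRingCat.of K) (b : X.obj.obj y ⟶ CommRingCat.of K)
    (h : X.res hx ≫ a = X.res hy ≫ b) : ∃ (z : X.carrier) (hz : x ≤ z) (hz' : y ≤ z)
      (e : X.obj.obj z ⟶ CommRingCat.of K),
      X.res hz ≫ e = a ∧ X.res hz' ≫ e = b ∧ IsMaximalPoint e := by
  obtain ⟨z, hz, hz', c, rfl, rfl⟩ := hX hx hy K a b h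
  obtain ⟨w, hw, e, rfl, he⟩ := RingedPoset.exists_isMaximalPoint c
  exact ⟨w, hz.trans hw, hz'.trans hw, e, by rw [← X.res_comp hz hw, Category.assoc],
    by rw [← X.res_comp hz' hw, Category.assoc], he⟩

/-- Points below a maximal point lift to points lying exactly over it. -/
theorem LiftsPoints.exists_over_maximal {f : U ⟶ X} (hf : LiftsPoints f) {x : X.carrier}
    {e : X.obj.obj x ⟶ CommRingCat.of K} (he : IsMaximalPoint e) {u : U.carrier}
    (hu : f.base u ≤ x) (a : U.obj.obj u ⟶ CommRingCat.of K)
    (h : f.sharp u ≫ a = X.res hu ≫ e) :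
    ∃ (v : U.carrier) (_ : u ≤ v) (hx : f.base v = x) (c : U.obj.obj v ⟶ CommRingCat.of K),
      U.res ‹u ≤ v› ≫ c = a ∧ X.res hx.ge ≫ f.sharp v ≫ c = e := by
  obtain ⟨v, hv, hxv, c, hc, hc'⟩ := hf u hu K a e h
  exact ⟨v, hv, (he _ hxv _ hc').symm, c, hc, hc'⟩

end MaximalPoints

section FiberProduct

variable (f : U ⟶ X) (g : Z ⟶ X)

/-- The first coprojection to a value of the fibered product. -/
noncomputable def fpInl (p : (fiberProduct f g).carrier) :
    U.obj.obj p.1.1 ⟶ (fiberProduct f g).obj.obj p :=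
  pushout.inl _ _

/-- The second coprojection to a value of the fibered product. -/
noncomputable def fpInr (p : (fiberProduct f g).carrier) :
    Z.obj.obj p.1.2 ⟶ (fiberProduct f g).obj.obj p :=
  pushout.inr _ _

variable {f g}

theorem fp_condition (p : (fiberProduct f g).carrier) :
    f.sharp p.1.1 ≫ fpInl f g p = X.res p.2.le ≫ g.sharp p.1.2 ≫ fpInr f g p :=
  pushout.condition.trans (Category.assoc _ _ _)

theorem fp_hom_ext {p : (fiberProduct f g).carrier} {R : CommRingCat.{u}}
    {a b : (fiberProduct f g).obj.obj p ⟶ R} (h : fpInl f g p ≫ a = fpInl f g p ≫ b)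
    (h' : fpInr f g p ≫ a = fpInr f g p ≫ b) : a = b :=
  pushout.hom_ext h h'

theorem fp_exists_desc (p : (fiberProduct f g).carrier) {R : CommRingCat.{u}}
    (a : U.obj.obj p.1.1 ⟶ R) (b : Z.obj.obj p.1.2 ⟶ R)
    (h : f.sharp p.1.1 ≫ a = X.res p.2.le ≫ g.sharp p.1.2 ≫ b) :
    ∃ c : (fiberProduct f g).obj.obj p ⟶ R, fpInl f g p ≫ c = a ∧ fpInr f g p ≫ c = b :=
  ⟨pushout.desc a b (h.trans (Category.assoc _ _ _).symm), pushout.inl_desc _ _ _,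
    pushout.inr_desc _ _ _⟩

theorem fpInl_res {p q : (fiberProduct f g).carrier} (h : p ≤ q) :
    fpInl f g p ≫ (fiberProduct f g).res h = U.res h.1 ≫ fpInl f g q :=
  pushout.inl_desc _ _ _

theorem fpInr_res {p q : (fiberProduct f g).carrier} (h : p ≤ q) :
    fpInr f g p ≫ (fiberProduct f g).res h = Z.res h.2 ≫ fpInr f g q :=
  pushout.inr_desc _ _ _

theorem fp_epi_res (hU : ∀ {x y : U.carrier} (h : x ≤ y), Epi (U.res h))
    (hZ : ∀ {x y : Z.carrier} (h : x ≤ y), Epi (Z.res h)) {p q : (fiberProduct f g).carrier}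
    (h : p ≤ q) : Epi ((fiberProduct f g).res h) := by
  refine ⟨fun {R} a b e => fp_hom_ext ?_ ?_⟩
  · have := hU h.1
    rw [← cancel_epi (U.res h.1), ← Category.assoc, ← Category.assoc, ← fpInl_res h,
      Category.assoc, Category.assoc, e]
  · have := hZ h.2
    rw [← cancel_epi (Z.res h.2), ← Category.assoc, ← Category.assoc, ← fpInr_res h,
      Category.assoc, Category.assoc, e]

/-- Since the restrictions of `X` are epimorphisms, the value at `q` may be formed over the smaller
base point. It is `(𝒪_p ⊗ 𝒪_{U, q₁}) ⊗ 𝒪_{Z, q₂}`, so the restriction is, up to isomorphism, a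
composite of two base changes of flat maps. -/
theorem fp_flat_res (hU : ∀ {x y : U.carrier} (h : x ≤ y), (U.res h).hom.Flat)
    (hZ : ∀ {x y : Z.carrier} (h : x ≤ y), (Z.res h).hom.Flat)
    (hX : ∀ {x y : X.carrier} (h : x ≤ y), Epi (X.res h)) {p q : (fiberProduct f g).carrier}
    (h : p ≤ q) : ((fiberProduct f g).res h).hom.Flat := by
  let α := pushout.inl (fpInl f g p) (U.res h.1)
  let α' := pushout.inr (fpInl f g p) (U.res h.1)
  let β := pushout.inl (fpInr f g p ≫ α) (Z.res h.2)
  let β' := pushout.inr (fpInr f g p ≫ α) (Z.res h.2)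
  have hα : fpInl f g p ≫ α = U.res h.1 ≫ α' := pushout.condition
  have hβ : fpInr f g p ≫ α ≫ β = Z.res h.2 ≫ β' := by
    rw [← Category.assoc]; exact pushout.condition
  let ρ := pushout.desc ((fiberProduct f g).res h) (fpInl f g q) (fpInl_res h)
  have hρ : α ≫ ρ = (fiberProduct f g).res h := pushout.inl_desc _ _ _
  have hρ' : α' ≫ ρ = fpInl f g q := pushout.inr_desc _ _ _
  let π := pushout.desc ρ (fpInr f g q) (by
    rw [Category.assoc, hρ]; exact fpInr_res h)
  have hπ : β ≫ π = ρ := pushout.inl_desc _ _ _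
  have hπ' : β' ≫ π = fpInr f g q := pushout.inr_desc _ _ _
  obtain ⟨σ, hσ, hσ'⟩ := fp_exists_desc q (α' ≫ β) β' (by
    have := hX (f.mono h.1)
    have h1 := f.naturality h.1
    have h2 := res_sharp_res g p.2.le h.2 ((f.mono h.1).trans q.2.le)
    rw [← cancel_epi (X.res (f.mono h.1)), ← Category.assoc, h1, Category.assoc,
      ← Category.assoc (U.res h.1), ← hα, ← Category.assoc (X.res (f.mono h.1)), X.res_comp,
      ← Category.assoc (X.res _) (g.sharp _), ← h2]
    simp only [Category.assoc]
    rw [← hβ, ← Category.assoc, fp_condition]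
    simp only [Category.assoc])
  have h1 : π ≫ σ = 𝟙 _ := by
    refine pushout.hom_ext ?_ ?_
    · rw [Category.comp_id]
      refine (Category.assoc β π σ).symm.trans ?_
      rw [hπ]
      refine pushout.hom_ext ?_ ?_
      · refine (Category.assoc α ρ σ).symm.trans ?_
        rw [hρ]
        refine fp_hom_ext ?_ ?_
        · rw [← Category.assoc, fpInl_res, Category.assoc, hσ, ← Category.assoc, ← hα,
            Category.assoc]
        · rw [← Category.assoc, fpInr_res, Category.assoc, hσ', ← hβ]
      · refine (Category.assoc α' ρ σ).symm.trans ?_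
        rw [hρ', hσ]
    · rw [Category.comp_id]
      refine (Category.assoc β' π σ).symm.trans ?_
      rw [hπ', hσ']
  have h2 : σ ≫ π = 𝟙 _ := by
    refine fp_hom_ext ?_ ?_
    · rw [← Category.assoc, hσ, Category.assoc, hπ, hρ', Category.comp_id]
    · rw [← Category.assoc, hσ', hπ', Category.comp_id]
  have : IsIso π := ⟨σ, h1, h2⟩
  have h3 : (fiberProduct f g).res h = α ≫ β ≫ π := by rw [hπ, hρ]
  rw [h3]
  exact CommRingCat.flat_comp (CommRingCat.flat_pushout_inl _ _ (hU h.1))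
    (CommRingCat.flat_comp (CommRingCat.flat_pushout_inl _ _ (hZ h.2)) (CommRingCat.flat_of_isIso π))

/-- The coordinates are merged separately, after which their images in `X` may differ. Passing to a
maximal point of `X` above both and lifting to it makes the images equal. -/
theorem fp_mergesPoints (hX : X.MergesPoints) (hU : U.MergesPoints) (hZ : Z.MergesPoints)
    (hf : LiftsPoints f) (hg : LiftsPoints g) :
    MergesPoints (fiberProduct f g) := by
  intro t x y hx hy K _ a b hab
  have hab1 : U.res hx.1 ≫ fpInl f g x ≫ a = U.res hy.1 ≫ fpInl f g y ≫ b := by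
    rw [← Category.assoc, ← Category.assoc, ← fpInl_res hx, ← fpInl_res hy, Category.assoc,
      Category.assoc, hab]
  have hab2 : Z.res hx.2 ≫ fpInr f g x ≫ a = Z.res hy.2 ≫ fpInr f g y ≫ b := by
    rw [← Category.assoc, ← Category.assoc, ← fpInr_res hx, ← fpInr_res hy, Category.assoc,
      Category.assoc, hab]
  obtain ⟨z₁, hxz, hyz, c₁, hc, hc'⟩ := hU hx.1 hy.1 K _ _ hab1
  obtain ⟨z₂, hxz', hyz', c₂, hd, hd'⟩ := hZ hx.2 hy.2 K _ _ hab2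
  have ht1 : f.base t.1.1 ≤ f.base z₁ := f.mono (hx.1.trans hxz)
  have ht2 : f.base t.1.1 ≤ g.base z₂ := t.2.le.trans (g.mono (hx.2.trans hxz'))
  obtain ⟨x₃, h1, h2, e, he1, he2, he⟩ := MergesPoints.exists_isMaximalPoint hX ht1 ht2
    (f.sharp z₁ ≫ c₁) (g.sharp z₂ ≫ c₂) (by
      have e1 := f.naturality (hx.1.trans hxz)
      have e2 := res_sharp_res g t.2.le (hx.2.trans hxz') ht2
      rw [← Category.assoc, e1, ← Category.assoc (X.res ht2), ← e2]
      simp only [Category.assoc]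
      rw [← U.res_comp hx.1 hxz, ← Z.res_comp hx.2 hxz', Category.assoc, Category.assoc, hc, hd,
        ← Category.assoc (U.res _), ← Category.assoc (Z.res _), ← fpInl_res hx, ← fpInr_res hx,
        Category.assoc, Category.assoc, ← Category.assoc, fp_condition]
      simp only [Category.assoc])
  obtain ⟨v₁, hv1, rfl, d₁, hd1, hd1'⟩ := hf.exists_over_maximal he h1 c₁ he1.symm
  obtain ⟨v₂, hv2, hvv, d₂, hd2, hd2'⟩ := hg.exists_over_maximal he h2 c₂ he2.symm
  rw [X.res_self, Category.id_comp] at hd1'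
  let v : (fiberProduct f g).carrier := ⟨(v₁, v₂), hvv.symm⟩
  obtain ⟨c, hcl, hcr⟩ := fp_exists_desc v d₁ d₂ (hd1'.trans hd2'.symm)
  have hxv : x ≤ v := ⟨hxz.trans hv1, hxz'.trans hv2⟩
  have hyv : y ≤ v := ⟨hyz.trans hv1, hyz'.trans hv2⟩
  refine ⟨v, hxv, hyv, c, fp_hom_ext ?_ ?_, fp_hom_ext ?_ ?_⟩
  · rw [← Category.assoc, fpInl_res, Category.assoc, hcl, ← hc, ← hd1, ← Category.assoc,
      U.res_comp]
  · rw [← Category.assoc, fpInr_res, Category.assoc, hcr, ← hd, ← hd2, ← Category.assoc,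
      Z.res_comp]
  · rw [← Category.assoc, fpInl_res, Category.assoc, hcl, ← hc', ← hd1, ← Category.assoc,
      U.res_comp]
  · rw [← Category.assoc, fpInr_res, Category.assoc, hcr, ← hd', ← hd2, ← Category.assoc,
      Z.res_comp]

theorem isPointwiseSchematic_fiberProduct (hX : X.IsPointwiseSchematic)
    (hU : U.IsPointwiseSchematic) (hZ : Z.IsPointwiseSchematic) (hf : LiftsPoints f)
    (hg : LiftsPoints g) : IsPointwiseSchematic (fiberProduct f g) :=
  ⟨fp_flat_res hU.flat hZ.flat hX.epi, fp_epi_res hU.epi hZ.epi,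
    fp_mergesPoints hX.merges hU.merges hZ.merges hf hg⟩

end FiberProduct

/-! ### The diagonal and the pointwise description of flat immersions -/

section Diagonal

variable {f : U ⟶ X}

theorem fpInl_diag (u : U.carrier) : fpInl f f ((diag f).base u) ≫ (diag f).sharp u = 𝟙 _ :=
  pushout.inl_desc _ _ _

theorem fpInr_diag (u : U.carrier) : fpInr f f ((diag f).base u) ≫ (diag f).sharp u = 𝟙 _ :=
  pushout.inr_desc _ _ _

theorem fpInl_res_diag {p : (fiberProduct f f).carrier} {u : U.carrier}
    (h : p ≤ (diag f).base u) :
    fpInl f f p ≫ (fiberProduct f f).res h ≫ (diag f).sharp u = U.res h.1 := by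
  rw [← Category.assoc, fpInl_res, Category.assoc]
  exact (congrArg (U.res h.1 ≫ ·) (fpInl_diag u)).trans (Category.comp_id _)

theorem fpInr_res_diag {p : (fiberProduct f f).carrier} {u : U.carrier}
    (h : p ≤ (diag f).base u) :
    fpInr f f p ≫ (fiberProduct f f).res h ≫ (diag f).sharp u = U.res h.2 := by
  rw [← Category.assoc, fpInr_res, Category.assoc]
  exact (congrArg (U.res h.2 ≫ ·) (fpInr_diag u)).trans (Category.comp_id _)

theorem epi_sharp_diag (u : U.carrier) : Epi ((diag f).sharp u) := by
  refine ⟨fun {R} a b e => ?_⟩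
  have h := congrArg (fpInl f f ((diag f).base u) ≫ ·) e
  simp only [← Category.assoc] at h
  exact (Category.id_comp a).symm.trans ((congrArg (· ≫ a) (fpInl_diag u)).symm.trans
    (h.trans ((congrArg (· ≫ b) (fpInl_diag u)).trans (Category.id_comp b))))

theorem liftsPoints_diag (hU : U.MergesPoints) : LiftsPoints (diag f) := by
  intro u w hw K _ a b hab
  have h1 : U.res hw.1 ≫ fpInl f f w ≫ b = a := by
    have h2 := congrArg (fpInl f f ((diag f).base u) ≫ ·) hab
    simp only [← Category.assoc] at h2
    rw [fpInl_diag, fpInl_res hw] at h2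
    rw [← Category.assoc]
    exact h2.symm.trans (Category.id_comp a)
  have h2 : U.res hw.2 ≫ fpInr f f w ≫ b = a := by
    have h2 := congrArg (fpInr f f ((diag f).base u) ≫ ·) hab
    simp only [← Category.assoc] at h2
    rw [fpInr_diag, fpInr_res hw] at h2
    rw [← Category.assoc]
    exact h2.symm.trans (Category.id_comp a)
  obtain ⟨z, hz, hz', c, hc, hc'⟩ := hU hw.1 hw.2 K _ _ (h1.trans h2.symm)
  have hwz : w ≤ (diag f).base z := ⟨hz, hz'⟩
  refine ⟨z, hw.1.trans hz, hwz, c, ?_, fp_hom_ext ?_ ?_⟩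
  · rw [← h1, ← hc, ← Category.assoc, U.res_comp]
    rfl
  · have h3 := congrArg (· ≫ c) (fpInl_res_diag hwz)
    simp only [Category.assoc] at h3
    exact h3.trans hc
  · have h3 := congrArg (· ≫ c) (fpInr_res_diag hwz)
    simp only [Category.assoc] at h3
    exact h3.trans hc'

end Diagonal

/-- The description of flat immersions in terms of points with values in fields. -/
structure IsPointwiseFlatImmersion (f : U ⟶ X) : Prop where
  lifts : LiftsPoints f
  flat : IsFlat f
  epi : ∀ u, Epi (f.sharp u)
  merges : ∀ {u u' : U.carrier} (h : f.base u = f.base u') (K : Type u) [Field K]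
    (a : U.obj.obj u ⟶ CommRingCat.of K) (b : U.obj.obj u' ⟶ CommRingCat.of K),
    f.sharp u ≫ a = X.res h.le ≫ f.sharp u' ≫ b →
    ∃ (v : U.carrier) (hv : u ≤ v) (hv' : u' ≤ v) (c : U.obj.obj v ⟶ CommRingCat.of K),
      U.res hv ≫ c = a ∧ U.res hv' ≫ c = b

/-- Both new properties come from the diagonal being a qc-isomorphism: points of `U ×_X U` come from
the diagonal, which is merging; and `s ⊗ 1 - 1 ⊗ s` vanishes over the diagonal, hence is zero, which
makes the components epimorphisms. -/
theorem IsFlatImmersion.isPointwise {f : U ⟶ X} (hX : X.IsPointwiseSchematic)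
    (hU : U.IsPointwiseSchematic) (hf : IsFlatImmersion f) : IsPointwiseFlatImmersion f := by
  have hl : LiftsPoints f := (isSchematicHom_iff hU.epi f).1 hf.schematic
  have hW := isPointwiseSchematic_fiberProduct hX hU hU hl hl
  have hd : LiftsPoints (PosetDatum.diag f) := liftsPoints_diag hU.merges
  refine ⟨hl, hf.flat, fun u => ?_, fun {u u'} h K _ a b hab => ?_⟩
  · have h1 : fpInl f f ((PosetDatum.diag f).base u) = fpInr f f ((PosetDatum.diag f).base u) := by
      ext s
      refine sub_eq_zero.1 (hf.diag.eq_zero_of_vanishesOver hW hU hd fun v hv => ?_)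
      rw [map_sub, map_sub, sub_eq_zero]
      have h2 := (fpInl_res_diag hv).trans (fpInr_res_diag hv).symm
      exact congrArg (fun g => g s) h2
    refine ⟨fun {R} a b e => ?_⟩
    obtain ⟨c, rfl, rfl⟩ := fp_exists_desc ((PosetDatum.diag f).base u) a b
      (e.trans ((congrArg (· ≫ f.sharp u ≫ b) (X.res_self (le_refl (f.base u)))).trans
        (Category.id_comp _)).symm)
    exact congrArg (· ≫ c) h1
  · obtain ⟨c, rfl, rfl⟩ := fp_exists_desc (f := f) (g := f) ⟨(u, u'), h⟩ a b hab
    obtain ⟨v, hv, d, rfl⟩ := hf.diag.exists_point hW hd (fun u => epi_sharp_diag u) c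
    refine ⟨v, hv.1, hv.2, d, ?_, ?_⟩
    · have h3 := congrArg (· ≫ d) (fpInl_res_diag hv)
      simp only [Category.assoc] at h3
      exact h3.symm
    · have h3 := congrArg (· ≫ d) (fpInr_res_diag hv)
      simp only [Category.assoc] at h3
      exact h3.symm

/-- The diagonal satisfies `isQcIso_of_flat`: merging for `f` gives surjectivity, and merging in
`U`, after projection to one factor, gives the gluing condition. -/
theorem IsPointwiseFlatImmersion.isFlatImmersion {f : U ⟶ X} (hX : X.IsPointwiseSchematic)
    (hU : U.IsPointwiseSchematic) (hf : IsPointwiseFlatImmersion f) : IsFlatImmersion f := by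
  have hW := isPointwiseSchematic_fiberProduct hX hU hU hf.lifts hf.lifts
  refine ⟨(isSchematicHom_iff hU.epi f).2 hf.lifts, hf.flat, isQcIso_of_flat hU.flat hW.flat hW.epi
    epi_sharp_diag (fun u => ?_) (fun z p => ?_) fun {z y y'} h h' K _ a b hab => ?_⟩
  · have : Epi (fpInl f f ((PosetDatum.diag f).base u)) := by
      have := hf.epi u
      have := hX.epi (le_refl (f.base u))
      exact inferInstanceAs (Epi (pushout.inl (f.sharp u) (X.res (le_refl (f.base u)) ≫ f.sharp u)))
    refine CommRingCat.flat_of_epi_of_flat_comp (fpInl f f ((PosetDatum.diag f).base u)) _ ?_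
    exact (congrArg (fun φ => φ.hom.Flat) (fpInl_diag (f := f) u)).mpr
      (CommRingCat.flat_of_isIso (𝟙 (U.obj.obj u)))
  · obtain ⟨K, _, k, rfl⟩ := CommRingCat.exists_residueField p
    obtain ⟨v, hv, hv', c, hc, hc'⟩ := hf.merges z.2 K (fpInl f f z ≫ k) (fpInr f f z ≫ k) (by
      have := congrArg (· ≫ k) (fp_condition z)
      simpa only [Category.assoc] using this)
    have hzv : z ≤ (diag f).base v := ⟨hv, hv'⟩
    refine ⟨v, hzv, PrimeSpectrum.comap c.hom ⊥, ?_⟩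
    rw [← PrimeSpectrum.comap_comp_apply, ← CommRingCat.hom_comp]
    congr 2
    refine fp_hom_ext ?_ ?_
    · have h3 := congrArg (· ≫ c) (fpInl_res_diag hzv)
      simp only [Category.assoc] at h3
      exact (congrArg (fpInl f f z ≫ ·) (Category.assoc _ _ c)).trans (h3.trans hc)
    · have h3 := congrArg (· ≫ c) (fpInr_res_diag hzv)
      simp only [Category.assoc] at h3
      exact (congrArg (fpInr f f z ≫ ·) (Category.assoc _ _ c)).trans (h3.trans hc')
  · refine hU.merges h.1 h'.1 K a b ?_
    have h1 := congrArg (· ≫ a) (fpInl_res_diag h)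
    have h2 := congrArg (· ≫ b) (fpInl_res_diag h')
    simp only [Category.assoc] at h1 h2
    exact h1.symm.trans ((congrArg (fpInl f f z ≫ ·) hab).trans h2)

end RingedPoset

/-! ### Wide pushouts of flat epimorphisms -/

namespace CommRingCat

variable {J : Type u} {A : CommRingCat.{u}} {B : J → CommRingCat.{u}} (φ : ∀ j, A ⟶ B j)

theorem epi_widePushout_head [∀ j, Epi (φ j)] : Epi (WidePushout.head φ) := by
  refine ⟨fun {R} a b e => WidePushout.hom_ext φ a b (fun j => ?_) e⟩
  rw [← cancel_epi (φ j), ← Category.assoc, ← Category.assoc, WidePushout.arrow_ι, e]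

theorem exists_widePushout_desc [∀ j, Epi (φ j)] {R : CommRingCat.{u}} (a : A ⟶ R)
    (h : ∀ j, ∃ b, φ j ≫ b = a) : ∃ c, WidePushout.head φ ≫ c = a := by
  choose b hb using h
  exact ⟨WidePushout.desc a b hb, WidePushout.head_desc _ _ _ _⟩

/-- Adjoining the factors one at a time gives a flat epimorphism `η`. Among epimorphisms, mutual
factorization is enough for an isomorphism, so only existence of factorizations is carried through
the induction. -/
theorem flat_widePushout_head [Finite J] [∀ j, Epi (φ j)] (h : ∀ j, (φ j).hom.Flat) :
    (WidePushout.head φ).hom.Flat := by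
  classical
  have key : ∀ s : Finset J, ∃ (P : CommRingCat.{u}) (η : A ⟶ P), Epi η ∧ η.hom.Flat ∧
      (∀ j ∈ s, ∃ b, φ j ≫ b = η) ∧ ∀ (R : CommRingCat.{u}) (a : A ⟶ R),
        (∀ j ∈ s, ∃ b, φ j ≫ b = a) → ∃ c, η ≫ c = a := by
    intro s
    induction s using Finset.induction_on with
    | empty =>
      exact ⟨A, 𝟙 A, inferInstance, flat_of_isIso (𝟙 A), by simp,
        fun R a _ => ⟨a, Category.id_comp a⟩⟩
    | insert j s _ ih =>
      obtain ⟨P, η, _, hflat, hι, hdesc⟩ := ih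
      refine ⟨pushout η (φ j), η ≫ pushout.inl η (φ j), inferInstance,
        flat_comp hflat (flat_pushout_inl _ _ (h j)), fun i hi => ?_, fun R a ha => ?_⟩
      · obtain rfl | hi := Finset.mem_insert.1 hi
        · exact ⟨pushout.inr _ _, pushout.condition.symm⟩
        · obtain ⟨b, rfl⟩ := hι i hi
          exact ⟨b ≫ pushout.inl _ _, (Category.assoc _ _ _).symm⟩
      · obtain ⟨c, rfl⟩ := hdesc R a fun i hi => ha i (Finset.mem_insert_of_mem hi)
        obtain ⟨b, hb⟩ := ha j (Finset.mem_insert_self j s)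
        exact ⟨pushout.desc c b hb.symm, by rw [Category.assoc, pushout.inl_desc]⟩
  have := Fintype.ofFinite J
  obtain ⟨P, η, _, hflat, hι, hdesc⟩ := key Finset.univ
  have := epi_widePushout_head φ
  obtain ⟨c, hc⟩ := hdesc _ (WidePushout.head φ) fun j _ => ⟨_, WidePushout.arrow_ι φ j⟩
  obtain ⟨d, hd⟩ := exists_widePushout_desc φ η fun j => hι j (Finset.mem_univ j)
  have : IsIso c := ⟨d, by rw [← cancel_epi η, ← Category.assoc, hc, hd, Category.comp_id],
    by rw [← cancel_epi (WidePushout.head φ), ← Category.assoc, hd, hc, Category.comp_id]⟩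
  rw [← hc]
  exact flat_comp hflat (flat_of_isIso c)

end CommRingCat

/-! ### The cylinder of the nerve datum -/

namespace RingedPoset

open PosetDatum

variable {I : Type u} [Finite I] {X : RingedPoset.{u}} {U : I → RingedPoset.{u}}
  {f : ∀ i, U i ⟶ X}

/-- The `i`-th coordinate of a point of the cylinder of the nerve datum. -/
def cylCoord (c : (cyl (nerve f)).carrier) (i : I) (hi : i ∈ c.idx.1) : (U i).carrier :=
  WidePoint.pt (f := fun i : c.idx.1 => f i.1) c.pt ⟨i, hi⟩

theorem base_cylCoord (c : (cyl (nerve f)).carrier) (i : I) (hi : i ∈ c.idx.1) :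
    (f i).base (cylCoord c i hi) = (cylNerveToBase f).base c :=
  WidePoint.base_pt (f := fun i : c.idx.1 => f i.1) c.pt ⟨i, hi⟩

theorem exists_cyl_point {Δ : Set I} (hΔ : Δ.Nonempty) (x : X.carrier)
    (v : ∀ i ∈ Δ, (U i).carrier) (h : ∀ i hi, (f i).base (v i hi) = x) :
    ∃ c : (cyl (nerve f)).carrier, (cylNerveToBase f).base c = x ∧ ∃ hc : c.idx.1 = Δ,
      ∀ i hi, cylCoord c i hi = v i (hc.subset hi) :=
  ⟨⟨⟨Δ, hΔ⟩, (⟨fun i => v i.1 i.2, x, fun i => h i.1 i.2⟩ : WidePoint fun i : Δ => f i.1)⟩, rfl,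
    rfl, fun _ _ => rfl⟩

theorem cyl_le_iff {c d : (cyl (nerve f)).carrier} :
    c ≤ d ↔ ∃ h : c.idx.1 ⊆ d.idx.1, ∀ i hi, cylCoord c i hi ≤ cylCoord d i (h hi) := by
  constructor
  · rintro ⟨h, h'⟩
    exact ⟨h, fun i hi => h'.1 ⟨i, hi⟩⟩
  · rintro ⟨h, h'⟩
    refine ⟨h, fun i => h' i.1 i.2, ?_⟩
    obtain ⟨i, hi⟩ := c.idx.2
    have h1 := (f i).mono (h' i hi)
    rw [base_cylCoord, base_cylCoord] at h1
    exact h1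

theorem exists_sharp_cylCoord_comp (c : (cyl (nerve f)).carrier) (i : I) (hi : i ∈ c.idx.1) :
    ∃ b, X.res (base_cylCoord c i hi).ge ≫ (f i).sharp (cylCoord c i hi) ≫ b =
      (cylNerveToBase f).sharp c :=
  ⟨WidePushout.ι (WidePoint.arrow (f := fun i : c.idx.1 => f i.1) c.pt) ⟨i, hi⟩,
    (Category.assoc _ _ _).symm.trans (WidePushout.arrow_ι
      (WidePoint.arrow (f := fun i : c.idx.1 => f i.1) c.pt) ⟨i, hi⟩)⟩

section

variable (hX : X.IsPointwiseSchematic) (hf : ∀ i, IsPointwiseFlatImmersion (f i))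
include hX hf

theorem epi_cyl_arrow (c : (cyl (nerve f)).carrier) (i : c.idx.1) :
    Epi (WidePoint.arrow (f := fun i : c.idx.1 => f i.1) c.pt i) := by
  have := hX.epi (WidePoint.base_pt (f := fun i : c.idx.1 => f i.1) c.pt i).ge
  have := (hf i.1).epi (WidePoint.pt (f := fun i : c.idx.1 => f i.1) c.pt i)
  exact epi_comp _ _

theorem epi_sharp_cyl (c : (cyl (nerve f)).carrier) : Epi ((cylNerveToBase f).sharp c) :=
  have := epi_cyl_arrow hX hf c
  CommRingCat.epi_widePushout_head (WidePoint.arrow (f := fun i : c.idx.1 => f i.1) c.pt)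

theorem exists_cyl_desc (c : (cyl (nerve f)).carrier) {R : CommRingCat.{u}}
    (a : X.obj.obj ((cylNerveToBase f).base c) ⟶ R)
    (h : ∀ i hi, ∃ b, X.res (base_cylCoord c i hi).ge ≫ (f i).sharp (cylCoord c i hi) ≫ b = a) :
    ∃ k, (cylNerveToBase f).sharp c ≫ k = a :=
  have := epi_cyl_arrow hX hf c
  CommRingCat.exists_widePushout_desc (WidePoint.arrow (f := fun i : c.idx.1 => f i.1) c.pt) a
    fun i => (h i.1 i.2).imp fun _ hb => (Category.assoc _ _ _).trans hb

theorem isFlat_cylNerveToBase : IsFlat (cylNerveToBase f) := fun c =>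
  have := epi_cyl_arrow hX hf c
  CommRingCat.flat_widePushout_head (WidePoint.arrow (f := fun i : c.idx.1 => f i.1) c.pt)
    fun i => CommRingCat.flat_comp (hX.flat _) ((hf i.1).flat _)

theorem epi_cyl_res {c d : (cyl (nerve f)).carrier} (h : c ≤ d) :
    Epi ((cyl (nerve f)).res h) := by
  have := epi_sharp_cyl hX hf d
  have := hX.epi ((cylNerveToBase f).mono h)
  have h1 := (cylNerveToBase f).naturality h
  have : Epi ((cylNerveToBase f).sharp c ≫ (cyl (nerve f)).res h) := h1 ▸ epi_comp _ _
  exact epi_of_epi ((cylNerveToBase f).sharp c) _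

theorem flat_cyl_res {c d : (cyl (nerve f)).carrier} (h : c ≤ d) :
    ((cyl (nerve f)).res h).hom.Flat := by
  have := epi_sharp_cyl hX hf c
  refine CommRingCat.flat_of_epi_of_flat_comp ((cylNerveToBase f).sharp c) _ ?_
  rw [← (cylNerveToBase f).naturality h]
  exact CommRingCat.flat_comp (hX.flat _) (isFlat_cylNerveToBase hX hf d)

variable {K : Type u} [Field K]

/-- The values of the cylinder are epimorphic over those of `X`, so compatibility of `K`-points can
be checked in `X`. -/
theorem cyl_res_comp_eq {c d : (cyl (nerve f)).carrier} (h : c ≤ d)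
    {a : (cyl (nerve f)).obj.obj c ⟶ CommRingCat.of K}
    {k : (cyl (nerve f)).obj.obj d ⟶ CommRingCat.of K} {x : X.carrier}
    {e : X.obj.obj x ⟶ CommRingCat.of K} (hc : (cylNerveToBase f).base c ≤ x)
    (hd : x ≤ (cylNerveToBase f).base d) (ha : X.res hc ≫ e = (cylNerveToBase f).sharp c ≫ a)
    (hk : X.res hd ≫ (cylNerveToBase f).sharp d ≫ k = e) : (cyl (nerve f)).res h ≫ k = a := by
  have := epi_sharp_cyl hX hf c
  rw [← cancel_epi ((cylNerveToBase f).sharp c), ← ha, ← hk, ← Category.assoc,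
    ← (cylNerveToBase f).naturality h, Category.assoc, ← Category.assoc (X.res hc), X.res_comp]

theorem exists_coord_over {c : (cyl (nerve f)).carrier}
    (a : (cyl (nerve f)).obj.obj c ⟶ CommRingCat.of K) {x : X.carrier}
    {e : X.obj.obj x ⟶ CommRingCat.of K} (he : IsMaximalPoint e)
    (hc : (cylNerveToBase f).base c ≤ x) (ha : X.res hc ≫ e = (cylNerveToBase f).sharp c ≫ a)
    (i : I) (hi : i ∈ c.idx.1) : ∃ (v : (U i).carrier) (hx : (f i).base v = x)
      (b : (U i).obj.obj v ⟶ CommRingCat.of K),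
      X.res hx.ge ≫ (f i).sharp v ≫ b = e ∧ cylCoord c i hi ≤ v := by
  obtain ⟨b, hb⟩ := exists_sharp_cylCoord_comp c i hi
  have hu : (f i).base (cylCoord c i hi) ≤ x := (base_cylCoord c i hi).le.trans hc
  obtain ⟨v, hv, hx, d, -, hd⟩ := (hf i).lifts.exists_over_maximal he hu (b ≫ a) (by
    have := hX.epi (base_cylCoord c i hi).ge
    rw [← cancel_epi (X.res (base_cylCoord c i hi).ge), ← Category.assoc (X.res _) (X.res hu),
      X.res_comp, ha, ← hb]
    simp only [Category.assoc])
  exact ⟨v, hx, d, hd, hv⟩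

theorem exists_coord_over_common {c c' : (cyl (nerve f)).carrier}
    (a : (cyl (nerve f)).obj.obj c ⟶ CommRingCat.of K)
    (a' : (cyl (nerve f)).obj.obj c' ⟶ CommRingCat.of K) {x : X.carrier}
    {e : X.obj.obj x ⟶ CommRingCat.of K} (he : IsMaximalPoint e)
    (hc : (cylNerveToBase f).base c ≤ x) (hc' : (cylNerveToBase f).base c' ≤ x)
    (ha : X.res hc ≫ e = (cylNerveToBase f).sharp c ≫ a)
    (ha' : X.res hc' ≫ e = (cylNerveToBase f).sharp c' ≫ a')
    (i : I) (hi : i ∈ c.idx.1 ∪ c'.idx.1) : ∃ (v : (U i).carrier) (hx : (f i).base v = x)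
      (b : (U i).obj.obj v ⟶ CommRingCat.of K), X.res hx.ge ≫ (f i).sharp v ≫ b = e ∧
        (∀ hi, cylCoord c i hi ≤ v) ∧ ∀ hi, cylCoord c' i hi ≤ v := by
  by_cases h : i ∈ c.idx.1
  · obtain ⟨v, hx, b, hb, hv⟩ := exists_coord_over hX hf a he hc ha i h
    by_cases h' : i ∈ c'.idx.1
    · obtain ⟨v', hx', b', hb', hv'⟩ := exists_coord_over hX hf a' he hc' ha' i h'
      subst hx
      rw [X.res_self, Category.id_comp] at hb
      -- The merged coordinate `w` could have a larger image, but maximality of `e` forces it to lie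
      -- over the same `x`.
      obtain ⟨w, hw, hw', d, rfl, -⟩ := (hf i).merges hx'.symm K b b' (hb.trans hb'.symm)
      have hd : X.res ((f i).mono hw) ≫ (f i).sharp w ≫ d = e := by
        rw [← hb, ← Category.assoc, (f i).naturality hw, Category.assoc]
      exact ⟨w, (he _ _ _ hd).symm, d, hd, fun _ => hv.trans hw, fun _ => hv'.trans hw'⟩
    · exact ⟨v, hx, b, hb, fun _ => hv, fun hi' => absurd hi' h'⟩
  · obtain ⟨v, hx, b, hb, hv⟩ := exists_coord_over hX hf a' he hc' ha' i (hi.resolve_left h)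
    exact ⟨v, hx, b, hb, fun hi' => absurd hi' h, fun _ => hv⟩

/-- Points of the cylinder below a maximal point of `X` come from a point lying exactly over it. -/
theorem exists_cyl_over_maximal {c c' : (cyl (nerve f)).carrier}
    (a : (cyl (nerve f)).obj.obj c ⟶ CommRingCat.of K)
    (a' : (cyl (nerve f)).obj.obj c' ⟶ CommRingCat.of K) {x : X.carrier}
    {e : X.obj.obj x ⟶ CommRingCat.of K} (he : IsMaximalPoint e)
    (hc : (cylNerveToBase f).base c ≤ x) (hc' : (cylNerveToBase f).base c' ≤ x)
    (ha : X.res hc ≫ e = (cylNerveToBase f).sharp c ≫ a)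
    (ha' : X.res hc' ≫ e = (cylNerveToBase f).sharp c' ≫ a') :
    ∃ (d : (cyl (nerve f)).carrier) (hd : c ≤ d) (hd' : c' ≤ d)
      (hx : x ≤ (cylNerveToBase f).base d) (k : (cyl (nerve f)).obj.obj d ⟶ CommRingCat.of K),
      (cyl (nerve f)).res hd ≫ k = a ∧ (cyl (nerve f)).res hd' ≫ k = a' ∧
        X.res hx ≫ (cylNerveToBase f).sharp d ≫ k = e := by
  choose v hv b hb hle hle' using exists_coord_over_common hX hf a a' he hc hc' ha ha'
  -- The index of `d` is the union of the two index sets. All chosen coordinates lie exactly over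
  -- `x`, so they define a point of the fibered product.
  obtain ⟨d, rfl, hΔ, hd⟩ := exists_cyl_point (c.idx.2.mono Set.subset_union_left) x v hv
  obtain ⟨k, hk⟩ := exists_cyl_desc hX hf d e fun i hi => by
    have h1 : ∃ (hx : (f i).base (cylCoord d i hi) = (cylNerveToBase f).base d)
        (b : (U i).obj.obj (cylCoord d i hi) ⟶ CommRingCat.of K),
        X.res hx.ge ≫ (f i).sharp (cylCoord d i hi) ≫ b = e := by
      rw [hd i hi]
      exact ⟨hv i (hΔ.subset hi), b i (hΔ.subset hi), hb i (hΔ.subset hi)⟩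
    exact h1.2
  have hk' : X.res le_rfl ≫ (cylNerveToBase f).sharp d ≫ k = e := by
    rw [X.res_self, Category.id_comp, hk]
  have h1 : c ≤ d := cyl_le_iff.2 ⟨Set.subset_union_left.trans hΔ.superset, fun i hi => by
    rw [hd]; exact hle i _ hi⟩
  have h2 : c' ≤ d := cyl_le_iff.2 ⟨Set.subset_union_right.trans hΔ.superset, fun i hi => by
    rw [hd]; exact hle' i _ hi⟩
  exact ⟨d, h1, h2, le_rfl, k, cyl_res_comp_eq hX hf h1 hc le_rfl ha hk',
    cyl_res_comp_eq hX hf h2 hc' le_rfl ha' hk', hk'⟩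

theorem exists_cyl_over_coord (i : I) (v : (U i).carrier) {R : CommRingCat.{u}}
    (b : (U i).obj.obj v ⟶ R) : ∃ (d : (cyl (nerve f)).carrier)
      (h : (cylNerveToBase f).base d = (f i).base v) (k : (cyl (nerve f)).obj.obj d ⟶ R),
      X.res h.ge ≫ (cylNerveToBase f).sharp d ≫ k = (f i).sharp v ≫ b := by
  obtain ⟨d, hx, hΔ, hd⟩ := exists_cyl_point (f := f) (Set.singleton_nonempty i) ((f i).base v)
    (fun j hj => (show i = j from hj.symm) ▸ v) (fun j hj => by obtain rfl : j = i := hj; rfl)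
  obtain ⟨k, hk⟩ := exists_cyl_desc hX hf d (X.res hx.le ≫ (f i).sharp v ≫ b) fun j hj => by
    obtain rfl : j = i := hΔ.subset hj
    have h1 : ∃ (h : (f j).base (cylCoord d j hj) = (cylNerveToBase f).base d)
        (b' : (U j).obj.obj (cylCoord d j hj) ⟶ R),
        X.res h.ge ≫ (f j).sharp (cylCoord d j hj) ≫ b' = X.res hx.le ≫ (f j).sharp v ≫ b := by
      rw [hd j hj]
      exact ⟨hx.symm, b, rfl⟩
    exact h1.2
  refine ⟨d, hx, k, ?_⟩
  rw [hk, ← Category.assoc, X.res_comp, X.res_self, Category.id_comp]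

/-- Merging holds under the weaker assumption of agreement in `X`. It therefore serves the cylinder
being schematic, the flat immersion property and the qc-isomorphism criterion alike. -/
theorem exists_cyl_merge {x : X.carrier} {c c' : (cyl (nerve f)).carrier}
    (hc : x ≤ (cylNerveToBase f).base c) (hc' : x ≤ (cylNerveToBase f).base c')
    (a : (cyl (nerve f)).obj.obj c ⟶ CommRingCat.of K)
    (a' : (cyl (nerve f)).obj.obj c' ⟶ CommRingCat.of K)
    (h : X.res hc ≫ (cylNerveToBase f).sharp c ≫ a =
      X.res hc' ≫ (cylNerveToBase f).sharp c' ≫ a') :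
    ∃ (d : (cyl (nerve f)).carrier) (hd : c ≤ d) (hd' : c' ≤ d)
      (k : (cyl (nerve f)).obj.obj d ⟶ CommRingCat.of K),
      (cyl (nerve f)).res hd ≫ k = a ∧ (cyl (nerve f)).res hd' ≫ k = a' := by
  obtain ⟨z, hz, hz', e, h1, h2, he⟩ := MergesPoints.exists_isMaximalPoint hX.merges hc hc' _ _ h
  obtain ⟨d, hd, hd', -, k, hk, hk', -⟩ := exists_cyl_over_maximal hX hf a a' he hz hz' h1 h2
  exact ⟨d, hd, hd', k, hk, hk'⟩

theorem liftsPoints_cyl : LiftsPoints (cylNerveToBase f) := by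
  intro c x hx K _ a b h
  obtain ⟨z, hz, e, rfl, he⟩ := exists_isMaximalPoint b
  rw [← Category.assoc, X.res_comp] at h
  obtain ⟨d, hd, -, hzd, k, hk, -, rfl⟩ :=
    exists_cyl_over_maximal hX hf a a he (hx.trans hz) (hx.trans hz) h.symm h.symm
  exact ⟨d, hd, hz.trans hzd, k, hk, by rw [← X.res_comp hz hzd, Category.assoc]⟩

theorem isPointwiseSchematic_cyl : IsPointwiseSchematic (cyl (nerve f)) := by
  refine ⟨flat_cyl_res hX hf, epi_cyl_res hX hf, fun {t c c'} hc hc' K _ a b h => ?_⟩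
  refine exists_cyl_merge hX hf ((cylNerveToBase f).mono hc) ((cylNerveToBase f).mono hc') a b ?_
  have h1 := congrArg ((cylNerveToBase f).sharp t ≫ ·) h
  simp only [← Category.assoc] at h1 ⊢
  rw [(cylNerveToBase f).naturality hc, (cylNerveToBase f).naturality hc']
  exact h1

theorem isPointwiseFlatImmersion_cyl : IsPointwiseFlatImmersion (cylNerveToBase f) := by
  refine ⟨liftsPoints_cyl hX hf, isFlat_cylNerveToBase hX hf, epi_sharp_cyl hX hf,
    fun {c c'} h K _ a b hab => ?_⟩
  refine exists_cyl_merge hX hf le_rfl h.le a b ?_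
  rw [X.res_self, Category.id_comp, hab]

/-- A prime at `x` has the same image in `Spec X` as a prime coming from some `U_i`, so both come
from a prime above. Lifting it as a field-valued point along `f i` gives a point of `U_i`, hence one
of the cylinder at `Δ = {i}`. -/
theorem isQcIso_cyl_of_surjective
    (hs : ∀ p : X.spec, ∃ (i : I) (q : (U i).spec), (specMap (f i)).base q = p) :
    IsQcIso (cylNerveToBase f) := by
  refine isQcIso_of_flat (flat_cyl_res hX hf) hX.flat hX.epi (epi_sharp_cyl hX hf)
    (isFlat_cylNerveToBase hX hf) (fun x p => ?_)
    fun h h' K _ a b hab => exists_cyl_merge hX hf h h' a b hab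
  obtain ⟨i, q, hq⟩ := hs ((ι X x).base p)
  obtain ⟨u, q, rfl⟩ := exists_ι_base_eq q
  rw [specMap_base_ι, MergesPoints.ι_base_eq_iff hX.merges] at hq
  obtain ⟨z, hz, hxz, r, hr, rfl⟩ := hq
  obtain ⟨K, _, e, rfl⟩ := CommRingCat.exists_residueField r
  have := (hf i).epi u
  obtain ⟨a, ha, -⟩ := CommRingCat.exists_lift_of_epi ((f i).sharp u) (X.res hz ≫ e) q hr.symm
  obtain ⟨v, -, hzv, b, -, rfl⟩ := (hf i).lifts u hz K a e ha
  obtain ⟨d, hd, k, hk⟩ := exists_cyl_over_coord hX hf i v b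
  refine ⟨d, hxz.trans (hzv.trans hd.ge), PrimeSpectrum.comap k.hom ⊥, ?_⟩
  rw [← PrimeSpectrum.comap_comp_apply, ← PrimeSpectrum.comap_comp_apply, ← CommRingCat.hom_comp,
    ← CommRingCat.hom_comp, ← hk, ← Category.assoc (X.res hzv), X.res_comp, Category.assoc,
    ← Category.assoc (X.res hxz), X.res_comp]

end

/-- The map from each `Spec` of a value of the cylinder to `Spec X` factors through `Spec U_i` for
any `i` in the non-empty set `Δ`. -/
theorem surjective_of_isQcIso_cyl (h : IsQcIso (cylNerveToBase f)) (p : X.spec) :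
    ∃ (i : I) (q : (U i).spec), (specMap (f i)).base q = p := by
  have : IsIso (specMap (cylNerveToBase f)) := h
  have h1 := congrArg (fun g : X.spec ⟶ X.spec => g.base p)
    (IsIso.inv_hom_id (specMap (cylNerveToBase f)))
  obtain ⟨c, q, hq⟩ := exists_ι_base_eq ((inv (specMap (cylNerveToBase f))).base p)
  have h2 : (specMap (cylNerveToBase f)).base ((ι (cyl (nerve f)) c).base q) = p :=
    (congrArg (specMap (cylNerveToBase f)).base hq).trans h1
  rw [specMap_base_ι] at h2
  obtain ⟨i, hi⟩ := c.idx.2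
  obtain ⟨b, hb⟩ := exists_sharp_cylCoord_comp c i hi
  refine ⟨i, (ι (U i) (cylCoord c i hi)).base (PrimeSpectrum.comap b.hom q), ?_⟩
  rw [specMap_base_ι, ← ι_base_comap (base_cylCoord c i hi).ge, ← h2, ← hb, CommRingCat.hom_comp,
    CommRingCat.hom_comp, PrimeSpectrum.comap_comp_apply, PrimeSpectrum.comap_comp_apply]

end RingedPoset

theorem mainTheorem7 {I : Type u} [Finite I] {X : RingedPoset.{u}} {U : I → RingedPoset.{u}}
    (hX : RingedPoset.IsSchematic X) (hU : ∀ i, RingedPoset.IsSchematic (U i))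
    (f : ∀ i, U i ⟶ X) (hf : ∀ i, RingedPoset.IsFlatImmersion (f i)) :
    RingedPoset.IsSchematic (PosetDatum.cyl (PosetDatum.nerve f)) ∧
      RingedPoset.IsFlatImmersion (PosetDatum.cylNerveToBase f) ∧
      (RingedPoset.IsQcIso (PosetDatum.cylNerveToBase f) ↔ RingedPoset.IsCovering f) := by
  have hX' := RingedPoset.isSchematic_iff.1 hX
  have hU' := fun i => RingedPoset.isSchematic_iff.1 (hU i)
  have hf' := fun i => (hf i).isPointwise hX' (hU' i)
  have hC := RingedPoset.isPointwiseSchematic_cyl hX' hf'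
  exact ⟨RingedPoset.isSchematic_iff.2 hC,
    (RingedPoset.isPointwiseFlatImmersion_cyl hX' hf').isFlatImmersion hX' hC,
    fun h => ⟨hf, RingedPoset.surjective_of_isQcIso_cyl h⟩,
    fun h => RingedPoset.isQcIso_cyl_of_surjective hX' hf' h.surjective⟩
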